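/- **Setting.** All objects are indexed by a security parameter $n$; a function $\delta:\mathbb N\to[0,1]$ is negligible if $n^c\delta(n)\to 0$ for every $c\in\mathbb N$. A MAC consists, for each $n$, of a finite key set with a probability distribution and of functions $\mathsf{Mac}_k:\{0,1\}^{\ell(n)}\to\{0,1\}^{t(n)}$ with $\ell,t$ polynomially bounded; verification is canonical, i.e. a tag of a message $m$ is accepted if and only if it equals $\mathsf{Mac}_k(m)$. *Blind unforgeability (BU).* An adversary is a pair $(\mathcal A,\epsilon)$, where $\mathcal A$ is a polynomial-time uniform family of quantum oracle circuits, measured at the end in the computational basis, and $\epsilon:\mathbb N\to[0,1]$ is a (rational-valued) function computable in polynomial time from $1^n$. In the blind forgery experiment a key $k$ is generated, each message is placed independently with probability $\epsilon(n)$ into a random set $B$, and $\mathcal A(1^n)$ is run with quantum oracle $|x\rangle|y\rangle\mapsto|x\rangle|y\oplus B\mathsf{Mac}_k(x)\rangle$, where $B\mathsf{Mac}_k(x)=0^{t(n)}\|1$ if $x\in B$ and $B\mathsf{Mac}_k(x)=\mathsf{Mac}_k(x)\|0$ otherwise. The adversary wins if it outputs $(m,\mathsf{Mac}_k(m))$ with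 $m\in B$. The MAC is BU-secure if every adversary $(\mathcal A,\epsilon)$ wins with negligible probability only, and BU-insecure otherwise. *BZ security.* A MAC is BZ-secure if, for every polynomially bounded $q:\mathbb N\to\mathbb N$ and every (computationally unrestricted) quantum algorithm making $q(n)$ queries to the quantum oracle $|x\rangle|y\rangle\mapsto|x\rangle|y\oplus\mathsf{Mac}_k(x)\rangle$, with $k$ a random key, the probability that the algorithm outputs $q(n)+1$ distinct pairs $(m,\mathsf{Mac}_k(m))$ is negligible. *The construction.* The key is $k=(p,f,g)$ with $p\in\{0,1\}^n$ and $f,g:\{0,1\}^n\to\{0,1\}^n$ uniformly random and independent, and $\mathsf{Mac}_k:\{0,1\}^{n+1}\to\{0,1\}^{2n}$ is $$\mathsf{Mac}_k(x)=\begin{cases}0^{2n}& x=0\|p,\\ 0^n\|f(x')& x=0\|x',\ x'\ne p,\\ g(x'\bmod p)\|f(x')& x=1\|x',\end{cases}$$ where strings are read as binary integers in $x'\bmod p$, and $x'\bmod 0=x'$. **Theorem.** 1. The MAC of the construction is BU-insecure. 2. There exists a BZ-secure MAC which is BU-insecure. -/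

import Mathlib

noncomputable section

namespace BlindForgery

/-- Bit strings of length `n`, written from left to right. -/
abbrev BitString (n : ℕ) : Type := Fin n → Bool

/-- The natural number with binary expansion `x` (most significant bit first). -/
def BitString.toNat {n : ℕ} (x : BitString n) : ℕ := Nat.ofBits fun i => x i.rev

/-- `x mod p`, as a bit string of the same length. Here `x mod 0 = x`. -/
def BitString.mod {n : ℕ} (x p : BitString n) : BitString n :=
  fun i => (x.toNat % p.toNat).testBit i.rev

/-- Bitwise exclusive or. -/
def BitString.xor {n : ℕ} (x y : BitString n) : BitString n := fun i => (x i).xor (y i)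

/-- `f` is bounded by a polynomial. -/
def PolyBounded (f : ℕ → ℕ) : Prop := ∃ p : Polynomial ℕ, ∀ n, f n ≤ p.eval n

/-- A function of the security parameter is negligible if it decays faster than every inverse
polynomial. -/
def Negligible (f : ℕ → ℝ) : Prop :=
  Asymptotics.SuperpolynomialDecay Filter.atTop (fun n : ℕ => (n : ℝ)) f

/-! ### Message authentication codes -/

/-- A deterministic message authentication code for fixed-length messages, with canonical
verification (a tag `t` of `m` is accepted if and only if `t = mac n k m`). Everything is indexed
by the security parameter `n`. -/
structure MAC where
  /-- messages are bit strings of this length -/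
  msgLen : ℕ → ℕ
  /-- tags are bit strings of this length -/
  tagLen : ℕ → ℕ
  msgLen_poly : PolyBounded msgLen
  tagLen_poly : PolyBounded tagLen
  Key : ℕ → Type
  [keyFintype : ∀ n, Fintype (Key n)]
  keyGen : ∀ n, PMF (Key n)
  mac : ∀ n, Key n → BitString (msgLen n) → BitString (tagLen n)

attribute [instance] MAC.keyFintype

/-- The pair `(m, t)` is accepted under the key `k`. -/
def MAC.Ver (M : MAC) {n : ℕ} (k : M.Key n)
    (mt : BitString (M.msgLen n) × BitString (M.tagLen n)) : Prop :=
  M.mac n k mt.1 = mt.2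

/-- Expectation over a key produced by key generation. -/
def MAC.expectKey (M : MAC) (n : ℕ) (φ : M.Key n → ℝ) : ℝ :=
  ∑ k : M.Key n, (M.keyGen n k).toReal * φ k

/-! ### Quantum circuits with oracle gates -/

/-- The gates of a quantum oracle circuit. Wires are numbered `0, 1, 2, …`. The gates `had`, `t`
and `cnot` (Clifford + T) already form a universal set. -/
inductive Gate where
  | had (i : ℕ)
  | t (i : ℕ)
  | not (i : ℕ)
  | cnot (c i : ℕ)
  | toffoli (c d i : ℕ)
  | query

/-- A quantum oracle circuit: its gates, in the order in which they are applied. -/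
abbrev Circuit : Type := List Gate

/-- A number larger than all wires that a gate mentions. -/
def Gate.bound : Gate → ℕ
  | had i => i + 1
  | t i => i + 1
  | not i => i + 1
  | cnot c i => max (c + 1) (i + 1)
  | toffoli c d i => max (max (c + 1) (d + 1)) (i + 1)
  | query => 0

/-- A number larger than all wires that the gates of a circuit mention. -/
def circuitBound (C : Circuit) : ℕ := C.foldr (fun g r => max g.bound r) 0

/-- A (pure, not necessarily normalized) state of `w` qubits in the computational basis. -/
abbrev QState (w : ℕ) : Type := BitString w → ℂ

/-- The bit on wire `i`. -/
def getWire {w : ℕ} (b : BitString w) (i : ℕ) : Bool := if h : i < w then b ⟨i, h⟩ else false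

/-- Replace the bit on wire `i` by `v`. -/
def setWire {w : ℕ} (b : BitString w) (i : ℕ) (v : Bool) : BitString w :=
  fun j => if (j : ℕ) = i then v else b j

/-- The query input register: wires `0, …, m - 1`. -/
def regX (m : ℕ) {w : ℕ} (b : BitString w) : BitString m := fun i => getWire b i

/-- The query output register: wires `m, …, m + s - 1`. -/
def regY (m s : ℕ) {w : ℕ} (b : BitString w) : BitString s := fun i => getWire b (m + i)

/-- The action `|x⟩|y⟩|z⟩ ↦ |x⟩|y ⊕ F x⟩|z⟩` of an oracle on basis states. -/
def queryBasis {m s w : ℕ} (F : BitString m → BitString s) (b : BitString w) : BitString w :=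
  fun j =>
    if h : m ≤ (j : ℕ) ∧ (j : ℕ) < m + s then (b j).xor (F (regX m b) ⟨(j : ℕ) - m, by omega⟩)
    else b j

/-- The unitary action of a gate, with oracle `F`, on a state, given by the amplitude of the new
state at the basis state `b`. The gates that permute the basis states are involutions. A controlled
gate whose target is one of its controls acts as the identity. -/
def Gate.apply {m s w : ℕ} (F : BitString m → BitString s) (g : Gate) (ψ : QState w) : QState w :=
  match g with
  | had i => fun b =>
      ((1 / Real.sqrt 2 : ℝ) : ℂ) *
        (ψ (setWire b i false) + (if getWire b i then -1 else 1) * ψ (setWire b i true))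
  | t i => fun b =>
      (if getWire b i then Complex.exp (Complex.I * ((Real.pi / 4 : ℝ) : ℂ)) else 1) * ψ b
  | not i => fun b => ψ (setWire b i (!getWire b i))
  | cnot c i => fun b =>
      if c = i then ψ b else ψ (setWire b i ((getWire b i).xor (getWire b c)))
  | toffoli c d i => fun b =>
      if c = i ∨ d = i then ψ b
      else ψ (setWire b i ((getWire b i).xor (getWire b c && getWire b d)))
  | query => fun b => ψ (queryBasis F b)

/-- The number of qubits of a circuit with query registers of `m` and `s` qubits: there are at
least as many ancilla qubits as the circuit uses. -/
def qubits (m s : ℕ) (C : Circuit) : ℕ := m + s + circuitBound C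

/-- The state after running the circuit `C` with oracle `F` on the all-zero state. -/
def runCircuit {m s : ℕ} (F : BitString m → BitString s) (C : Circuit) :
    QState (qubits m s C) :=
  C.foldl (fun ψ g => g.apply F ψ) fun b => if b = fun _ => false then 1 else 0

/-! ### Polynomial-time uniformity -/

/-- The symbols in which circuits are written down. -/
inductive Sym where
  | had | t | not | cnot | toffoli | query
  | one | sep

/-- A wire number in unary, followed by an end marker. -/
def encodeWire (i : ℕ) : List Sym := List.replicate i Sym.one ++ [Sym.sep]

def encodeGate : Gate → List Sym
  | .had i => Sym.had :: encodeWire i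
  | .t i => Sym.t :: encodeWire i
  | .not i => Sym.not :: encodeWire i
  | .cnot c i => Sym.cnot :: (encodeWire c ++ encodeWire i)
  | .toffoli c d i => Sym.toffoli :: (encodeWire c ++ (encodeWire d ++ encodeWire i))
  | .query => [Sym.query]

def encodeCircuit (C : Circuit) : List Sym := C.flatMap encodeGate

/-- A family of circuits is polynomial-time uniform if a Turing machine writes down the `n`-th
circuit on input `1ⁿ` in time polynomial in `n`. -/
def UniformFamily (C : ℕ → Circuit) : Prop :=
  Nonempty (Turing.TM2ComputableInPolyTime Computability.unaryEncodeNat encodeCircuit C)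

/-- `f n` can be computed, in binary, from `1ⁿ` in polynomial time. -/
def EfficientNat (f : ℕ → ℕ) : Prop :=
  Nonempty (Turing.TM2ComputableInPolyTime Computability.unaryEncodeNat Computability.encodeNat f)

/-! ### Blind unforgeability -/

/-- The blinded function `B F`; the blinding symbol is the string `0…01`, and a bit `0` is appended
to all values that are not blinded. -/
def blind {m t : ℕ} (B : Finset (BitString m)) (F : BitString m → BitString t) :
    BitString m → BitString (t + 1) :=
  fun x =>
    if x ∈ B then Fin.snoc (α := fun _ => Bool) (fun _ => false) true
    else Fin.snoc (α := fun _ => Bool) (F x) false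

/-- The probability that `B` is the random set in which every string is placed independently with
probability `ε`. -/
def blindProb {m : ℕ} (ε : ℝ) (B : Finset (BitString m)) : ℝ :=
  ∏ x : BitString m, if x ∈ B then ε else 1 - ε

/-- A polynomial-time uniform quantum adversary together with its efficiently computable blinding
parameter `ε n = num n / den n ∈ [0, 1]`. -/
structure BUAdversary where
  circuit : ℕ → Circuit
  circuit_uniform : UniformFamily circuit
  num : ℕ → ℕ
  den : ℕ → ℕ
  num_efficient : EfficientNat num
  den_efficient : EfficientNat den
  den_pos : ∀ n, 0 < den n
  num_le_den : ∀ n, num n ≤ den n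

def BUAdversary.ε (A : BUAdversary) (n : ℕ) : ℝ := (A.num n : ℝ) / (A.den n : ℝ)

open Classical in
/-- The probability that the circuit `C`, run with the blinded oracle `B Mac_k` and then measured in
the computational basis, outputs an accepted pair `(m, t)` with `m ∈ B`. The message `m` is read off
the query input register, and `t` off the query output register without its last qubit. -/
def forgeProb (M : MAC) {n : ℕ} (C : Circuit) (k : M.Key n)
    (B : Finset (BitString (M.msgLen n))) : ℝ :=
  ∑ b : BitString (qubits (M.msgLen n) (M.tagLen n + 1) C),
    if regX (M.msgLen n) b ∈ B ∧
        M.Ver k (regX (M.msgLen n) b, regY (M.msgLen n) (M.tagLen n) b) then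
      ‖runCircuit (blind B (M.mac n k)) C b‖ ^ 2
    else 0

/-- The probability that the adversary `A` wins the blind forgery experiment. -/
def blindForge (M : MAC) (A : BUAdversary) (n : ℕ) : ℝ :=
  M.expectKey n fun k =>
    ∑ B : Finset (BitString (M.msgLen n)), blindProb (A.ε n) B * forgeProb M (A.circuit n) k B

/-- A MAC is blind-unforgeable if every polynomial-time uniform quantum adversary wins the blind
forgery experiment with at most negligible probability. -/
def BUSecure (M : MAC) : Prop := ∀ A : BUAdversary, Negligible (blindForge M A)

/-! ### Boneh–Zhandry unforgeability -/

/-- Basis of a query input register, a query output register, and a workspace of dimension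
`d + 1`. -/
abbrev QueryBasis (m t d : ℕ) : Type := BitString m × BitString t × Fin (d + 1)

/-- A computationally unrestricted quantum algorithm which makes `q` queries to an oracle
`BitString m → BitString t`: it applies `U q O U (q - 1) O ⋯ U 1 O U 0` to a fixed basis state,
measures, and outputs `q + 1` pairs of strings. -/
structure QueryAlgorithm (m t q : ℕ) where
  workspace : ℕ
  U : ℕ → Matrix.unitaryGroup (QueryBasis m t workspace) ℂ
  out : QueryBasis m t workspace → Fin (q + 1) → BitString m × BitString t

/-- The state of the algorithm after `j` queries to `F` and the unitary that follows them. -/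
def QueryAlgorithm.state {m t q : ℕ} (A : QueryAlgorithm m t q) (F : BitString m → BitString t) :
    ℕ → QueryBasis m t A.workspace → ℂ
  | 0 => (A.U 0).1.mulVec (Pi.single (fun _ => false, fun _ => false, 0) 1)
  | j + 1 => (A.U (j + 1)).1.mulVec fun b => A.state F j (b.1, b.2.1.xor (F b.1), b.2.2)

open Classical in
/-- The probability that `q` queries to `Mac_k` yield `q + 1` distinct input-output pairs of
`Mac_k`. -/
def multiForgeProb (M : MAC) {n q : ℕ} (A : QueryAlgorithm (M.msgLen n) (M.tagLen n) q)
    (k : M.Key n) : ℝ :=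
  ∑ b : QueryBasis (M.msgLen n) (M.tagLen n) A.workspace,
    if Function.Injective (A.out b) ∧ ∀ i, M.Ver k (A.out b i) then
      ‖A.state (M.mac n k) q b‖ ^ 2
    else 0

/-- A MAC is BZ-secure if no adversary that makes polynomially many queries produces, with more than
negligible probability, more distinct valid pairs than it makes queries. -/
def BZSecure (M : MAC) : Prop :=
  ∀ q : ℕ → ℕ, PolyBounded q →
    ∀ A : ∀ n, QueryAlgorithm (M.msgLen n) (M.tagLen n) (q n),
      Negligible fun n => M.expectKey n (multiForgeProb M (A n))

/-! ### The periodic MAC -/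

/-- A key `(p, f, g)` of the periodic MAC. -/
abbrev PeriodicKey (n : ℕ) : Type :=
  BitString n × (BitString n → BitString n) × (BitString n → BitString n)

/-- The tag of `1‖x` is `g (x mod p)‖f x`; the tag of `0‖p` is `0…0`; the tag of `0‖x` with
`x ≠ p` is `0…0‖f x`. -/
def periodicTag {n : ℕ} (k : PeriodicKey n) (m : BitString (n + 1)) : BitString (n + n) :=
  let x : BitString n := Fin.tail m
  if m 0 = true then Fin.append (k.2.2 (x.mod k.1)) (k.2.1 x)
  else if x = k.1 then fun _ => false
  else Fin.append (fun _ => false) (k.2.1 x)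

/-- The MAC with messages of `n + 1` bits, tags of `2 n` bits and a uniformly random key
`(p, f, g)`. -/
def periodicMAC : MAC where
  msgLen n := n + 1
  tagLen n := n + n
  msgLen_poly := ⟨Polynomial.X + 1, fun n => by simp⟩
  tagLen_poly := ⟨Polynomial.X + Polynomial.X, fun n => by simp⟩
  Key := PeriodicKey
  keyFintype := fun _ => inferInstance
  keyGen n := PMF.uniformOfFintype (PeriodicKey n)
  mac _ k m := periodicTag k m

end BlindForgery

end

/-!
**The periodic MAC is not blind-unforgeable.** A single query is enough. The tag of `1‖x` ends with
`f x`, and, if `p ≠ 0`, the tag of `00…0` is `0…0‖f 0`. So the adversary queries `10…0` and forges the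
tag of `00…0`. To get `f 0` alone, it puts the wires that would receive `g (x mod p)` into the uniform
superposition, which is not changed by the query. If every message is blinded with probability `1/2`,
the attack wins when `00…0` is blinded and `10…0` is not (`periodicMAC_not_buSecure`).

**The separating MAC** is `shiftMAC`. Its key consists of a matrix `A`, strings `w` and `p`, and random
functions `g` and `f`. The special message `00‖p` has the tag `0…0`, and the tag of any other `m` is one
structured bit `headBit m` followed by `f m`. For `L (x₁, x₂) = x₁ + A x₂`, this bit is `g (L x)` on
`01‖x`, `g (L x + w) + p · x` on `11‖x`, and `z · w` on `10‖(z, Aᵀ z)`.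

It is not blind-unforgeable (`shiftMAC_not_buSecure`), because three phase queries to the structured bits,
with Hadamard transforms in between, produce the message `00‖p` with constant amplitude. Averaged over
`g`, the product of the phases on `01‖x` and `11‖x'` is supported on `L x + L x' = w`, where it is
`(-1) ^ (p · x')`. The Fourier transform of this constraint is carried by the vectors `(z, Aᵀ z)`, with
signs `(-1) ^ (z · w)`, and these are the phases that the middle query provides; the last transform then
turns `(-1) ^ (p · x')` into `p`. With blinding probability `1/2`, half of the messages have a constant
phase, which only costs a constant factor: the blinding averages each phase `s` to `(1 + s) / 2`. The
special message is blinded independently of everything else, and its tag is known.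

It is secure in the sense of Boneh and Zhandry (`shiftMAC_bzSecure`) by a Fourier analysis in the random
function `f`. In the Fourier basis of the query output register, a query multiplies every basis state by a
character of `f` supported at one point, so that after `q` queries all characters have at most `q` points
in their support. A character that vanishes at one of the points at which `f` is output contributes only a
guess (`expect_ite_mul_norm_sum_sq_le`). Hence a successful adversary outputs the special message, and only
the characters with exactly `q` points in their support matter. Such a character queries every point
once, and its coefficient depends on the structured bits at its support only (`topCoeff_congr`). As long
as no two points of the support have equal arguments of `g`, and none is of the form `10‖(z, Aᵀ z)` with
`z ≠ 0`, these bits are distributed independently of `A`, `w` and `p` (`expect_headBit`). Therefore each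
query exposes the support with probability at most `(q + 1) / 2 ^ n` (`expect_exposed_insert_le`,
`expect_exposed_le`), and otherwise the output is independent of `p` (`expect_special_le`).

The circuit families of both attacks are written down by Turing machines that execute simple scripts
(`ScriptMachine.computable`).
-/

noncomputable section

namespace BlindForgery

/-! ### Script machines: a family of polynomial-time Turing machines -/

/-- An instruction of a script machine that writes words over `Γ`. The machine keeps two unary
counters, and writes its output from right to left. -/
inductive Item (Γ : Type) where
  /-- set up the counters: with input length `n`, the first counter becomes `2 n` if `c` holds and
  `n` otherwise, the second one `2 n` -/
  | load (c : Bool)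
  /-- write a fixed word -/
  | const (w : List Γ)
  /-- with counters `a ≤ b`, write the words `pre ++ oneⁱ ++ [sep]` for `b - a ≤ i < b` -/
  | layer (pre : List Γ) (one sep : Γ)
  /-- with second counter `b`, write the word `pre ++ oneᵇ ++ [sep]` -/
  | single (pre : List Γ) (one sep : Γ)
  /-- set both counters to zero -/
  | clean

/-- The word that an instruction writes when the counters are `a` and `b`. -/
def Item.out {Γ : Type} (a b : ℕ) : Item Γ → List Γ
  | .const w => w
  | .layer pre one sep =>
    (List.range a).flatMap fun i => pre ++ (List.replicate (b - a + i) one ++ [sep])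
  | .single pre one sep => pre ++ (List.replicate b one ++ [sep])
  | _ => []

/-- The instruction leaves the counters alone. -/
def Item.IsWrite {Γ : Type} : Item Γ → Prop
  | .load _ => False
  | .clean => False
  | _ => True

namespace ScriptMachine

/-- The stacks of a script machine. Between two instructions, the counters are kept on the stacks
`inp` and `cnt`, and the stacks `tmp` and `aux` are empty. -/
inductive Stack
  | inp | out | cnt | tmp | aux
  deriving DecidableEq

instance : Fintype Stack :=
  ⟨{.inp, .out, .cnt, .tmp, .aux}, fun x => by cases x <;> decide⟩

/-- Stack alphabets. -/
abbrev Alph (Γ : Type) : Stack → Type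
  | .inp => Bool
  | .out => Γ
  | _ => Unit

/-- The places at which the execution of an instruction can be. -/
inductive Loc
  | start | load | restore | layer | emit | unemit | clean₁ | clean₂
  deriving DecidableEq

instance : Fintype Loc :=
  ⟨{.start, .load, .restore, .layer, .emit, .unemit, .clean₁, .clean₂},
    fun x => by cases x <;> decide⟩

/-- Labels: the number of the current instruction, and the place in it. -/
abbrev Label (len : ℕ) : Type := Fin (len + 1) × Loc

variable {Γ : Type}

/-- Push a word on the output stack, its first letter first. -/
def pushAll {Λ : Type} (w : List Γ) (q : Turing.TM2.Stmt (Alph Γ) Λ Bool) :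
    Turing.TM2.Stmt (Alph Γ) Λ Bool :=
  w.foldr (fun a q => .push Stack.out (fun _ => a) q) q

/-- The number of the next instruction. -/
def nextIdx {len : ℕ} (j : Fin (len + 1)) : Fin (len + 1) :=
  ⟨min (j + 1) len, by omega⟩

/-- The program of the machine. The internal state records whether the last `pop` found a symbol. -/
def prog (s : List (Item Γ)) :
    Label s.length → Turing.TM2.Stmt (Alph Γ) (Label s.length) Bool
  | (j, .start) =>
    match s[(j : ℕ)]? with
    | none => .halt
    | some (.load _) => .goto fun _ => (j, .load)
    | some (.const w) => pushAll w.reverse (.goto fun _ => (nextIdx j, .start))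
    | some (.layer _ _ _) => .goto fun _ => (j, .layer)
    | some (.single _ _ sep) => .push .out (fun _ => sep) (.goto fun _ => (j, .emit))
    | some .clean => .goto fun _ => (j, .clean₁)
  | (j, .load) =>
    .pop .inp (fun _ o => o.isSome) <| .branch id
      (match s[(j : ℕ)]? with
        | some (.load true) =>
          .push .aux (fun _ => ()) (.push .aux (fun _ => ()) (.goto fun _ => (j, .load)))
        | _ => .push .aux (fun _ => ()) (.push .cnt (fun _ => ()) (.goto fun _ => (j, .load))))
      (.goto fun _ => (j, .restore))
  | (j, .restore) =>
    .pop .aux (fun _ o => o.isSome) <| .branch id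
      (.push .inp (fun _ => true) (.push .cnt (fun _ => ()) (.goto fun _ => (j, .restore))))
      (.goto fun _ => (nextIdx j, .start))
  | (j, .layer) =>
    .pop .inp (fun _ o => o.isSome) <| .branch id
      (match s[(j : ℕ)]? with
        | some (.layer _ _ sep) =>
          .push .aux (fun _ => ()) (.pop .cnt (fun v _ => v)
            (.push .out (fun _ => sep) (.goto fun _ => (j, .emit))))
        | _ => .halt)
      (.goto fun _ => (j, .restore))
  | (j, .emit) =>
    .pop .cnt (fun _ o => o.isSome) <|
      match s[(j : ℕ)]? with
      | some (.layer pre one _) => .branch id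
          (.push .tmp (fun _ => ()) (.push .out (fun _ => one) (.goto fun _ => (j, .emit))))
          (pushAll pre.reverse (.goto fun _ => (j, .unemit)))
      | some (.single pre one _) => .branch id
          (.push .tmp (fun _ => ()) (.push .out (fun _ => one) (.goto fun _ => (j, .emit))))
          (pushAll pre.reverse (.goto fun _ => (j, .unemit)))
      | _ => .halt
  | (j, .unemit) =>
    .pop .tmp (fun _ o => o.isSome) <| .branch id
      (.push .cnt (fun _ => ()) (.goto fun _ => (j, .unemit)))
      (match s[(j : ℕ)]? with
        | some (.layer _ _ _) => .goto fun _ => (j, .layer)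
        | _ => .goto fun _ => (nextIdx j, .start))
  | (j, .clean₁) =>
    .pop .inp (fun _ o => o.isSome) <| .branch id
      (.goto fun _ => (j, .clean₁)) (.goto fun _ => (j, .clean₂))
  | (j, .clean₂) =>
    .pop .cnt (fun _ o => o.isSome) <| .branch id
      (.goto fun _ => (j, .clean₂)) (.goto fun _ => (nextIdx j, .start))

/-- The machine that executes a script. -/
def machine (s : List (Item Γ)) : Turing.FinTM2 where
  K := Stack
  k₀ := .inp
  k₁ := .out
  Γ := Alph Γ
  Λ := Label s.length
  main := (0, .start)
  σ := Bool
  initialState := false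
  Γk₀Fin := inferInstanceAs (Fintype Bool)
  m := prog s

/-- Stack contents with given counter values. -/
def stks (a : ℕ) (o : List Γ) (b t d : ℕ) : ∀ k, List (Alph Γ k)
  | .inp => List.replicate a true
  | .out => o
  | .cnt => List.replicate b ()
  | .tmp => List.replicate t ()
  | .aux => List.replicate d ()

variable (a : ℕ) (o : List Γ) (b t d : ℕ)

@[simp] lemma stks_inp : stks a o b t d .inp = List.replicate a true := rfl
@[simp] lemma stks_out : stks a o b t d .out = o := rfl
@[simp] lemma stks_cnt : stks a o b t d .cnt = List.replicate b () := rfl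
@[simp] lemma stks_tmp : stks a o b t d .tmp = List.replicate t () := rfl
@[simp] lemma stks_aux : stks a o b t d .aux = List.replicate d () := rfl

variable {a o b t d}

lemma stepAux_pushAll {Λ : Type} (w : List Γ) (q : Turing.TM2.Stmt (Alph Γ) Λ Bool) (v : Bool)
    (o : List Γ) :
    Turing.TM2.stepAux (pushAll w q) v (stks a o b t d)
      = Turing.TM2.stepAux q v (stks a (w.reverse ++ o) b t d) := by
  induction w generalizing o with
  | nil => rfl
  | cons x w ih =>
    change Turing.TM2.stepAux (.push Stack.out (fun _ => x) (pushAll w q)) v _ = _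
    have h : Function.update (stks a o b t d) Stack.out (x :: o) = stks a (x :: o) b t d := by
      funext k; cases k <;> rfl
    rw [Turing.TM2.stepAux, stks_out, h, ih]
    simp

variable {s : List (Item Γ)}

/-- Configurations of the machine. -/
abbrev Conf (s : List (Item Γ)) : Type := Turing.TM2.Cfg (Alph Γ) (Label s.length) Bool

/-- The machine gets from `c` to `c'` in at most `T` steps. -/
def Run (s : List (Item Γ)) (T : ℕ) (c c' : Conf s) : Prop :=
  ∃ t ≤ T, (flip bind (Turing.TM2.step (prog s)))^[t] (some c) = some c'

lemma Run.refl (c : Conf s) : Run s 0 c c := ⟨0, le_rfl, rfl⟩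

lemma Run.trans {T₁ T₂ : ℕ} {c₁ c₂ c₃ : Conf s} (h₁ : Run s T₁ c₁ c₂) (h₂ : Run s T₂ c₂ c₃) :
    Run s (T₁ + T₂) c₁ c₃ := by
  obtain ⟨t₁, ht₁, e₁⟩ := h₁
  obtain ⟨t₂, ht₂, e₂⟩ := h₂
  exact ⟨t₂ + t₁, by omega, by rw [Function.iterate_add_apply, e₁, e₂]⟩

lemma Run.mono {T₁ T₂ : ℕ} {c₁ c₂ : Conf s} (h : Run s T₁ c₁ c₂) (hT : T₁ ≤ T₂) :
    Run s T₂ c₁ c₂ := by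
  obtain ⟨t, ht, e⟩ := h
  exact ⟨t, ht.trans hT, e⟩

lemma Run.single {l : Label s.length} {v : Bool} {S : ∀ k, List (Alph Γ k)} {c : Conf s}
    (h : Turing.TM2.stepAux (prog s l) v S = c) : Run s 1 ⟨some l, v, S⟩ c :=
  ⟨1, le_rfl, by subst h; rfl⟩

/-- First a step, then a run. -/
lemma Run.cons {l : Label s.length} {v : Bool} {S : ∀ k, List (Alph Γ k)} {c c' : Conf s} {T : ℕ}
    (h : Turing.TM2.stepAux (prog s l) v S = c) (h' : Run s T c c') :
    Run s (T + 1) ⟨some l, v, S⟩ c' :=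
  ((Run.single h).trans h').mono (by omega)

variable {j : Fin (s.length + 1)}

lemma run_restore (v : Bool) (a : ℕ) (o : List Γ) (b d : ℕ) :
    Run s (d + 1) ⟨some (j, .restore), v, stks a o b 0 d⟩
      ⟨some (nextIdx j, .start), false, stks (a + d) o (b + d) 0 0⟩ := by
  induction d generalizing a b v with
  | zero => exact Run.single (by simp [prog])
  | succ d ih =>
    refine Run.cons (c := ⟨some (j, .restore), true, stks (a + 1) o (b + 1) 0 d⟩)
      (by simp [prog, List.replicate_succ]; funext k; cases k <;> rfl) ?_
    have := ih true (a + 1) (b + 1)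
    rwa [show a + 1 + d = a + (d + 1) by omega, show b + 1 + d = b + (d + 1) by omega] at this

/-- The factors by which `load` multiplies the input length. -/
def loadFactor (c : Bool) : ℕ := if c then 2 else 1

lemma run_load_loop {c : Bool} (hj : s[(j : ℕ)]? = some (.load c)) (v : Bool) (a : ℕ) (o : List Γ)
    (b d : ℕ) :
    Run s (a + 1) ⟨some (j, .load), v, stks a o b 0 d⟩
      ⟨some (j, .restore), false,
        stks 0 o (b + (2 - loadFactor c) * a) 0 (d + loadFactor c * a)⟩ := by
  induction a generalizing b d v with
  | zero => exact Run.single (by simp [prog])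
  | succ a ih =>
    cases c
    · refine Run.cons (c := ⟨some (j, .load), true, stks a o (b + 1) 0 (d + 1)⟩)
        (by simp [prog, List.replicate_succ, hj]; funext k; cases k <;> rfl) ?_
      convert ih true (b + 1) (d + 1) using 3 <;> simp [loadFactor] <;> omega
    · refine Run.cons (c := ⟨some (j, .load), true, stks a o b 0 (d + 2)⟩)
        (by simp [prog, List.replicate_succ, hj]; funext k; cases k <;> rfl) ?_
      convert ih true b (d + 2) using 3 <;> simp [loadFactor] ; omega

lemma run_unemit_layer {pre : List Γ} {one sep : Γ}
    (hj : s[(j : ℕ)]? = some (.layer pre one sep)) (v : Bool) (a : ℕ) (o : List Γ) (b t d : ℕ) :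
    Run s (t + 1) ⟨some (j, .unemit), v, stks a o b t d⟩
      ⟨some (j, .layer), false, stks a o (b + t) 0 d⟩ := by
  induction t generalizing b v with
  | zero => exact Run.single (by simp [prog, hj])
  | succ t ih =>
    refine Run.cons (c := ⟨some (j, .unemit), true, stks a o (b + 1) t d⟩)
      (by simp [prog, List.replicate_succ]; funext k; cases k <;> rfl) ?_
    have := ih true (b + 1)
    rwa [show b + 1 + t = b + (t + 1) by omega] at this

lemma run_unemit_single {pre : List Γ} {one sep : Γ}
    (hj : s[(j : ℕ)]? = some (.single pre one sep)) (v : Bool) (a : ℕ) (o : List Γ) (b t d : ℕ) :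
    Run s (t + 1) ⟨some (j, .unemit), v, stks a o b t d⟩
      ⟨some (nextIdx j, .start), false, stks a o (b + t) 0 d⟩ := by
  induction t generalizing b v with
  | zero => exact Run.single (by simp [prog, hj])
  | succ t ih =>
    refine Run.cons (c := ⟨some (j, .unemit), true, stks a o (b + 1) t d⟩)
      (by simp [prog, List.replicate_succ]; funext k; cases k <;> rfl) ?_
    have := ih true (b + 1)
    rwa [show b + 1 + t = b + (t + 1) by omega] at this

lemma run_emit {pre : List Γ} {one sep : Γ}
    (hj : s[(j : ℕ)]? = some (.layer pre one sep) ∨ s[(j : ℕ)]? = some (.single pre one sep))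
    (v : Bool) (a : ℕ) (o : List Γ) (b t d : ℕ) :
    Run s (b + 1) ⟨some (j, .emit), v, stks a o b t d⟩
      ⟨some (j, .unemit), false, stks a (pre ++ (List.replicate b one ++ o)) 0 (t + b) d⟩ := by
  induction b generalizing o t v with
  | zero =>
    refine Run.single ?_
    have h : Function.update (stks a o 0 t d) Stack.cnt [] = stks a o 0 t d := by
      funext k; cases k <;> rfl
    rcases hj with hj | hj <;> simp [prog, hj, h, stepAux_pushAll]
  | succ b ih =>
    refine Run.cons (c := ⟨some (j, .emit), true, stks a (one :: o) b (t + 1) d⟩) ?_ ?_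
    · rcases hj with hj | hj <;> simp [prog, List.replicate_succ, hj] <;>
        (funext k; cases k <;> rfl)
    · have := ih true (one :: o) (t + 1)
      rw [show t + 1 + b = t + (b + 1) by omega] at this
      rwa [List.replicate_succ', List.append_assoc, List.singleton_append]

lemma run_layer_loop {pre : List Γ} {one sep : Γ}
    (hj : s[(j : ℕ)]? = some (.layer pre one sep)) (v : Bool) (a : ℕ) (o : List Γ) (r d : ℕ) :
    Run s (a * (2 * (r + a) + 3) + 1) ⟨some (j, .layer), v, stks a o (r + a) 0 d⟩
      ⟨some (j, .restore), false, stks 0 ((List.range a).flatMap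
        (fun i => pre ++ (List.replicate (r + i) one ++ [sep])) ++ o) r 0 (d + a)⟩ := by
  induction a generalizing o d v with
  | zero => exact (Run.single (by simp [prog])).mono (by omega)
  | succ a ih =>
    have h1 : Run s 1 ⟨some (j, .layer), v, stks (a + 1) o (r + (a + 1)) 0 d⟩
        ⟨some (j, .emit), true, stks a (sep :: o) (r + a) 0 (d + 1)⟩ :=
      Run.single (by simp [prog, List.replicate_succ, hj, ← add_assoc]; funext k; cases k <;> rfl)
    have h2 := run_emit (Or.inl hj) true a (sep :: o) (r + a) 0 (d + 1)
    have h3 := run_unemit_layer hj false a (pre ++ (List.replicate (r + a) one ++ sep :: o)) 0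
      (0 + (r + a)) (d + 1)
    have h4 := ih false (pre ++ (List.replicate (r + a) one ++ sep :: o)) (d + 1)
    simp only [zero_add] at h2 h3
    have := h1.trans (h2.trans (h3.trans h4))
    rw [List.range_succ, List.flatMap_append]
    simp only [List.flatMap_cons, List.flatMap_nil, List.append_nil, List.append_assoc,
      List.singleton_append]
    rw [show d + 1 + a = d + (a + 1) by omega] at this
    refine this.mono ?_
    have : a * (2 * (r + a) + 3) ≤ a * (2 * (r + (a + 1)) + 3) := by gcongr; omega
    rw [add_mul]
    omega

lemma run_clean₁ (v : Bool) (a : ℕ) (o : List Γ) (b : ℕ) :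
    Run s (a + 1) ⟨some (j, .clean₁), v, stks a o b 0 0⟩
      ⟨some (j, .clean₂), false, stks 0 o b 0 0⟩ := by
  induction a generalizing v with
  | zero => exact Run.single (by simp [prog])
  | succ a ih =>
    exact Run.cons (c := ⟨some (j, .clean₁), true, stks a o b 0 0⟩)
      (by simp [prog, List.replicate_succ]; funext k; cases k <;> rfl) (ih true)

lemma run_clean₂ (v : Bool) (o : List Γ) (b : ℕ) :
    Run s (b + 1) ⟨some (j, .clean₂), v, stks 0 o b 0 0⟩
      ⟨some (nextIdx j, .start), false, stks 0 o 0 0 0⟩ := by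
  induction b generalizing v with
  | zero => exact Run.single (by simp [prog])
  | succ a ih =>
    exact Run.cons (c := ⟨some (j, .clean₂), true, stks 0 o a 0 0⟩)
      (by simp [prog, List.replicate_succ]; funext k; cases k <;> rfl) (ih true)

lemma run_item {it : Item Γ} (hj : s[(j : ℕ)]? = some it) (hit : it.IsWrite) {n a b : ℕ}
    (hab : a ≤ b) (hb : b ≤ 2 * n) (o : List Γ) :
    Run s (10 * (n + 1) ^ 2) ⟨some (j, .start), false, stks a o b 0 0⟩
      ⟨some (nextIdx j, .start), false, stks a (it.out a b ++ o) b 0 0⟩ := by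
  have hn : 1 ≤ (n + 1) ^ 2 := Nat.one_le_pow _ _ (by omega)
  cases it with
  | load c => exact hit.elim
  | clean => exact hit.elim
  | const w =>
    refine Run.mono (Run.single ?_) (show 1 ≤ _ by omega)
    simp [prog, hj, stepAux_pushAll, Item.out]
  | single pre one sep =>
    have h1 : Run s 1 ⟨some (j, .start), false, stks a o b 0 0⟩
        ⟨some (j, .emit), false, stks a (sep :: o) b 0 0⟩ :=
      Run.single (by simp [prog, hj]; funext k; cases k <;> rfl)
    have h2 := run_emit (Or.inr hj) false a (sep :: o) b 0 0
    have h3 := run_unemit_single hj false a (pre ++ (List.replicate b one ++ sep :: o)) 0 (0 + b) 0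
    have := h1.trans (h2.trans h3)
    simp only [zero_add] at this
    simp only [Item.out, List.append_assoc, List.singleton_append]
    refine this.mono ?_
    nlinarith
  | layer pre one sep =>
    obtain ⟨r, rfl⟩ := Nat.exists_eq_add_of_le' hab
    have h1 : Run s 1 ⟨some (j, .start), false, stks a o (r + a) 0 0⟩
        ⟨some (j, .layer), false, stks a o (r + a) 0 0⟩ :=
      Run.single (by simp [prog, hj])
    have h2 := run_layer_loop hj false a o r 0
    have h3 := run_restore (s := s) (j := j) false 0 ((List.range a).flatMap
        (fun i => pre ++ (List.replicate (r + i) one ++ [sep])) ++ o) r (0 + a)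
    have := h1.trans (h2.trans h3)
    simp only [zero_add] at this
    simp only [Item.out, Nat.add_sub_cancel]
    refine this.mono ?_
    have h4 : a * (2 * (r + a) + 3) ≤ 2 * n * (2 * (2 * n) + 3) := by gcongr; omega
    nlinarith

/-- The script that sets up the counters, writes the given items, and cleans up. The items are executed
in reverse order, since the output is written from right to left. -/
def script (c : Bool) (items : List (Item Γ)) : List (Item Γ) :=
  .load c :: (items.reverse ++ [.clean])

lemma run_items {c : Bool} {items : List (Item Γ)} (hw : ∀ it ∈ items, it.IsWrite) {n a b : ℕ}
    (hab : a ≤ b) (hb : b ≤ 2 * n) (suf pre : List (Item Γ)) (h : items.reverse = pre ++ suf)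
    (o : List Γ) (j k : Fin ((script c items).length + 1)) (hj : (j : ℕ) = pre.length + 1)
    (hk : (k : ℕ) = items.length + 1) :
    Run (script c items) (suf.length * (10 * (n + 1) ^ 2))
      ⟨some (j, .start), false, stks a o b 0 0⟩
      ⟨some (k, .start), false, stks a (suf.reverse.flatMap (Item.out a b) ++ o) b 0 0⟩ := by
  have hlen : items.length = pre.length + suf.length := by
    simpa using congrArg List.length h
  induction suf generalizing pre o j with
  | nil =>
    have : j = k := Fin.ext (by simp at hlen; omega)
    subst this
    simpa using Run.refl _
  | cons it suf ih =>
    have hget : (script c items)[(j : ℕ)]? = some it := by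
      rw [hj, script, h, List.getElem?_cons_succ, List.append_assoc,
        List.getElem?_append_right (le_refl _)]
      simp
    have hmem : it ∈ items := by
      rw [← List.mem_reverse, h]; simp
    have h1 := run_item hget (hw it hmem) hab hb o
    have h2 := ih (pre ++ [it]) (by simp [h]) (it.out a b ++ o) (nextIdx j) (by
      have : (script c items).length = items.length + 2 := by simp [script]
      simp only [List.length_cons] at hlen
      simp only [nextIdx, List.length_append, List.length_cons, List.length_nil]
      omega) (by simp at hlen ⊢; omega)
    rw [List.reverse_cons, List.flatMap_append, List.append_assoc, List.flatMap_singleton]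
    refine (h1.trans h2).mono ?_
    simp only [List.length_cons, add_mul]
    omega

/-- The number of marks on the first counter, for input length `n`. -/
def counter (c : Bool) (n : ℕ) : ℕ := loadFactor c * n

lemma run_script (c : Bool) {items : List (Item Γ)} (hw : ∀ it ∈ items, it.IsWrite) (n : ℕ) :
    ∃ t ≤ (items.length + 3) * (10 * (n + 1) ^ 2),
      (flip bind (Turing.TM2.step (prog (script c items))))^[t]
        (some ⟨some (0, .start), false, stks n [] 0 0 0⟩) =
        some ⟨none, false, stks 0 (items.flatMap (Item.out (counter c n) (2 * n))) 0 0 0⟩ := by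
  change Run _ _ _ _
  have hlen : (script c items).length = items.length + 2 := by simp [script]
  have hn : 1 ≤ (n + 1) ^ 2 := Nat.one_le_pow _ _ (by omega)
  have hc : counter c n ≤ 2 * n := by cases c <;> simp [counter, loadFactor]; omega
  have hget : (script c items)[((0 : Fin ((script c items).length + 1)) : ℕ)]? = some (.load c) := by
    simp [script]
  have h1 : Run (script c items) 1 ⟨some (0, .start), false, stks n [] 0 0 0⟩
      ⟨some (0, .load), false, stks n [] 0 0 0⟩ := Run.single (by simp only [prog, hget]; rfl)
  have h2 := run_load_loop hget false n [] 0 0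
  have h3 := run_restore (s := script c items) (j := 0) false 0 [] (0 + (2 - loadFactor c) * n)
    (0 + loadFactor c * n)
  have e1 : 0 + loadFactor c * n = counter c n := by simp [counter]
  have e2 : 0 + (2 - loadFactor c) * n + (0 + loadFactor c * n) = 2 * n := by
    cases c <;> simp [loadFactor]; omega
  have h4 := run_items (c := c) hw hc le_rfl items.reverse [] (by simp) [] (nextIdx 0)
    ⟨items.length + 1, by omega⟩ (by simp [nextIdx, hlen]) rfl
  have hget' : (script c items)[items.length + 1]? = some .clean := by
    rw [script, List.getElem?_cons_succ, List.getElem?_append_right (by simp)]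
    simp
  set k : Fin ((script c items).length + 1) := ⟨items.length + 1, by omega⟩
  set o := items.flatMap (Item.out (counter c n) (2 * n))
  have h5 : Run (script c items) 1 ⟨some (k, .start), false, stks (counter c n) o (2 * n) 0 0⟩
      ⟨some (k, .clean₁), false, stks (counter c n) o (2 * n) 0 0⟩ :=
    Run.single (by simp [prog, k, hget'])
  have h6 := run_clean₁ (s := script c items) (j := k) false (counter c n) o (2 * n)
  have h7 := run_clean₂ (s := script c items) (j := k) false o (2 * n)
  have h8 : Run (script c items) 1 ⟨some (nextIdx k, .start), false, stks 0 o 0 0 0⟩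
      ⟨none, false, stks 0 o 0 0 0⟩ :=
    Run.single (by
      have : (script c items)[((nextIdx k : Fin _) : ℕ)]? = none := by
        rw [List.getElem?_eq_none_iff]; simp [nextIdx, k]; omega
      simp [prog, this])
  rw [e2, e1, Nat.zero_add (counter c n)] at h3
  rw [e1] at h2
  rw [List.reverse_reverse, List.append_nil] at h4
  refine (h1.trans (h2.trans (h3.trans (h4.trans (h5.trans (h6.trans (h7.trans h8))))))).mono ?_
  simp only [List.length_reverse]
  rw [add_mul]
  nlinarith

lemma initList_machine (s : List (Item Γ)) (w : List Bool) (n : ℕ) (h : w = List.replicate n true) :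
    Turing.initList (machine s) w = ⟨some (0, .start), false, stks n [] 0 0 0⟩ := by
  subst h
  unfold Turing.initList
  congr 1
  funext k
  cases k <;> rfl

lemma haltList_machine (s : List (Item Γ)) (w w' : List Γ) (h : w = w') :
    Turing.haltList (machine s) w = ⟨none, false, stks 0 w' 0 0 0⟩ := by
  subst h
  unfold Turing.haltList
  congr 1
  funext k
  cases k <;> rfl

/-- The functions of the input length whose values, read as words, are written by scripts, are
polynomial-time computable. -/
lemma computable {β : Type} (eb : β → List Γ) (f : ℕ → β) (c : Bool) (items : List (Item Γ))
    (hw : ∀ it ∈ items, it.IsWrite)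
    (hf : ∀ n, eb (f n) = items.flatMap (Item.out (counter c n) (2 * n))) :
    Nonempty (Turing.TM2ComputableInPolyTime Computability.unaryEncodeNat eb f) := by
  have hun : ∀ n, Computability.unaryEncodeNat n = List.replicate n true := by
    intro n
    induction n with
    | zero => rfl
    | succ n ih => rw [Computability.unaryEncodeNat, ih, List.replicate_succ]
  refine ⟨{
    tm := machine (script c items)
    inputAlphabet := Equiv.refl Bool
    outputAlphabet := Equiv.refl Γ
    time := (Polynomial.C (10 * (items.length + 3))) * (Polynomial.X + 1) ^ 2
    outputsFun := fun n => ?_ }⟩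
  have h := run_script c hw n
  refine ⟨⟨h.choose, ?_⟩, ?_⟩
  · have h2 := h.choose_spec.2
    have i1 := initList_machine (script c items)
      (List.map (Equiv.refl Bool).invFun (Computability.unaryEncodeNat n)) n (by rw [hun]; simp)
    have i2 := haltList_machine (script c items) (List.map (Equiv.refl Γ).invFun (eb (f n)))
      (items.flatMap (Item.out (counter c n) (2 * n))) (by rw [hf]; simp)
    exact ((congrArg (fun x => (flip bind (Turing.TM2.step (prog (script c items))))^[h.choose]
      (some x)) i1).trans h2).trans (congrArg some i2.symm)
  · refine h.choose_spec.1.trans (le_of_eq ?_)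
    simp [hun]
    ring

end ScriptMachine

/-! ### Characters of the group of bit strings -/

/-- The sign of a bit. -/
def sgn (b : Bool) : ℝ := if b then -1 else 1

@[simp] lemma sgn_false : sgn false = 1 := rfl
@[simp] lemma sgn_true : sgn true = -1 := rfl

lemma sgn_xor (a b : Bool) : sgn (a ^^ b) = sgn a * sgn b := by
  cases a <;> cases b <;> norm_num [sgn]

lemma sgn_mul_self (a : Bool) : sgn a * sgn a = 1 := by cases a <;> norm_num [sgn]

lemma abs_sgn (a : Bool) : |sgn a| = 1 := by cases a <;> simp [sgn]

section Char

variable {ι : Type*}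

/-- Bitwise exclusive or with a fixed string is a bijection. -/
def xorEquiv (c : ι → Bool) : (ι → Bool) ≃ (ι → Bool) where
  toFun a := fun i => a i ^^ c i
  invFun a := fun i => a i ^^ c i
  left_inv a := by funext i; simp
  right_inv a := by funext i; simp

@[simp] lemma xorEquiv_apply (c a : ι → Bool) (i : ι) : xorEquiv c a i = (a i ^^ c i) := rfl

lemma xor_eq_zero_iff (b c : ι → Bool) : (fun i => b i ^^ c i) = (fun _ => false) ↔ b = c := by
  constructor
  · intro h; funext i
    have := congrFun h i
    simpa using this
  · rintro rfl; simp

variable [Fintype ι]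

/-- The pairing `(-1) ^ (a · b)` of bit strings. -/
def chi (a b : ι → Bool) : ℝ := ∏ i, sgn (a i && b i)

lemma chi_comm (a b : ι → Bool) : chi a b = chi b a := by
  simp [chi, Bool.and_comm]

lemma chi_xor (a b c : ι → Bool) : chi (fun i => a i ^^ b i) c = chi a c * chi b c := by
  rw [chi, chi, chi, ← Finset.prod_mul_distrib]
  refine Finset.prod_congr rfl fun i _ => ?_
  rw [← sgn_xor]
  cases a i <;> cases b i <;> cases c i <;> rfl

lemma chi_xor_right (a b c : ι → Bool) : chi a (fun i => b i ^^ c i) = chi a b * chi a c := by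
  rw [chi_comm, chi_xor, chi_comm b, chi_comm c]

lemma chi_mul_self (a b : ι → Bool) : chi a b * chi a b = 1 := by
  rw [chi, ← Finset.prod_mul_distrib]
  exact Finset.prod_eq_one fun i _ => sgn_mul_self _

@[simp] lemma chi_zero_left (b : ι → Bool) : chi (fun _ => false) b = 1 := by simp [chi]

@[simp] lemma chi_zero_right (a : ι → Bool) : chi a (fun _ => false) = 1 := by simp [chi]

variable [DecidableEq ι]

lemma sum_chi_left (b : ι → Bool) :
    ∑ a : ι → Bool, chi a b = if b = (fun _ => false) then 2 ^ Fintype.card ι else 0 := by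
  split_ifs with h
  · subst h; simp
  · obtain ⟨i, hi⟩ : ∃ i, b i = true := by
      by_contra! hb
      exact h (funext fun i => by simpa using hb i)
    have e : chi (fun j => decide (j = i)) b = -1 := by
      rw [chi, Finset.prod_eq_single i]
      · simp [hi]
      · intro j _ hj; simp [hj]
      · simp
    have : ∑ a : ι → Bool, chi a b = -∑ a : ι → Bool, chi a b := by
      conv_lhs => rw [← Equiv.sum_comp (xorEquiv fun j => decide (j = i))]
      rw [← Finset.sum_neg_distrib]
      refine Finset.sum_congr rfl fun a _ => ?_
      change chi (fun j => a j ^^ decide (j = i)) b = _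
      rw [chi_xor, e, mul_neg_one]
    linarith

lemma sum_chi_mul_chi (b c : ι → Bool) :
    ∑ a : ι → Bool, chi a b * chi a c = if b = c then 2 ^ Fintype.card ι else 0 := by
  simp_rw [← chi_xor_right, sum_chi_left, xor_eq_zero_iff]

end Char

/-! ### Wires -/

section Wires

variable {w : ℕ}

/-- The contents of the wires `o, …, o + N - 1`. -/
def getWires (o N : ℕ) (b : BitString w) : BitString N := fun i => getWire b (o + i)

/-- Replace the contents of the wires `o, …, o + N - 1` by `u`. -/
def putWires {N : ℕ} (o : ℕ) (u : BitString N) (b : BitString w) : BitString w :=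
  fun j => if h : o ≤ (j : ℕ) ∧ (j : ℕ) < o + N then u ⟨j - o, by omega⟩ else b j

lemma getWire_setWire_self (b : BitString w) {i : ℕ} (hi : i < w) (v : Bool) :
    getWire (setWire b i v) i = v := by
  simp [getWire, setWire, hi]

lemma getWire_setWire_ne (b : BitString w) {i k : ℕ} (h : k ≠ i) (v : Bool) :
    getWire (setWire b i v) k = getWire b k := by
  by_cases hk : k < w <;> simp [getWire, setWire, hk, h]

lemma getWire_putWires_of_mem {N o : ℕ} (u : BitString N) (b : BitString w) {i : ℕ} (hi : i < N)
    (hw : o + N ≤ w) : getWire (putWires o u b) (o + i) = u ⟨i, hi⟩ := by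
  have : o + i < w := by omega
  simp [getWire, putWires, this, hi]

lemma getWire_putWires_of_notMem {N o : ℕ} (u : BitString N) (b : BitString w) {i : ℕ}
    (hi : ¬ (o ≤ i ∧ i < o + N)) : getWire (putWires o u b) i = getWire b i := by
  unfold getWire
  split_ifs with h
  · simp only [putWires]; rw [dif_neg hi]
  · rfl

lemma getWires_putWires {N o : ℕ} (u : BitString N) (b : BitString w) (hw : o + N ≤ w) :
    getWires o N (putWires o u b) = u := by
  funext i
  exact getWire_putWires_of_mem u b i.2 hw

lemma putWires_getWires {N o : ℕ} (b : BitString w) : putWires o (getWires o N b) b = b := by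
  funext j
  simp only [putWires, getWires, getWire]
  split_ifs with h h'
  · congr 1; ext; simp; omega
  · exact absurd j.2 (by omega)
  · rfl

/-- Whether two strings agree outside of a range of wires does not depend on the string that is put
there. -/
lemma putWires_eq_putWires_iff {N o : ℕ} (u v : BitString N) (b c : BitString w) :
    putWires o u b = putWires o u c ↔ putWires o v b = putWires o v c := by
  constructor <;> intro h <;> funext j <;> have := congrFun h j <;>
    simp only [putWires] at this ⊢ <;> split_ifs with h' <;> simp_all

lemma putWires_setWire {N o : ℕ} (u : BitString N) (b : BitString w) {i : ℕ}
    (hi : ¬ (o ≤ i ∧ i < o + N)) (v : Bool) :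
    putWires o u (setWire b i v) = setWire (putWires o u b) i v := by
  funext j
  simp only [putWires, setWire]
  split_ifs with h1 h2 <;> first | rfl | (exfalso; omega)

lemma getWires_setWire {N o : ℕ} (b : BitString w) {i : ℕ}
    (hi : ¬ (o ≤ i ∧ i < o + N)) (v : Bool) :
    getWires o N (setWire b i v) = getWires o N b := by
  funext k
  exact getWire_setWire_ne b (by omega) v

lemma setWire_setWire (b : BitString w) (i : ℕ) (v v' : Bool) :
    setWire (setWire b i v) i v' = setWire b i v' := by
  funext j; simp only [setWire]; split_ifs <;> rfl

lemma setWire_getWire (b : BitString w) (i : ℕ) : setWire b i (getWire b i) = b := by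
  funext j
  simp only [setWire, getWire]
  split_ifs with h h'
  · congr 1; ext; simp [h]
  · exact absurd j.2 (by omega)
  · rfl

end Wires

/-! ### The action of some circuits -/

lemma invSqrtTwo_pow_mul_self (N : ℕ) :
    ((1 / Real.sqrt 2 : ℝ) : ℂ) ^ N * ((1 / Real.sqrt 2 : ℝ) : ℂ) ^ N = (1 / 2) ^ N := by
  rw [← mul_pow, ← Complex.ofReal_mul]
  congr 1
  rw [div_mul_div_comm, one_mul, Real.mul_self_sqrt (by norm_num)]
  norm_num

section Circuits

variable {m s w : ℕ} (F : BitString m → BitString s)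

/-- The action of a circuit on a state. -/
def applyAll (C : Circuit) (ψ : QState w) : QState w := C.foldl (fun ψ g => g.apply F ψ) ψ

lemma applyAll_append (C D : Circuit) (ψ : QState w) :
    applyAll F (C ++ D) ψ = applyAll F D (applyAll F C ψ) := by
  simp [applyAll]

lemma applyAll_singleton (g : Gate) (ψ : QState w) : applyAll F [g] ψ = g.apply F ψ := rfl

/-- Hadamard gates on the wires `o, …, o + N - 1`. -/
def hadLayer (o N : ℕ) : Circuit := (List.range N).map fun i => Gate.had (o + i)

lemma getWires_succ (o N : ℕ) (b : BitString w) :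
    getWires o (N + 1) b = Fin.snoc (α := fun _ => Bool) (getWires o N b) (getWire b (o + N)) := by
  funext i
  refine Fin.lastCases ?_ (fun i => ?_) i
  · simp [getWires]
  · simp [getWires]

lemma putWires_snoc {o N : ℕ} (u : BitString N) (v : Bool) (b : BitString w) :
    putWires o (Fin.snoc (α := fun _ => Bool) u v : BitString (N + 1)) b
      = putWires o u (setWire b (o + N) v) := by
  funext j
  simp only [putWires, setWire]
  by_cases h : o ≤ (j : ℕ) ∧ (j : ℕ) < o + N
  · rw [dif_pos h, dif_pos (by omega)]
    have e : (⟨j - o, by omega⟩ : Fin (N + 1)) = Fin.castSucc ⟨j - o, by omega⟩ := rfl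
    rw [e, Fin.snoc_castSucc]
  · rw [dif_neg h]
    by_cases h' : (j : ℕ) = o + N
    · rw [if_pos h', dif_pos (by omega)]
      have e : (⟨j - o, by omega⟩ : Fin (N + 1)) = Fin.last N := by ext; simp [h']
      rw [e, Fin.snoc_last]
    · rw [if_neg h', dif_neg (by omega)]

lemma chi_snoc {N : ℕ} (a b : BitString N) (u v : Bool) :
    chi (Fin.snoc (α := fun _ => Bool) a u : Fin (N + 1) → Bool)
      (Fin.snoc (α := fun _ => Bool) b v) = chi a b * sgn (u && v) := by
  simp [chi, Fin.prod_univ_castSucc]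

lemma sum_bitString_succ {N : ℕ} (φ : BitString (N + 1) → ℂ) :
    ∑ u, φ u = ∑ u : BitString N, (φ (Fin.snoc (α := fun _ => Bool) u false)
      + φ (Fin.snoc (α := fun _ => Bool) u true)) := by
  rw [← Equiv.sum_comp (Fin.snocEquiv fun _ => Bool), Fintype.sum_prod_type]
  rw [Fintype.sum_bool, ← Finset.sum_add_distrib]
  exact Finset.sum_congr rfl fun u _ => add_comm _ _

/-- A layer of Hadamard gates is a Fourier transform on bit strings. -/
lemma applyAll_hadLayer (o N : ℕ) (hw : o + N ≤ w) (ψ : QState w) (b : BitString w) :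
    applyAll F (hadLayer o N) ψ b = ((1 / Real.sqrt 2 : ℝ) : ℂ) ^ N *
      ∑ u : BitString N, (chi (getWires o N b) u : ℂ) * ψ (putWires o u b) := by
  induction N generalizing b with
  | zero =>
    have : ∀ u : BitString 0, putWires o u b = b := fun u => by
      funext j; simp only [putWires]; rw [dif_neg (by omega)]
    simp [hadLayer, applyAll, this, chi]
  | succ N ih =>
    have hs : hadLayer o (N + 1) = hadLayer o N ++ [Gate.had (o + N)] := by
      simp [hadLayer, List.range_succ]
    have key : ∀ v, ∀ u : BitString N, getWires o N (setWire b (o + N) v) = getWires o N b :=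
      fun v u => getWires_setWire b (by omega) v
    rw [hs, applyAll_append, applyAll_singleton]
    simp only [Gate.apply]
    rw [ih (by omega), ih (by omega), sum_bitString_succ, pow_succ]
    simp only [Finset.mul_sum, ← Finset.sum_add_distrib]
    refine Finset.sum_congr rfl fun u _ => ?_
    rw [key false u, key true u, getWires_succ, putWires_snoc, putWires_snoc, chi_snoc, chi_snoc]
    cases getWire b (o + N) <;> simp <;> ring

lemma regX_queryBasis (b : BitString w) : regX m (queryBasis F b) = regX m b := by
  funext i
  unfold regX getWire
  split_ifs with h
  · simp only [queryBasis]; rw [dif_neg (by have := i.2; simp)]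
  · rfl

lemma queryBasis_queryBasis (b : BitString w) : queryBasis F (queryBasis F b) = b := by
  funext j
  change (if h : m ≤ (j : ℕ) ∧ (j : ℕ) < m + s then (queryBasis F b j).xor
    (F (regX m (queryBasis F b)) ⟨(j : ℕ) - m, by omega⟩) else queryBasis F b j) = b j
  rw [regX_queryBasis]
  by_cases h : m ≤ (j : ℕ) ∧ (j : ℕ) < m + s
  · rw [dif_pos h]
    simp only [queryBasis]
    rw [dif_pos h]
    simp
  · rw [dif_neg h]
    simp only [queryBasis]
    rw [dif_neg h]

/-- Two queries, between which the first output wire `m` gets the phase gate `T⁴ = Z`. -/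
def phaseQuery (m : ℕ) : Circuit :=
  [Gate.query, Gate.t m, Gate.t m, Gate.t m, Gate.t m, Gate.query]

lemma exp_pow_four :
    Complex.exp (Complex.I * ((Real.pi / 4 : ℝ) : ℂ)) ^ 4 = -1 := by
  rw [← Complex.exp_nat_mul]
  have : ((4 : ℕ) : ℂ) * (Complex.I * ((Real.pi / 4 : ℝ) : ℂ)) = Real.pi * Complex.I := by
    push_cast; ring
  rw [this, Complex.exp_pi_mul_I]

/-- The second query erases what the first one has written, so that only a phase remains. -/
lemma applyAll_phaseQuery (hs : 0 < s) (hw : m + s ≤ w) (ψ : QState w) (b : BitString w) :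
    applyAll F (phaseQuery m) ψ b
      = (sgn (getWire b m ^^ F (regX m b) ⟨0, hs⟩) : ℂ) * ψ b := by
  have h1 : getWire (queryBasis F b) m = (getWire b m ^^ F (regX m b) ⟨0, hs⟩) := by
    have hm : m < w := by omega
    simp only [getWire, hm, dif_pos, queryBasis]
    rw [dif_pos ⟨le_rfl, by omega⟩]
    simp
  simp only [phaseQuery, applyAll, List.foldl_cons, List.foldl_nil, Gate.apply,
    queryBasis_queryBasis, h1]
  cases (getWire b m ^^ F (regX m b) ⟨0, hs⟩)
  · simp
  · simp only [if_true, sgn_true]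
    rw [← mul_assoc, ← mul_assoc, ← mul_assoc]
    have := exp_pow_four
    rw [show ∀ z : ℂ, z * z * z * z = z ^ 4 from fun z => by ring, this]
    simp

/-- The state with amplitudes `ξ` on the wires `o, …, o + N - 1` in which all other wires are in the
basis state `β`. -/
def embState {N : ℕ} (o : ℕ) (β : BitString w) (ξ : BitString N → ℂ) : QState w :=
  fun b => if putWires o (getWires o N b) β = b then ξ (getWires o N b) else 0

/-- The normalized Fourier transform. -/
def fourier {N : ℕ} (ξ : BitString N → ℂ) (x : BitString N) : ℂ :=
  ((1 / Real.sqrt 2 : ℝ) : ℂ) ^ N * ∑ u : BitString N, (chi x u : ℂ) * ξ u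

lemma applyAll_hadLayer_embState {o N : ℕ} (hw : o + N ≤ w) (β : BitString w)
    (ξ : BitString N → ℂ) :
    applyAll F (hadLayer o N) (embState o β ξ) = embState o β (fourier ξ) := by
  funext b
  rw [applyAll_hadLayer F o N hw]
  simp only [embState, fourier]
  have h : ∀ u : BitString N, putWires o u β = putWires o u b ↔
      putWires o (getWires o N b) β = b := by
    intro u
    conv_rhs => rhs; rw [← putWires_getWires (o := o) (N := N) b]
    exact putWires_eq_putWires_iff _ _ _ _
  simp only [getWires_putWires _ _ hw, h]
  split_ifs <;> simp

lemma applyAll_not_embState {o N i : ℕ} (hi : ¬ (o ≤ i ∧ i < o + N)) (hiw : i < w)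
    (β : BitString w) (ξ : BitString N → ℂ) :
    applyAll F [Gate.not i] (embState o β ξ) = embState o (setWire β i (!getWire β i)) ξ := by
  funext b
  simp only [applyAll_singleton, Gate.apply, embState, getWires_setWire _ hi,
    putWires_setWire _ _ hi]
  refine if_congr ?_ rfl rfl
  have hg : ∀ u : BitString N, getWire (putWires o u β) i = getWire β i :=
    fun u => getWire_putWires_of_notMem u β hi
  constructor
  · intro h
    have h2 : getWire β i = !getWire b i := by
      rw [← hg (getWires o N b), h, getWire_setWire_self b hiw]
    rw [h, setWire_setWire, h2, Bool.not_not, setWire_getWire]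
  · intro h
    have h2 : getWire b i = !getWire β i := by
      conv_lhs => rw [← h]
      rw [getWire_setWire_self _ hiw]
    rw [h2, Bool.not_not]
    calc putWires o (getWires o N b) β
        = setWire (putWires o (getWires o N b) β) i
            (getWire (putWires o (getWires o N b) β) i) := (setWire_getWire _ _).symm
      _ = setWire b i (getWire β i) := by
        rw [hg]; conv_rhs => rw [← h, setWire_setWire]

lemma applyAll_phaseQuery_embState {o N : ℕ} (hs : 0 < s) (hw : m + s ≤ w) (ho : o + N ≤ m)
    (β : BitString w) (hβ : getWire β m = false) (ξ : BitString N → ℂ) :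
    applyAll F (phaseQuery m) (embState o β ξ) = embState o β fun u =>
      (sgn (F (regX m (putWires o u β)) ⟨0, hs⟩) : ℂ) * ξ u := by
  funext b
  rw [applyAll_phaseQuery F hs hw]
  simp only [embState]
  split_ifs with h
  · have h2 : getWire b m = false := by
      rw [← h, getWire_putWires_of_notMem _ _ (by omega), hβ]
    rw [h2, Bool.false_xor]
    conv_lhs => rw [← h]
    rw [h]
  · simp

end Circuits

open scoped BigOperators

/-! ### Attacks with blinding probability one half -/

lemma expect_prod {α β : Type*} [Fintype α] [Fintype β] (φ : α × β → ℝ) :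
    𝔼 z, φ z = 𝔼 a, 𝔼 b, φ (a, b) := by
  rw [← Finset.univ_product_univ, Finset.expect_product]

lemma mem_symmDiff_singleton_of_ne {X : Type*} [DecidableEq X] {x y : X} (h : y ≠ x)
    (B : Finset X) : y ∈ symmDiff B {x} ↔ y ∈ B := by
  simp [Finset.mem_symmDiff, h]

/-- In a uniformly random set, the membership of a point is independent of all other
memberships. -/
lemma expect_mem_mul {X : Type*} [Fintype X] [DecidableEq X] (x : X) (φ : Bool → ℝ)
    (ψ : Finset X → ℝ) (hψ : ∀ B, ψ (symmDiff B {x}) = ψ B) :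
    𝔼 B : Finset X, φ (decide (x ∈ B)) * ψ B = (φ true + φ false) / 2 * 𝔼 B, ψ B := by
  have e : 𝔼 B : Finset X, φ (decide (x ∈ B)) * ψ B
      = 𝔼 B : Finset X, φ (!decide (x ∈ B)) * ψ B := by
    have hinv : Function.Involutive fun B : Finset X => symmDiff B {x} :=
      fun B => symmDiff_symmDiff_cancel_right _ _
    refine Fintype.expect_equiv hinv.toPerm _ _ fun B => ?_
    have : decide (x ∈ symmDiff B {x}) = !decide (x ∈ B) := by
      by_cases h : x ∈ B <;> simp [Finset.mem_symmDiff, h]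
    change _ = φ (!decide (x ∈ symmDiff B {x})) * ψ (symmDiff B {x})
    rw [this, hψ, Bool.not_not]
  have e2 : 𝔼 B : Finset X, φ (decide (x ∈ B)) * ψ B + 𝔼 B : Finset X, φ (!decide (x ∈ B)) * ψ B
      = (φ true + φ false) * 𝔼 B, ψ B := by
    rw [← Finset.expect_add_distrib, Finset.mul_expect]
    refine Finset.expect_congr rfl fun B _ => ?_
    by_cases h : x ∈ B <;> simp [h] <;> ring
  rw [← e] at e2
  linear_combination e2 / 2

lemma blindProb_half {m : ℕ} (B : Finset (BitString m)) :
    blindProb (1 / 2) B = (1 / 2) ^ Fintype.card (BitString m) := by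
  unfold blindProb
  rw [Finset.prod_congr rfl (g := fun _ => (1 / 2 : ℝ)), Finset.prod_const, Finset.card_univ]
  intro x _
  split_ifs <;> norm_num

/-- The adversary with a given circuit family that blinds with probability one half. -/
def halfAdversary (C : ℕ → Circuit) (hC : UniformFamily C) : BUAdversary where
  circuit := C
  circuit_uniform := hC
  num _ := 1
  den _ := 2
  num_efficient := ScriptMachine.computable Computability.encodeNat _ false [.const [true]]
    (by simp [Item.IsWrite]) (fun n => by simp [Item.out]; rfl)
  den_efficient := ScriptMachine.computable Computability.encodeNat _ false [.const [false, true]]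
    (by simp [Item.IsWrite]) (fun n => by simp [Item.out]; rfl)
  den_pos _ := by norm_num
  num_le_den _ := by norm_num

lemma blindForge_halfAdversary (M : MAC) {C : ℕ → Circuit} (hC : UniformFamily C) (n : ℕ) :
    blindForge M (halfAdversary C hC) n
      = M.expectKey n fun k => 𝔼 B, forgeProb M (C n) k B := by
  have : (halfAdversary C hC).ε n = 1 / 2 := by simp [BUAdversary.ε, halfAdversary]
  simp only [blindForge, this, blindProb_half, ← Finset.mul_sum, Fintype.expect_eq_sum_div_card,
    Fintype.card_finset]
  congr 1
  funext k
  rw [Nat.cast_pow, Nat.cast_ofNat, div_eq_inv_mul (∑ B, _) _, one_div, inv_pow]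
  rfl

/-- A success probability that is bounded below violates blind unforgeability. -/
lemma not_buSecure_of_le {M : MAC} (A : BUAdversary) {c : ℝ} (hc : 0 < c)
    (h : ∀ n, 1 ≤ n → c ≤ blindForge M A n) : ¬ BUSecure M := by
  intro hM
  have h0 := hM A 0
  simp only [pow_zero, one_mul] at h0
  have := ge_of_tendsto h0 (Filter.eventually_atTop.2 ⟨1, h⟩)
  linarith

lemma expectKey_uniform {M : MAC} {n : ℕ} [Nonempty (M.Key n)]
    (h : M.keyGen n = PMF.uniformOfFintype (M.Key n)) (φ : M.Key n → ℝ) :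
    M.expectKey n φ = 𝔼 k, φ k := by
  rw [MAC.expectKey, Fintype.expect_eq_sum_div_card, div_eq_inv_mul, Finset.mul_sum]
  refine Finset.sum_congr rfl fun k _ => ?_
  rw [h, PMF.uniformOfFintype_apply, ENNReal.toReal_inv, ENNReal.toReal_natCast]

lemma forgeProb_nonneg (M : MAC) {n : ℕ} (C : Circuit) (k : M.Key n)
    (B : Finset (BitString (M.msgLen n))) : 0 ≤ forgeProb M C k B :=
  Finset.sum_nonneg fun b _ => by split_ifs <;> positivity

open Classical in
lemma le_forgeProb (M : MAC) {n : ℕ} (C : Circuit) (k : M.Key n)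
    (B : Finset (BitString (M.msgLen n)))
    (b : BitString (qubits (M.msgLen n) (M.tagLen n + 1) C))
    (hm : regX (M.msgLen n) b ∈ B)
    (hv : M.Ver k (regX (M.msgLen n) b, regY (M.msgLen n) (M.tagLen n) b)) :
    ‖runCircuit (blind B (M.mac n k)) C b‖ ^ 2 ≤ forgeProb M C k B := by
  unfold forgeProb
  refine le_trans (le_of_eq ?_) (Finset.single_le_sum (f := fun b =>
    if regX (M.msgLen n) b ∈ B ∧
        M.Ver k (regX (M.msgLen n) b, regY (M.msgLen n) (M.tagLen n) b) then
      ‖runCircuit (blind B (M.mac n k)) C b‖ ^ 2 else 0)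
      (fun b _ => by split_ifs <;> positivity) (Finset.mem_univ b))
  rw [if_pos ⟨hm, hv⟩]

/-- The initial state, seen as a state of some of the wires. -/
lemma runCircuit_eq {m s : ℕ} (F : BitString m → BitString s) (C : Circuit) (o N : ℕ) :
    runCircuit F C = applyAll F C (embState o (fun _ => false)
      fun u : BitString N => if u = fun _ => false then 1 else 0) := by
  unfold runCircuit applyAll
  congr 1
  funext b
  simp only [embState]
  have h0 : putWires o (fun _ => false : BitString N) (fun _ => false : BitString (qubits m s C))
      = fun _ => false := by
    funext j; simp only [putWires]; split_ifs <;> rfl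
  by_cases hb : b = fun _ => false
  · subst hb
    have : getWires o N (fun _ => false : BitString (qubits m s C)) = fun _ => false := by
      funext i; simp [getWires, getWire]
    rw [this, if_pos h0, if_pos rfl, if_pos rfl]
  · rw [if_neg hb]
    split_ifs with h1 h2
    · rw [h2, h0] at h1; exact absurd h1.symm hb
    · rfl
    · rfl

/-! ### Encodings of circuits -/

lemma encodeCircuit_append (C D : Circuit) :
    encodeCircuit (C ++ D) = encodeCircuit C ++ encodeCircuit D := List.flatMap_append

/-- The first symbols of the encoding of a gate `g` on a wire whose number is at least `e`. -/
def wirePrefix (g : Sym) (e : ℕ) : List Sym := g :: List.replicate e Sym.one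

lemma out_layer (e a b : ℕ) :
    (Item.layer (wirePrefix .had e) Sym.one Sym.sep).out a b
      = encodeCircuit (hadLayer (e + (b - a)) a) := by
  simp only [Item.out, encodeCircuit, hadLayer, List.flatMap_map]
  congr 1
  funext i
  simp [wirePrefix, encodeGate, encodeWire, ← List.append_assoc, add_assoc]

lemma out_single (e a b : ℕ) :
    (Item.single (wirePrefix .t e) Sym.one Sym.sep).out a b = encodeCircuit [Gate.t (e + b)] := by
  simp [Item.out, encodeCircuit, wirePrefix, encodeGate, encodeWire, ← List.append_assoc]

/-! ### The periodic MAC is not blind-unforgeable -/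

/-- The circuit that queries the message `10…0` with the first half of the tag register in the
uniform superposition, so that only the second half of the tag is received. -/
def halfTagCircuit (n : ℕ) : Circuit :=
  [Gate.not 0] ++ (hadLayer (n + 1) n ++ ([Gate.query] ++ (hadLayer (n + 1) n ++ [Gate.not 0])))

lemma uniformFamily_halfTagCircuit : UniformFamily halfTagCircuit := by
  refine ScriptMachine.computable encodeCircuit _ false
    [.const (encodeCircuit [Gate.not 0]), .layer (wirePrefix .had 1) .one .sep,
      .const (encodeCircuit [Gate.query]), .layer (wirePrefix .had 1) .one .sep,
      .const (encodeCircuit [Gate.not 0])] (by simp [Item.IsWrite]) fun n => ?_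
  have hc : ScriptMachine.counter false n = n := by
    simp [ScriptMachine.counter, ScriptMachine.loadFactor]
  have hl := out_layer 1 n (2 * n)
  rw [show 1 + (2 * n - n) = n + 1 by omega] at hl
  simp only [hc, List.flatMap_cons, List.flatMap_nil, List.append_nil, hl, halfTagCircuit,
    encodeCircuit_append]
  rfl

lemma queryBasis_apply_of_lt {m s w : ℕ} (F : BitString m → BitString s) (b : BitString w)
    {j : Fin w} (h : (j : ℕ) < m) : queryBasis F b j = b j := by
  simp only [queryBasis]; rw [dif_neg (by omega)]

/-- Whatever the oracle is, the final state of `halfTagCircuit` is a basis state: a register in the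
uniform superposition is not changed by adding a string to it. The message register is reset to `0…0`,
and the second half of the tag of `10…0` remains. -/
lemma runCircuit_halfTagCircuit {n s : ℕ} (hs : n ≤ s) (F : BitString (n + 1) → BitString s) :
    ∃ b : BitString (qubits (n + 1) s (halfTagCircuit n)),
      runCircuit F (halfTagCircuit n) b = 1 ∧ regX (n + 1) b = (fun _ => false) ∧
      ∀ i : Fin s, getWire b (n + 1 + i) =
        if (i : ℕ) < n then false else F (Fin.cons true fun _ => false) i := by
  set w := qubits (n + 1) s (halfTagCircuit n) with hwdef
  have hw : n + 1 + s ≤ w := by simp [hwdef, qubits]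
  set β : BitString w := setWire (fun _ => false) 0 true with hβ
  set b₁ : BitString w := putWires (n + 1) (fun _ => false : BitString n) (queryBasis F β) with hb₁
  have hX1 : regX (n + 1) β = Fin.cons true fun _ => false := by
    funext i
    refine Fin.cases ?_ (fun i => ?_) i
    · exact getWire_setWire_self _ (by omega) _
    · change getWire β ((i.succ : Fin _) : ℕ) = false
      rw [hβ, getWire_setWire_ne _ (by simp)]
      simp [getWire]
  have hXp : ∀ (u : BitString n) (b : BitString w),
      regX (n + 1) (putWires (n + 1) u b) = regX (n + 1) b := by
    intro u b
    funext i
    exact getWire_putWires_of_notMem _ _ (by omega)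
  have hXb : regX (n + 1) b₁ = Fin.cons true fun _ => false := by
    rw [hb₁, hXp, regX_queryBasis, hX1]
  refine ⟨setWire b₁ 0 false, ?_, ?_, ?_⟩
  · rw [runCircuit_eq F _ (n + 1) n]
    change applyAll F ([Gate.not 0] ++ (hadLayer (n + 1) n ++ ([Gate.query] ++
      (hadLayer (n + 1) n ++ [Gate.not 0])))) _ _ = 1
    rw [applyAll_append, applyAll_append, applyAll_append, applyAll_append,
      applyAll_not_embState F (by omega) (by omega), applyAll_hadLayer_embState F (by omega)]
    have hg : getWire (fun _ => false : BitString w) 0 = false := by simp [getWire]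
    have hg1 : getWire b₁ 0 = true := congrFun hXb 0
    have hset : setWire (setWire b₁ 0 false) 0 (!getWire (setWire b₁ 0 false) 0) = b₁ := by
      rw [getWire_setWire_self _ (by omega), setWire_setWire, Bool.not_false, ← hg1,
        setWire_getWire]
    rw [hg, Bool.not_false, ← hβ]
    conv_lhs => rw [applyAll_singleton]; simp only [Gate.apply]
    rw [hset, applyAll_hadLayer F _ _ (by omega)]
    have hchi : getWires (n + 1) n b₁ = fun _ => false := getWires_putWires _ _ (by omega)
    have hval : ∀ u : BitString n, applyAll F [Gate.query] (embState (n + 1) β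
        (fourier fun u : BitString n => if u = fun _ => false then 1 else 0))
        (putWires (n + 1) u b₁) = ((1 / Real.sqrt 2 : ℝ) : ℂ) ^ n := by
      intro u
      rw [applyAll_singleton]
      simp only [Gate.apply, embState]
      rw [if_pos]
      · simp [fourier]
      · funext j
        simp only [putWires]
        split_ifs with h
        · simp only [getWires, getWire]
          rw [dif_pos (by have := j.2; omega)]
          congr 1; ext; simp; omega
        · by_cases hj : (j : ℕ) < n + 1
          · rw [queryBasis_apply_of_lt _ _ hj]
            simp only [putWires, hb₁, h, dif_neg, not_false_iff]
            rw [queryBasis_apply_of_lt _ _ hj]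
          · by_cases hj2 : (j : ℕ) < n + 1 + s
            · have e1 : queryBasis F (putWires (n + 1) u b₁) j
                  = ((putWires (n + 1) u b₁ j) ^^ F (regX (n + 1) (putWires (n + 1) u b₁))
                    ⟨(j : ℕ) - (n + 1), by omega⟩) := by
                simp only [queryBasis]; rw [dif_pos (by omega)]
              have e2 : queryBasis F β j
                  = (β j ^^ F (regX (n + 1) β) ⟨(j : ℕ) - (n + 1), by omega⟩) := by
                simp only [queryBasis]; rw [dif_pos (by omega)]
              have e3 : putWires (n + 1) u b₁ j = queryBasis F β j := by
                simp only [putWires, hb₁, h, dif_neg, not_false_iff]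
              rw [e1, hXp, hXb, e3, e2, hX1]
              simp
            · have e1 : queryBasis F (putWires (n + 1) u b₁) j = putWires (n + 1) u b₁ j := by
                simp only [queryBasis]; rw [dif_neg (by omega)]
              have e2 : queryBasis F β j = β j := by
                simp only [queryBasis]; rw [dif_neg (by omega)]
              have e3 : putWires (n + 1) u b₁ j = queryBasis F β j := by
                simp only [putWires, hb₁, h, dif_neg, not_false_iff]
              rw [e1, e3, e2]
    simp only [hval, hchi, chi_zero_left]
    rw [Finset.sum_const, Finset.card_univ]
    simp only [Complex.ofReal_one, one_mul, nsmul_eq_mul]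
    rw [mul_left_comm, invSqrtTwo_pow_mul_self]
    simp
  · funext i
    refine Fin.cases ?_ (fun i => ?_) i
    · exact getWire_setWire_self _ (by omega) _
    · have h1 : regX (n + 1) (setWire b₁ 0 false) i.succ = regX (n + 1) b₁ i.succ :=
        getWire_setWire_ne _ (by simp) _
      rw [h1, hXb]
      simp
  · intro i
    rw [getWire_setWire_ne _ (by omega)]
    split_ifs with hi
    -- the second Hadamard layer takes the first half of the register back to zero
    · exact getWire_putWires_of_mem _ _ hi (by omega)
    · rw [hb₁, getWire_putWires_of_notMem _ _ (by omega)]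
      have hiw : n + 1 + (i : ℕ) < w := by omega
      simp only [getWire, queryBasis]
      rw [dif_pos hiw, dif_pos (by omega), hX1]
      have : β ⟨n + 1 + i, hiw⟩ = false := by simp [hβ, setWire]
      rw [this]
      simp

theorem periodicMAC_not_buSecure : ¬ BUSecure periodicMAC := by
  refine not_buSecure_of_le (halfAdversary _ uniformFamily_halfTagCircuit) (c := 1 / 8)
    (by norm_num) fun n hn => ?_
  rw [blindForge_halfAdversary]
  have : Nonempty (periodicMAC.Key n) := inferInstanceAs (Nonempty (PeriodicKey n))
  rw [expectKey_uniform rfl]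
  set m₀ : BitString (n + 1) := fun _ => false with hm₀
  set m₁ : BitString (n + 1) := Fin.cons true fun _ => false with hm₁
  have hne : m₀ ≠ m₁ := fun h => by simpa [m₀, m₁] using congrFun h 0
  -- the attack succeeds if `m₀` is blinded and `m₁` is not
  have hwin : ∀ (k : PeriodicKey n) (B : Finset (BitString (n + 1))), k.1 ≠ (fun _ => false) →
      m₀ ∈ B → m₁ ∉ B → 1 ≤ forgeProb periodicMAC (halfTagCircuit n) k B := by
    intro k B hk h0 h1
    obtain ⟨b, hb, hbX, hbY⟩ := runCircuit_halfTagCircuit (n := n) (s := n + n + 1) (by omega)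
      (blind B (periodicTag k))
    have := le_forgeProb periodicMAC (halfTagCircuit n) k B b ?_ ?_
    · refine le_trans (le_of_eq ?_) this
      change 1 = ‖runCircuit (blind B (periodicTag k)) (halfTagCircuit n) b‖ ^ 2
      rw [hb]; norm_num
    · change regX (n + 1) b ∈ B
      rw [hbX]; exact h0
    · change periodicTag k (regX (n + 1) b) = regY (n + 1) (n + n) b
      rw [hbX]
      have ht : periodicTag k m₀ = Fin.append (fun _ => false) (k.2.1 fun _ => false) := by
        have : Fin.tail m₀ ≠ k.1 := fun h => hk h.symm
        simp only [periodicTag]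
        rw [if_neg (by simp [m₀]), if_neg this]
        rfl
      have ht1 : periodicTag k m₁ = Fin.append (k.2.2 (BitString.mod (fun _ => false) k.1))
          (k.2.1 fun _ => false) := by
        simp only [periodicTag]
        rw [if_pos (by simp [m₁])]
        rfl
      rw [← hm₀, ht]
      funext i
      have hY : regY (n + 1) (n + n) b i = getWire b (n + 1 + ((i.castSucc : Fin (n + n + 1)) : ℕ)) :=
        rfl
      rw [hY, hbY]
      simp only [Fin.val_castSucc]
      refine Fin.addCases (fun i => ?_) (fun i => ?_) i
      · simp
      · rw [if_neg (by simp), ← hm₁]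
        simp only [blind]
        rw [if_neg h1, Fin.snoc_castSucc, ht1, Fin.append_right, Fin.append_right]
  have hB : ∀ k : PeriodicKey n, k.1 ≠ (fun _ => false) →
      1 / 4 ≤ 𝔼 B, forgeProb periodicMAC (halfTagCircuit n) k B := by
    intro k hk
    have h1 : 𝔼 B : Finset (BitString (n + 1)),
        (if decide (m₀ ∈ B) then (1 : ℝ) else 0) * ((if decide (m₁ ∈ B) then (0 : ℝ) else 1) * 1)
        = 1 / 4 := by
      rw [expect_mem_mul m₀ (fun v => if v then (1 : ℝ) else 0),
        expect_mem_mul m₁ (fun v => if v then (0 : ℝ) else 1), Fintype.expect_one]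
      · norm_num
      · intro B; rfl
      · intro B
        simp only [mem_symmDiff_singleton_of_ne hne.symm]
    rw [← h1]
    refine Finset.expect_le_expect fun B _ => ?_
    by_cases h0 : m₀ ∈ B
    · by_cases h1 : m₁ ∈ B
      · simpa [h0, h1] using forgeProb_nonneg periodicMAC _ _ B
      · simpa [h0, h1] using hwin k B hk h0 h1
    · simpa [h0] using forgeProb_nonneg periodicMAC _ _ B
  -- the key with `p = 0` has to be excluded, since then the special message is `m₀`
  change 1 / 8 ≤ 𝔼 k : PeriodicKey n, _
  rw [expect_prod]
  have hpow : (2 : ℝ) ≤ 2 ^ n := by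
    calc (2 : ℝ) = 2 ^ 1 := by norm_num
      _ ≤ 2 ^ n := by gcongr; norm_num
  have h1 : 𝔼 p : BitString n, ((1 / 4 : ℝ) - if p = (fun _ => false) then 1 / 4 else 0)
      = 1 / 4 - 1 / 4 / 2 ^ n := by
    rw [Finset.expect_sub_distrib, Fintype.expect_const, Fintype.expect_eq_sum_div_card,
      Finset.sum_ite_eq' Finset.univ]
    simp
  have h2 : (1 / 8 : ℝ) ≤ 1 / 4 - 1 / 4 / 2 ^ n := by
    have : (1 / 4 : ℝ) / 2 ^ n ≤ 1 / 4 / 2 := by gcongr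
    linarith
  refine h2.trans (h1 ▸ Finset.expect_le_expect fun p _ => ?_)
  split_ifs with hp
  · rw [sub_self]
    exact Finset.expect_nonneg fun q _ => Finset.expect_nonneg fun B _ => forgeProb_nonneg _ _ _ _
  · rw [sub_zero]
    exact Finset.le_expect Finset.univ_nonempty fun q _ => hB (p, q) hp

/-! ### The hidden shift MAC -/

section Dot

lemma sgn_bodd_sum {ι : Type*} (s : Finset ι) (f : ι → Bool) :
    sgn (∑ i ∈ s, (f i).toNat).bodd = ∏ i ∈ s, sgn (f i) := by
  classical
  induction s using Finset.induction_on with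
  | empty => simp
  | insert i s hi ih =>
    rw [Finset.sum_insert hi, Finset.prod_insert hi, Nat.bodd_add, sgn_xor, ih]
    cases f i <;> simp

variable {ι : Type*} [Fintype ι]

/-- The parity of the bitwise conjunction of two strings, their inner product modulo two. -/
def dot (a b : ι → Bool) : Bool := (∑ i, (a i && b i).toNat).bodd

lemma sgn_dot (a b : ι → Bool) : sgn (dot a b) = chi a b := sgn_bodd_sum _ _

end Dot

/-- The first half of a string. -/
def leftHalf {n : ℕ} (x : BitString (n + n)) : BitString n := fun i => x (Fin.castAdd n i)

/-- The second half of a string. -/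
def rightHalf {n : ℕ} (x : BitString (n + n)) : BitString n := fun i => x (Fin.natAdd n i)

/-- Application of a matrix modulo two, given by its rows, to a vector. -/
def matVec {n : ℕ} (A : Fin n → BitString n) (x : BitString n) : BitString n := fun i => dot (A i) x

/-- Application of the transposed matrix. -/
def vecMat {n : ℕ} (A : Fin n → BitString n) (z : BitString n) : BitString n :=
  fun j => dot z fun i => A i j

/-- The linear map `(x₁, x₂) ↦ x₁ + A x₂`. -/
def lin {n : ℕ} (A : Fin n → BitString n) (x : BitString (n + n)) : BitString n :=
  fun i => leftHalf x i ^^ matVec A (rightHalf x) i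

/-- The parameters `(A, w)` of the hidden shift MAC: a matrix and a shift. -/
abbrev ShiftParam (n : ℕ) : Type := (Fin n → BitString n) × BitString n

/-- The keys `((A, w), p, g, f)` of the hidden shift MAC. -/
abbrev ShiftKey (n : ℕ) : Type :=
  ShiftParam n × BitString (n + n) × (BitString n → Bool) × (BitString (n + n + 2) → BitString n)

/-- The message `a‖b‖x`. -/
def mkMsg {n : ℕ} (a b : Bool) (x : BitString (n + n)) : BitString (n + n + 2) :=
  Fin.cons (α := fun _ => Bool) a (Fin.cons (α := fun _ => Bool) b x : Fin (n + n + 1) → Bool)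

/-- The last `2 n` bits of a message. -/
def body {n : ℕ} (m : BitString (n + n + 2)) : BitString (n + n) := fun i => m i.succ.succ

/-- The first bit of the tag. For `L = lin A`, it is `g (L x)` on `01‖x` and `g (L x + w) + p · x` on
`11‖x`, and it is `z · w` on `10‖x` if `x = (z, Aᵀ z)`. In all other cases it is `0`. -/
def headBit {n : ℕ} (A : Fin n → BitString n) (w : BitString n) (p : BitString (n + n))
    (g : BitString n → Bool) (m : BitString (n + n + 2)) : Bool :=
  match m 0, m 1 with
  | false, false => false
  | false, true => g (lin A (body m))
  | true, false =>
    if rightHalf (body m) = vecMat A (leftHalf (body m)) then dot (leftHalf (body m)) w else false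
  | true, true => g (fun i => lin A (body m) i ^^ w i) ^^ dot p (body m)

/-- The tag of the special message `00‖p` is `0…0`, the tag of any other message `m` consists of
`headBit m` and the random string `f m`. -/
def shiftTag {n : ℕ} (k : ShiftKey n) (m : BitString (n + n + 2)) : BitString (n + 1) :=
  if m = mkMsg false false k.2.1 then fun _ => false
  else Fin.cons (α := fun _ => Bool) (headBit k.1.1 k.1.2 k.2.1 k.2.2.1 m) (k.2.2.2 m)

/-- The hidden shift MAC, with a uniformly random key. -/
def shiftMAC : MAC where
  msgLen n := n + n + 2
  tagLen n := n + 1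
  msgLen_poly := ⟨Polynomial.X + Polynomial.X + 2, fun n => by simp⟩
  tagLen_poly := ⟨Polynomial.X + 1, fun n => by simp⟩
  Key := ShiftKey
  keyFintype := fun _ => inferInstance
  keyGen n := PMF.uniformOfFintype (ShiftKey n)
  mac _ k m := shiftTag k m

section Msg

variable {n : ℕ}

@[simp] lemma mkMsg_zero (a b : Bool) (x : BitString (n + n)) : mkMsg a b x 0 = a := rfl
@[simp] lemma mkMsg_one (a b : Bool) (x : BitString (n + n)) : mkMsg a b x 1 = b := rfl
@[simp] lemma body_mkMsg (a b : Bool) (x : BitString (n + n)) : body (mkMsg a b x) = x := rfl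

lemma mkMsg_body (m : BitString (n + n + 2)) : mkMsg (m 0) (m 1) (body m) = m := by
  funext i
  refine Fin.cases rfl (fun i => ?_) i
  exact Fin.cases rfl (fun i => rfl) i

lemma mkMsg_inj {a b a' b' : Bool} {x x' : BitString (n + n)} :
    mkMsg a b x = mkMsg a' b' x' ↔ a = a' ∧ b = b' ∧ x = x' := by
  constructor
  · intro h
    exact ⟨by simpa using congrFun h 0, by simpa using congrFun h 1, by
      simpa using congrArg body h⟩
  · rintro ⟨rfl, rfl, rfl⟩; rfl

/-- The vector `(z, Aᵀ z)`. -/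
def rowVec (A : Fin n → BitString n) (z : BitString n) : BitString (n + n) :=
  Fin.append z (vecMat A z)

lemma chi_append (a b : BitString n) (x : BitString (n + n)) :
    chi (Fin.append a b) x = chi a (leftHalf x) * chi b (rightHalf x) := by
  simp only [chi, Fin.prod_univ_add, Fin.append_left, Fin.append_right]
  rfl

/-- The sign of a conjunction with an inner product. -/
lemma sgn_and_dot {ι : Type*} [Fintype ι] (c : Bool) (a b : ι → Bool) :
    sgn (c && dot a b) = ∏ j, sgn (c && (a j && b j)) := by
  cases c
  · simp
  · simp [sgn_dot, chi]

/-- The map `rowVec A` is dual to `lin A`. -/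
lemma chi_lin (A : Fin n → BitString n) (z : BitString n) (x : BitString (n + n)) :
    chi z (lin A x) = chi (rowVec A z) x := by
  rw [rowVec, chi_append]
  have : lin A x = fun i => leftHalf x i ^^ matVec A (rightHalf x) i := rfl
  rw [this, chi_xor_right]
  congr 1
  have h1 : chi z (matVec A (rightHalf x))
      = ∏ i, ∏ j, sgn (z i && (A i j && rightHalf x j)) :=
    Finset.prod_congr rfl fun i _ => sgn_and_dot _ _ _
  have h2 : chi (vecMat A z) (rightHalf x)
      = ∏ j, ∏ i, sgn (z i && (A i j && rightHalf x j)) := by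
    refine Finset.prod_congr rfl fun j _ => ?_
    rw [Bool.and_comm, vecMat, sgn_and_dot]
    refine Finset.prod_congr rfl fun i _ => ?_
    congr 1
    cases rightHalf x j <;> cases z i <;> cases A i j <;> rfl
  rw [h1, h2, Finset.prod_comm]

end Msg

/-! ### The attack on the hidden shift MAC -/

/-- The circuit that finds the special message. Between Hadamard layers on the last `2 n` bits of the
message, the phases of the messages that start with `01`, `10` and `11` are applied. -/
def shiftCircuit (n : ℕ) : Circuit :=
  hadLayer 2 (n + n) ++ ([Gate.not 1] ++ (phaseQuery (n + n + 2) ++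
  (hadLayer 2 (n + n) ++ ([Gate.not 0] ++ ([Gate.not 1] ++ (phaseQuery (n + n + 2) ++
  (hadLayer 2 (n + n) ++ ([Gate.not 1] ++ (phaseQuery (n + n + 2) ++
  (hadLayer 2 (n + n) ++ ([Gate.not 0] ++ [Gate.not 1])))))))))))

lemma uniformFamily_shiftCircuit : UniformFamily shiftCircuit := by
  let not₀ : Item Sym := .const (encodeCircuit [Gate.not 0])
  let not₁ : Item Sym := .const (encodeCircuit [Gate.not 1])
  let qry : Item Sym := .const (encodeCircuit [Gate.query])
  let ly : Item Sym := .layer (wirePrefix .had 2) .one .sep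
  let t : Item Sym := .single (wirePrefix .t 2) .one .sep
  refine ScriptMachine.computable encodeCircuit _ true
    [ly, not₁, qry, t, t, t, t, qry, ly, not₀, not₁, qry, t, t, t, t, qry, ly, not₁,
      qry, t, t, t, t, qry, ly, not₀, not₁]
    (by simp [Item.IsWrite, not₀, not₁, qry, ly, t]) fun n => ?_
  have hc : ScriptMachine.counter true n = 2 * n := by
    simp [ScriptMachine.counter, ScriptMachine.loadFactor]
  have hl : ly.out (2 * n) (2 * n) = encodeCircuit (hadLayer 2 (n + n)) := by
    have := out_layer 2 (2 * n) (2 * n)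
    rw [Nat.sub_self, add_zero] at this
    exact this.trans (by rw [two_mul])
  have ht : t.out (2 * n) (2 * n) = encodeCircuit [Gate.t (n + n + 2)] := by
    have := out_single 2 (2 * n) (2 * n)
    rwa [show 2 + 2 * n = n + n + 2 by omega] at this
  have h0 : ∀ a b, not₀.out a b = encodeCircuit [Gate.not 0] := fun a b => rfl
  have h1 : ∀ a b, not₁.out a b = encodeCircuit [Gate.not 1] := fun a b => rfl
  have hq : ∀ a b, qry.out a b = encodeCircuit [Gate.query] := fun a b => rfl
  have hp : encodeCircuit (phaseQuery (n + n + 2)) = encodeCircuit [Gate.query] ++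
      (encodeCircuit [Gate.t (n + n + 2)] ++ (encodeCircuit [Gate.t (n + n + 2)] ++
      (encodeCircuit [Gate.t (n + n + 2)] ++ (encodeCircuit [Gate.t (n + n + 2)] ++
      encodeCircuit [Gate.query])))) := by
    simp only [← encodeCircuit_append]; rfl
  simp only [hc, List.flatMap_cons, List.flatMap_nil, List.append_nil, hl, ht, h0, h1, hq,
    shiftCircuit, encodeCircuit_append, hp, List.append_assoc]

/-- The amplitude of the special message `00‖p` after the attack, where the phases that are applied
are `φ₁`, `φ₂` and `φ₃`. -/
def attackAmp {N : ℕ} (φ₁ φ₂ φ₃ : BitString N → ℝ) (p : BitString N) : ℝ :=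
  (1 / 2) ^ (N + N) * ∑ x' : BitString N, ∑ y : BitString N, ∑ x : BitString N,
    chi p x' * chi x' y * chi y x * (φ₁ x * (φ₂ y * φ₃ x'))

lemma fourier_fourier_fourier_fourier {N : ℕ} (φ₁ φ₂ φ₃ : BitString N → ℝ) (p : BitString N) :
    fourier (fun x' => (φ₃ x' : ℂ) * fourier (fun y => (φ₂ y : ℂ) * fourier (fun x => (φ₁ x : ℂ) *
      fourier (fun u => if u = fun _ => false then 1 else 0) x) y) x') p
      = (attackAmp φ₁ φ₂ φ₃ p : ℂ) := by
  have h2 := invSqrtTwo_pow_mul_self N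
  unfold fourier attackAmp
  generalize ((1 / Real.sqrt 2 : ℝ) : ℂ) ^ N = c at h2 ⊢
  have h3 : c ^ 4 = (1 / 2) ^ (N + N) := by
    rw [pow_add, ← h2]; ring
  simp only [Complex.ofReal_mul, Complex.ofReal_sum, Complex.ofReal_pow, Complex.ofReal_div,
    Complex.ofReal_one, Complex.ofReal_ofNat]
  rw [← h3]
  simp only [mul_ite, mul_one, mul_zero, Finset.sum_ite_eq', Finset.mem_univ, if_true,
    chi_zero_right, Complex.ofReal_one, Finset.mul_sum]
  refine Finset.sum_congr rfl fun x' _ => Finset.sum_congr rfl fun y _ =>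
    Finset.sum_congr rfl fun x _ => ?_
  ring

/-- Running `shiftCircuit` is a fourfold Fourier transform of the message body, with three phases in
between. The basis state `b` has the message `00‖p` with the tag `0…0` in its query registers. -/
lemma runCircuit_shiftCircuit {n s : ℕ} (hs : 0 < s)
    (F : BitString (n + n + 2) → BitString s) (p : BitString (n + n)) :
    ∃ b : BitString (qubits (n + n + 2) s (shiftCircuit n)),
      regX (n + n + 2) b = mkMsg false false p ∧
      (∀ i : Fin s, getWire b (n + n + 2 + i) = false) ∧
      runCircuit F (shiftCircuit n) b = (attackAmp
        (fun x => sgn (F (mkMsg false true x) ⟨0, hs⟩))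
        (fun x => sgn (F (mkMsg true false x) ⟨0, hs⟩))
        (fun x => sgn (F (mkMsg true true x) ⟨0, hs⟩)) p : ℂ) := by
  set w := qubits (n + n + 2) s (shiftCircuit n) with hwdef
  have hw : n + n + 2 + s ≤ w := by simp [hwdef, qubits]
  let β : Bool → Bool → BitString w := fun a b => setWire (setWire (fun _ => false) 0 a) 1 b
  have hβ0 : (fun _ => false) = β false false := by
    funext j; simp [β, setWire]
  have hg1 : ∀ a b, getWire (β a b) 1 = b := fun a b => getWire_setWire_self _ (by omega) _
  have hg0 : ∀ a b, getWire (β a b) 0 = a := fun a b => by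
    rw [getWire_setWire_ne _ (by omega), getWire_setWire_self _ (by omega)]
  have hgw : ∀ a b i, 2 ≤ i → getWire (β a b) i = false := fun a b i hi => by
    rw [getWire_setWire_ne _ (by omega), getWire_setWire_ne _ (by omega)]; simp [getWire]
  have hs1 : ∀ a b c, setWire (β a b) 1 c = β a c := fun a b c => setWire_setWire _ _ _ _
  have hs0 : ∀ a b c, setWire (β a b) 0 c = β c b := fun a b c => by
    funext j; simp only [β, setWire]; split_ifs <;> first | rfl | omega
  have hX : ∀ a b u, regX (n + n + 2) (putWires 2 u (β a b)) = mkMsg a b u := by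
    intro a b u
    funext i
    refine Fin.cases ?_ (fun i => ?_) i
    · exact (getWire_putWires_of_notMem _ _ (by simp)).trans (hg0 a b)
    · refine Fin.cases ?_ (fun i => ?_) i
      · exact (getWire_putWires_of_notMem _ _ (by simp)).trans (hg1 a b)
      · have := getWire_putWires_of_mem u (β a b) i.2 (by omega : 2 + (n + n) ≤ w)
        have e : ((i.succ.succ : Fin (n + n + 2)) : ℕ) = 2 + i := by simp; omega
        change getWire _ ((i.succ.succ : Fin (n + n + 2)) : ℕ) = u i
        rw [e]
        exact this
  have hP : ∀ a b ξ, applyAll F (phaseQuery (n + n + 2)) (embState 2 (β a b) ξ)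
      = embState 2 (β a b) fun u => (sgn (F (mkMsg a b u) ⟨0, hs⟩) : ℂ) * ξ u := by
    intro a b ξ
    rw [applyAll_phaseQuery_embState F hs hw (by omega) _ (hgw a b _ (by omega))]
    simp only [hX]
  have hN1 : ∀ a b (ξ : BitString (n + n) → ℂ), applyAll F [Gate.not 1] (embState 2 (β a b) ξ)
      = embState 2 (β a (!b)) ξ := by
    intro a b ξ
    rw [applyAll_not_embState F (by omega) (by omega), hg1, hs1]
  have hN0 : ∀ a b (ξ : BitString (n + n) → ℂ), applyAll F [Gate.not 0] (embState 2 (β a b) ξ)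
      = embState 2 (β (!a) b) ξ := by
    intro a b ξ
    rw [applyAll_not_embState F (by omega) (by omega), hg0, hs0]
  have hH : ∀ a b (ξ : BitString (n + n) → ℂ),
      applyAll F (hadLayer 2 (n + n)) (embState 2 (β a b) ξ) = embState 2 (β a b) (fourier ξ) :=
    fun a b ξ => applyAll_hadLayer_embState F (by omega) _ _
  refine ⟨putWires 2 p (β false false), hX _ _ _, fun i => ?_, ?_⟩
  · rw [getWire_putWires_of_notMem _ _ (by omega), hgw _ _ _ (by omega)]
  · rw [runCircuit_eq F _ 2 (n + n), hβ0]
    change applyAll F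
      (hadLayer 2 (n + n) ++ ([Gate.not 1] ++ (phaseQuery (n + n + 2) ++
      (hadLayer 2 (n + n) ++ ([Gate.not 0] ++ ([Gate.not 1] ++ (phaseQuery (n + n + 2) ++
      (hadLayer 2 (n + n) ++ ([Gate.not 1] ++ (phaseQuery (n + n + 2) ++
      (hadLayer 2 (n + n) ++ ([Gate.not 0] ++ [Gate.not 1])))))))))))) _ _ = _
    simp only [applyAll_append, hH, hP, hN0, hN1, Bool.not_false, Bool.not_true]
    simp only [embState]
    rw [getWires_putWires _ _ (by omega), if_pos rfl, fourier_fourier_fourier_fourier]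

/-- The sign of the first bit of a blinded tag, as a function of the membership in the blinding
set. -/
def blindSgn (c b : Bool) : ℝ := if b then 1 else sgn c

/-- The four messages that matter for the attack are distinct, so that they are blinded
independently. -/
lemma expect_blindSgn {n : ℕ} (x' y x p : BitString (n + n))
    (c : BitString (n + n + 2) → Bool) :
    𝔼 B : Finset (BitString (n + n + 2)), (if mkMsg false false p ∈ B then (1 : ℝ) else 0) *
      (blindSgn (c (mkMsg false true x)) (decide (mkMsg false true x ∈ B)) *
      (blindSgn (c (mkMsg true false y)) (decide (mkMsg true false y ∈ B)) *
      blindSgn (c (mkMsg true true x')) (decide (mkMsg true true x' ∈ B))))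
      = 1 / 2 * ((1 + sgn (c (mkMsg false true x))) / 2 * ((1 + sgn (c (mkMsg true false y))) / 2 *
        ((1 + sgn (c (mkMsg true true x'))) / 2))) := by
  have hmem : ∀ {a b a' b' : Bool} (u v : BitString (n + n)) (B : Finset (BitString (n + n + 2))),
      (a, b) ≠ (a', b') →
        (mkMsg a' b' v ∈ symmDiff B {mkMsg a b u} ↔ mkMsg a' b' v ∈ B) := fun u v B h =>
    mem_symmDiff_singleton_of_ne (fun e => h (by
      rw [(mkMsg_inj.1 e).1, (mkMsg_inj.1 e).2.1])) B
  have h1 := expect_mem_mul (mkMsg false false p) (fun b => if b then (1 : ℝ) else 0) (fun B =>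
      (blindSgn (c (mkMsg false true x)) (decide (mkMsg false true x ∈ B)) *
      (blindSgn (c (mkMsg true false y)) (decide (mkMsg true false y ∈ B)) *
      blindSgn (c (mkMsg true true x')) (decide (mkMsg true true x' ∈ B))))) fun B => by
    simp only [hmem (a := false) (b := false) (a' := false) (b' := true) _ _ _ (by decide),
      hmem (a := false) (b := false) (a' := true) (b' := false) _ _ _ (by decide),
      hmem (a := false) (b := false) (a' := true) (b' := true) _ _ _ (by decide)]
  have h2 := expect_mem_mul (mkMsg false true x) (blindSgn (c (mkMsg false true x))) (fun B =>
      (blindSgn (c (mkMsg true false y)) (decide (mkMsg true false y ∈ B)) *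
      blindSgn (c (mkMsg true true x')) (decide (mkMsg true true x' ∈ B)))) fun B => by
    simp only [hmem (a := false) (b := true) (a' := true) (b' := false) _ _ _ (by decide),
      hmem (a := false) (b := true) (a' := true) (b' := true) _ _ _ (by decide)]
  have h3 := expect_mem_mul (mkMsg true false y) (blindSgn (c (mkMsg true false y))) (fun B =>
      blindSgn (c (mkMsg true true x')) (decide (mkMsg true true x' ∈ B))) fun B => by
    simp only [hmem (a := true) (b := false) (a' := true) (b' := true) _ _ _ (by decide)]
  have h4 := expect_mem_mul (mkMsg true true x') (blindSgn (c (mkMsg true true x'))) (fun _ => 1)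
    fun B => rfl
  simp only [mul_one, Fintype.expect_const] at h4
  simp only [decide_eq_true_eq] at h1
  rw [h1, h2, h3, h4]
  simp [blindSgn]

/-- The values of a random function at two points are independent unbiased bits, unless the points
are equal. -/
lemma expect_sgn_mul_sgn {U : Type*} [Fintype U] [DecidableEq U] (u v : U) (c : ℝ) :
    𝔼 g : U → Bool, (1 + sgn (g u)) * (1 + sgn (g v) * c) = 1 + if u = v then c else 0 := by
  have hflip : ∀ (φ : (U → Bool) → ℝ) (u : U), (∀ g, φ (xorEquiv (fun i => decide (i = u)) g) =
      - φ g) → 𝔼 g, φ g = 0 := by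
    intro φ u h
    have := Fintype.expect_equiv (xorEquiv fun i => decide (i = u)) (fun g => - φ g) φ
      fun g => (h g).symm
    rw [Finset.expect_neg_distrib] at this
    linarith
  have hnot : ∀ b, sgn (!b) = - sgn b := fun b => by cases b <;> simp
  have h1 : ∀ u, 𝔼 g : U → Bool, sgn (g u) = 0 := fun u => hflip _ u fun g => by
    simp [hnot]
  have h2 : 𝔼 g : U → Bool, sgn (g u) * sgn (g v) = if u = v then (1 : ℝ) else 0 := by
    split_ifs with h
    · subst h; simp [sgn_mul_self]
    · refine hflip _ u fun g => ?_
      simp [hnot, Ne.symm h]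
  have e : ∀ g : U → Bool, (1 + sgn (g u)) * (1 + sgn (g v) * c)
      = 1 + sgn (g u) + sgn (g v) * c + sgn (g u) * sgn (g v) * c := fun g => by ring
  simp only [e, Finset.expect_add_distrib, ← Finset.expect_mul, h1, h2, Fintype.expect_const]
  split_ifs <;> ring

section Amplitude

variable {n : ℕ} (A : Fin n → BitString n) (w : BitString n) (p : BitString (n + n))

/-- The expected phase applied to a message when the blinding set is random. -/
def avgPhase (g : BitString n → Bool) (m : BitString (n + n + 2)) : ℝ :=
  (1 + sgn (headBit A w p g m)) / 2

lemma sgn_headBit_rowVec (g : BitString n → Bool) (z : BitString n) :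
    sgn (headBit A w p g (mkMsg true false (rowVec A z))) = chi z w := by
  have h1 : leftHalf (rowVec A z) = z := by
    funext i; exact Fin.append_left _ _ _
  have h2 : rightHalf (rowVec A z) = vecMat A z := by
    funext i; exact Fin.append_right _ _ _
  simp only [headBit, mkMsg_zero, mkMsg_one, body_mkMsg, h1, h2, if_true]
  exact sgn_dot _ _

lemma expect_avgPhase (x x' : BitString (n + n)) :
    𝔼 g, avgPhase A w p g (mkMsg false true x) * avgPhase A w p g (mkMsg true true x')
      = (1 + if (fun i => lin A x i ^^ lin A x' i) = w then chi p x' else 0) / 4 := by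
  have e : ∀ g : BitString n → Bool,
      avgPhase A w p g (mkMsg false true x) * avgPhase A w p g (mkMsg true true x')
      = (1 + sgn (g (lin A x))) * (1 + sgn (g fun i => lin A x' i ^^ w i) * chi p x') / 4 := by
    intro g
    simp only [avgPhase, headBit, mkMsg_zero, mkMsg_one, body_mkMsg, sgn_xor, sgn_dot]
    ring
  have hiff : (lin A x = fun i => lin A x' i ^^ w i) ↔ (fun i => lin A x i ^^ lin A x' i) = w := by
    rw [← xor_eq_zero_iff, ← xor_eq_zero_iff _ w]
    simp only [Bool.xor_assoc]
  rw [Finset.expect_congr rfl fun g _ => e g, ← Finset.expect_div, expect_sgn_mul_sgn]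
  simp only [hiff]

/-- The linear constraint becomes, after a Fourier transform, a superposition of the vectors
`rowVec A z`, on which the phase `φ` is correlated with the character `w`. -/
lemma sum_chi_avgPhase (φ : BitString (n + n) → ℝ)
    (hφ : ∀ z, φ (rowVec A z) = (1 + chi z w) / 2) :
    (2 ^ (n + n + (n + n)) : ℝ) / 2 ≤ ∑ x' : BitString (n + n), ∑ y : BitString (n + n),
      ∑ x : BitString (n + n), chi x' y * chi y x * φ y *
        (if (fun i => lin A x i ^^ lin A x' i) = w then 1 else 0) := by
  have hind : ∀ x x' : BitString (n + n),
      (2 ^ n : ℝ) * (if (fun i => lin A x i ^^ lin A x' i) = w then (1 : ℝ) else 0)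
        = ∑ z : BitString n, chi z w * (chi (rowVec A z) x * chi (rowVec A z) x') := by
    intro x x'
    have := sum_chi_mul_chi (fun i => lin A x i ^^ lin A x' i) w
    simp only [chi_xor_right, chi_lin, Fintype.card_fin] at this
    rw [mul_ite, mul_one, mul_zero, ← this]
    exact Finset.sum_congr rfl fun z _ => mul_comm _ _
  have hpair : ∀ y z : BitString (n + n), ∑ x, chi y x * chi z x
      = if y = z then (2 ^ (n + n) : ℝ) else 0 := by
    intro y z
    simpa only [chi_comm _ y, chi_comm _ z, Fintype.card_fin] using sum_chi_mul_chi y z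
  have hrow : ∀ y z : BitString (n + n), (∑ x, chi y x * chi z x) * (∑ x', chi y x' * chi z x')
      = if y = z then (2 ^ (n + n + (n + n)) : ℝ) else 0 := by
    intro y z
    rw [hpair]
    split_ifs
    · exact (pow_add _ _ _).symm
    · simp
  have key : (2 ^ n : ℝ) * ∑ x' : BitString (n + n), ∑ y : BitString (n + n),
      ∑ x : BitString (n + n), chi x' y * chi y x * φ y *
        (if (fun i => lin A x i ^^ lin A x' i) = w then 1 else 0)
      = ∑ z : BitString n, chi z w * ((1 + chi z w) / 2) * 2 ^ (n + n + (n + n)) := by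
    calc _ = ∑ x' : BitString (n + n), ∑ y : BitString (n + n), ∑ x : BitString (n + n),
          ∑ z : BitString n, chi z w * φ y * ((chi y x * chi (rowVec A z) x) *
            (chi y x' * chi (rowVec A z) x')) := by
          simp only [Finset.mul_sum (Finset.univ : Finset (BitString (n + n)))]
          refine Finset.sum_congr rfl fun x' _ => Finset.sum_congr rfl fun y _ =>
            Finset.sum_congr rfl fun x _ => ?_
          rw [mul_left_comm, hind, Finset.mul_sum]
          refine Finset.sum_congr rfl fun z _ => ?_
          rw [chi_comm x' y]
          ring
      _ = ∑ z : BitString n, ∑ y : BitString (n + n), chi z w * φ y *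
            ((∑ x, chi y x * chi (rowVec A z) x) * (∑ x', chi y x' * chi (rowVec A z) x')) := by
          simp only [Finset.sum_mul, Finset.mul_sum]
          rw [Finset.sum_comm]
          conv_rhs => rw [Finset.sum_comm]
          refine Finset.sum_congr rfl fun y _ => ?_
          calc _ = ∑ x' : BitString (n + n), ∑ z : BitString n, ∑ x : BitString (n + n),
                chi z w * φ y * ((chi y x * chi (rowVec A z) x) *
                  (chi y x' * chi (rowVec A z) x')) :=
                Finset.sum_congr rfl fun x' _ => Finset.sum_comm
            _ = _ := by
              rw [Finset.sum_comm]
      _ = _ := by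
          refine Finset.sum_congr rfl fun z _ => ?_
          simp only [hrow, mul_ite, mul_zero, Finset.sum_ite_eq', Finset.mem_univ, if_true, hφ]
  have hlow : (2 ^ n : ℝ) / 2 ≤ ∑ z : BitString n, chi z w * ((1 + chi z w) / 2) := by
    have e : ∀ z : BitString n, chi z w * ((1 + chi z w) / 2) = chi z w / 2 + 1 / 2 := by
      intro z
      linear_combination chi_mul_self z w / 2
    simp only [e, Finset.sum_add_distrib, ← Finset.sum_div, sum_chi_left, Fintype.card_fin]
    simp only [Finset.sum_const, Finset.card_univ, Fintype.card_pi, Fintype.card_bool,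
      Finset.prod_const, Fintype.card_fin, nsmul_eq_mul, Nat.cast_pow, Nat.cast_ofNat]
    have h2 : (0 : ℝ) < 2 ^ n := by positivity
    split_ifs <;> linarith
  rw [← Finset.sum_mul] at key
  have h2 : (0 : ℝ) < 2 ^ n := by positivity
  have h4 : (0 : ℝ) < 2 ^ (n + n + (n + n)) := by positivity
  refine le_of_mul_le_mul_left ?_ h2
  rw [key]
  calc _ = (2 ^ n : ℝ) / 2 * 2 ^ (n + n + (n + n)) := by ring
    _ ≤ _ := mul_le_mul_of_nonneg_right hlow h4.le

lemma sum_chi_nonneg {N : ℕ} (φ : BitString N → ℝ) (hφ : ∀ y, 0 ≤ φ y) (p : BitString N) :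
    0 ≤ ∑ x' : BitString N, ∑ y : BitString N, ∑ x : BitString N,
      chi p x' * chi x' y * chi y x * φ y := by
  have e : ∀ x' y : BitString N, ∑ x : BitString N, chi p x' * chi x' y * chi y x * φ y
      = chi p x' * chi x' y * φ y * if y = (fun _ => false) then 2 ^ N else 0 := by
    intro x' y
    have := sum_chi_left y
    simp only [Fintype.card_fin, chi_comm _ y] at this
    rw [← this, Finset.mul_sum]
    exact Finset.sum_congr rfl fun x _ => by ring
  simp only [e]
  simp only [mul_ite, mul_zero, Finset.sum_ite_eq', Finset.mem_univ, if_true, chi_zero_right,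
    mul_one]
  rw [← Finset.sum_mul, ← Finset.sum_mul]
  refine mul_nonneg (mul_nonneg ?_ (hφ _)) (by positivity)
  simp only [chi_comm p, sum_chi_left]
  split_ifs <;> positivity

/-- The expected amplitude of the special message after the attack. The bound comes from the
pairs `(x, x')` with `L x + L x' = w`; what remains is nonnegative. -/
lemma le_expect_attackAmp :
    1 / 8 ≤ 𝔼 g, attackAmp (fun x => avgPhase A w p g (mkMsg false true x))
      (fun x => avgPhase A w p g (mkMsg true false x))
      (fun x => avgPhase A w p g (mkMsg true true x)) p := by
  set φ : BitString (n + n) → ℝ := fun y => avgPhase A w p (fun _ => false) (mkMsg true false y)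
    with hφ
  have hφg : ∀ g y, avgPhase A w p g (mkMsg true false y) = φ y := fun g y => rfl
  have hrow : ∀ z, φ (rowVec A z) = (1 + chi z w) / 2 := fun z => by
    simp only [hφ, avgPhase, sgn_headBit_rowVec]
  have hφ0 : ∀ y, 0 ≤ φ y := fun y => by
    have := neg_le_of_abs_le
      (abs_sgn (headBit A w p (fun _ => false) (mkMsg true false y))).le
    simp only [hφ, avgPhase]
    linarith
  have e : 𝔼 g, attackAmp (fun x => avgPhase A w p g (mkMsg false true x))
      (fun x => avgPhase A w p g (mkMsg true false x))
      (fun x => avgPhase A w p g (mkMsg true true x)) p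
      = (1 / 2) ^ (n + n + (n + n)) * ((∑ x' : BitString (n + n), ∑ y : BitString (n + n),
        ∑ x : BitString (n + n), chi p x' * chi x' y * chi y x * φ y) / 4 +
        (∑ x' : BitString (n + n), ∑ y : BitString (n + n), ∑ x : BitString (n + n),
        chi x' y * chi y x * φ y *
        (if (fun i => lin A x i ^^ lin A x' i) = w then 1 else 0)) / 4) := by
    simp only [attackAmp, hφg]
    rw [← Finset.mul_expect, Finset.expect_sum_comm]
    simp only [Finset.sum_div, ← Finset.sum_add_distrib]
    congr 1
    refine Finset.sum_congr rfl fun x' _ => ?_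
    rw [Finset.expect_sum_comm]
    refine Finset.sum_congr rfl fun y _ => ?_
    rw [Finset.expect_sum_comm]
    refine Finset.sum_congr rfl fun x _ => ?_
    rw [← Finset.mul_expect]
    simp only [mul_left_comm _ (φ y)]
    rw [← Finset.mul_expect, expect_avgPhase]
    have := chi_mul_self p x'
    split_ifs
    · linear_combination (chi x' y * chi y x * φ y / 4) * this
    · ring
  have h1 := sum_chi_nonneg φ hφ0 p
  have h2 := sum_chi_avgPhase A w φ hrow
  rw [e, one_div_pow, one_div_mul_eq_div, le_div_iff₀ (by positivity)]
  linarith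

end Amplitude

theorem shiftMAC_not_buSecure : ¬ BUSecure shiftMAC := by
  refine not_buSecure_of_le (halfAdversary shiftCircuit uniformFamily_shiftCircuit)
    (c := (1 / 16) ^ 2) (by norm_num) fun n _ => ?_
  have : Nonempty (shiftMAC.Key n) := inferInstanceAs (Nonempty (ShiftKey n))
  rw [blindForge_halfAdversary, expectKey_uniform rfl]
  let amp : ShiftKey n → Finset (BitString (n + n + 2)) → ℝ := fun k B =>
    attackAmp
      (fun x => blindSgn (headBit k.1.1 k.1.2 k.2.1 k.2.2.1 (mkMsg false true x))
        (decide (mkMsg false true x ∈ B)))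
      (fun x => blindSgn (headBit k.1.1 k.1.2 k.2.1 k.2.2.1 (mkMsg true false x))
        (decide (mkMsg true false x ∈ B)))
      (fun x => blindSgn (headBit k.1.1 k.1.2 k.2.1 k.2.2.1 (mkMsg true true x))
        (decide (mkMsg true true x ∈ B))) k.2.1
  let ind : ShiftKey n → Finset (BitString (n + n + 2)) → ℝ := fun k B =>
    if mkMsg false false k.2.1 ∈ B then 1 else 0
  have hforge : ∀ (k : ShiftKey n) B,
      (ind k B * amp k B) ^ 2 ≤ forgeProb shiftMAC (shiftCircuit n) (n := n) k B := by
    intro k B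
    by_cases hB : mkMsg false false k.2.1 ∈ B
    · obtain ⟨b, hX, hY, hrun⟩ := runCircuit_shiftCircuit (Nat.succ_pos (n + 1))
        (blind B (shiftTag k)) k.2.1
      have hsgn : ∀ c d x, (c || d) = true →
          sgn (blind B (shiftTag k) (mkMsg c d x) ⟨0, Nat.succ_pos (n + 1)⟩)
          = blindSgn (headBit k.1.1 k.1.2 k.2.1 k.2.2.1 (mkMsg c d x))
            (decide (mkMsg c d x ∈ B)) := by
        intro c d x hcd
        have hne : mkMsg c d x ≠ mkMsg false false k.2.1 := by
          rw [Ne, mkMsg_inj]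
          rintro ⟨rfl, rfl, _⟩
          simp at hcd
        have e0 : (⟨0, Nat.succ_pos (n + 1)⟩ : Fin (n + 1 + 1)) = Fin.castSucc 0 := rfl
        unfold blind
        split_ifs with hm
        · rw [e0, Fin.snoc_castSucc]; simp [blindSgn, hm]
        · rw [e0, Fin.snoc_castSucc, shiftTag, if_neg hne, Fin.cons_zero]; simp [blindSgn, hm]
      simp only [hsgn _ _ _ (Bool.or_true _), hsgn _ _ _ (Bool.true_or _)] at hrun
      refine le_trans (le_of_eq ?_) (le_forgeProb shiftMAC (shiftCircuit n) (n := n) k B b ?_ ?_)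
      · change _ = ‖runCircuit (blind B (shiftTag k)) (shiftCircuit n) b‖ ^ 2
        rw [hrun, Complex.norm_real, Real.norm_eq_abs, sq_abs]
        simp [ind, amp, hB]
      · change regX (n + n + 2) b ∈ B
        rw [hX]; exact hB
      · change shiftTag k (regX (n + n + 2) b) = regY (n + n + 2) (n + 1) b
        rw [hX, shiftTag, if_pos rfl]
        funext i
        exact (hY i.castSucc).symm
    · have : ind k B = 0 := if_neg hB
      rw [this, zero_mul, zero_pow two_ne_zero]
      exact forgeProb_nonneg _ _ _ _
  have hB : ∀ k : ShiftKey n, 𝔼 B, ind k B * amp k B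
      = 1 / 2 * attackAmp (fun x => avgPhase k.1.1 k.1.2 k.2.1 k.2.2.1 (mkMsg false true x))
      (fun x => avgPhase k.1.1 k.1.2 k.2.1 k.2.2.1 (mkMsg true false x))
      (fun x => avgPhase k.1.1 k.1.2 k.2.1 k.2.2.1 (mkMsg true true x)) k.2.1 := by
    intro k
    simp only [ind, amp, attackAmp, Finset.mul_sum]
    rw [Finset.expect_sum_comm]
    refine Finset.sum_congr rfl fun x' _ => ?_
    rw [Finset.expect_sum_comm]
    refine Finset.sum_congr rfl fun y _ => ?_
    rw [Finset.expect_sum_comm]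
    refine Finset.sum_congr rfl fun x _ => ?_
    have := expect_blindSgn x' y x k.2.1 (headBit k.1.1 k.1.2 k.2.1 k.2.2.1)
    simp only [avgPhase]
    rw [mul_left_comm, mul_left_comm (1 / 2 : ℝ), ← this, ← mul_assoc, Finset.mul_expect]
    exact Finset.expect_congr rfl fun B _ => by ring
  have hmean : (1 / 16 : ℝ) ≤ 𝔼 z : ShiftKey n × Finset (BitString (n + n + 2)),
      ind z.1 z.2 * amp z.1 z.2 := by
    rw [expect_prod]
    simp only [hB]
    rw [← Finset.mul_expect, expect_prod]
    have : (1 / 8 : ℝ) ≤ 𝔼 a : ShiftParam n, 𝔼 b : BitString (n + n) × (BitString n → Bool) ×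
        (BitString (n + n + 2) → BitString n),
        attackAmp (fun x => avgPhase a.1 a.2 b.1 b.2.1 (mkMsg false true x))
        (fun x => avgPhase a.1 a.2 b.1 b.2.1 (mkMsg true false x))
        (fun x => avgPhase a.1 a.2 b.1 b.2.1 (mkMsg true true x)) b.1 := by
      refine Finset.le_expect Finset.univ_nonempty fun a _ => ?_
      rw [expect_prod]
      refine Finset.le_expect Finset.univ_nonempty fun p _ => ?_
      rw [expect_prod]
      simp only [Fintype.expect_const]
      exact le_expect_attackAmp a.1 a.2 p
    linarith
  calc ((1 / 16 : ℝ)) ^ 2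
      ≤ (𝔼 z : ShiftKey n × Finset (BitString (n + n + 2)), ind z.1 z.2 * amp z.1 z.2) ^ 2 :=
        pow_le_pow_left₀ (by norm_num) hmean 2
    _ ≤ 𝔼 z : ShiftKey n × Finset (BitString (n + n + 2)), (ind z.1 z.2 * amp z.1 z.2) ^ 2 := by
        have := Finset.expect_mul_sq_le_sq_mul_sq Finset.univ
          (fun z : ShiftKey n × Finset (BitString (n + n + 2)) => ind z.1 z.2 * amp z.1 z.2)
          (fun _ => 1)
        simpa only [mul_one, one_pow, Fintype.expect_const] using this
    _ = 𝔼 k : ShiftKey n, 𝔼 B, (ind k B * amp k B) ^ 2 := expect_prod _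
    _ ≤ _ := Finset.expect_le_expect fun k _ => Finset.expect_le_expect fun B _ => hforge k B

/-! ### Fourier analysis of functions of a random function -/

section Shift

variable {X ι : Type*} [DecidableEq X]

/-- Exclusive or with `c` at the point `x`. -/
def shiftAt (x : X) (c : ι → Bool) : (X → ι → Bool) ≃ (X → ι → Bool) :=
  Function.Involutive.toPerm (fun α => Function.update α x (xorEquiv c (α x))) fun α => by
    funext y i
    by_cases h : y = x
    · subst h; simp
    · simp [h]

@[simp] lemma shiftAt_same (x : X) (c : ι → Bool) (α : X → ι → Bool) :
    shiftAt x c α x = xorEquiv c (α x) :=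
  Function.update_self _ _ _

lemma shiftAt_of_ne {x y : X} (h : y ≠ x) (c : ι → Bool) (α : X → ι → Bool) :
    shiftAt x c α y = α y :=
  Function.update_of_ne h _ _

end Shift

section FunctionFourier

variable {X ι : Type*} [Fintype X] [Fintype ι]

/-- The character `f ↦ (-1) ^ ∑ x, α x · f x` of the group of functions `f` with strings as values. -/
def chiFun (α f : X → ι → Bool) : ℝ := ∏ x, chi (α x) (f x)

lemma chiFun_bot (f : X → ι → Bool) : chiFun ⊥ f = 1 :=
  Finset.prod_eq_one fun _ _ => chi_zero_left _

/-- The support of a character. -/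
def supp (α : X → ι → Bool) : Finset X := {x | α x ≠ ⊥}

@[simp] lemma mem_supp {α : X → ι → Bool} {x : X} : x ∈ supp α ↔ α x ≠ ⊥ := by simp [supp]

lemma supp_bot : supp (⊥ : X → ι → Bool) = ∅ := by
  ext; simp

lemma card_supp_update [DecidableEq X] (α : X → ι → Bool) {x : X} (h : α x ≠ ⊥) :
    (supp (Function.update α x ⊥)).card + 1 = (supp α).card := by
  have : supp (Function.update α x ⊥) = (supp α).erase x := by
    ext y
    by_cases hy : y = x
    · subst hy; simp
    · simp [hy]
  rw [this, Finset.card_erase_add_one (by simpa using h)]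

variable [DecidableEq X]

lemma chiFun_shiftAt (x : X) (c : ι → Bool) (α f : X → ι → Bool) :
    chiFun (shiftAt x c α) f = chiFun α f * chi c (f x) := by
  rw [chiFun, chiFun, ← Finset.mul_prod_erase _ _ (Finset.mem_univ x),
    ← Finset.mul_prod_erase _ (fun x => chi (α x) (f x)) (Finset.mem_univ x), shiftAt_same]
  have : chi (xorEquiv c (α x)) (f x) = chi (α x) (f x) * chi c (f x) := chi_xor _ _ _
  rw [this, Finset.prod_congr rfl (g := fun y => chi (α y) (f y))
    fun y hy => by rw [shiftAt_of_ne (Finset.ne_of_mem_erase hy)]]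
  ring

lemma chiFun_shiftAt_right (x : X) (c : ι → Bool) (α f : X → ι → Bool) :
    chiFun α (shiftAt x c f) = chiFun α f * chi (α x) c := by
  have h : ∀ α f : X → ι → Bool, chiFun α f = chiFun f α := fun α f =>
    Finset.prod_congr rfl fun x _ => chi_comm _ _
  rw [h, chiFun_shiftAt, h, chi_comm]

lemma card_supp_le (α : X → ι → Bool) (x : X) (c : ι → Bool) :
    (supp α).card ≤ (supp (shiftAt x c α)).card + 1 := by
  have : supp α ⊆ insert x (supp (shiftAt x c α)) := fun y hy => by
    by_cases h : y = x
    · simp [h]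
    · simpa [h, shiftAt_of_ne h] using hy
  exact (Finset.card_le_card this).trans (Finset.card_insert_le _ _)

variable [DecidableEq ι]

lemma expect_chiFun_mul_chiFun (α β : X → ι → Bool) :
    𝔼 f, chiFun α f * chiFun β f = if α = β then 1 else 0 := by
  have h1 : ∀ f : X → ι → Bool, chiFun α f * chiFun β f = ∏ x, chi (f x) (α x) * chi (f x) (β x) :=
    fun f => by simp only [chiFun, ← Finset.prod_mul_distrib, chi_comm _ (f _)]
  have h2 : ∑ f : X → ι → Bool, ∏ x, chi (f x) (α x) * chi (f x) (β x)
      = ∏ x, ∑ r, chi r (α x) * chi r (β x) := by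
    rw [Finset.prod_univ_sum, Fintype.piFinset_univ]
  simp only [h1, Fintype.expect_eq_sum_div_card, h2, sum_chi_mul_chi]
  split_ifs with h
  · subst h
    have : (2 : ℝ) ^ Fintype.card ι ≠ 0 := by positivity
    simp [this]
  · obtain ⟨x, hx⟩ := Function.ne_iff.1 h
    rw [Finset.prod_eq_zero (Finset.mem_univ x) (if_neg hx), zero_div]

/-- Parseval's identity. -/
lemma expect_norm_sum_sq (c : (X → ι → Bool) → ℂ) :
    𝔼 f : X → ι → Bool, ‖∑ α, (chiFun α f : ℂ) * c α‖ ^ 2 = ∑ α, ‖c α‖ ^ 2 := by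
  have e : ∀ f : X → ι → Bool, ‖∑ α, (chiFun α f : ℂ) * c α‖ ^ 2
      = ∑ α, ∑ β, (chiFun α f * chiFun β f) * (c α * starRingEnd ℂ (c β)).re := by
    intro f
    rw [← Complex.normSq_eq_norm_sq, ← Complex.ofReal_re (Complex.normSq _), ← Complex.mul_conj,
      map_sum, Finset.sum_mul_sum, Complex.re_sum]
    refine Finset.sum_congr rfl fun α _ => ?_
    rw [Complex.re_sum]
    refine Finset.sum_congr rfl fun β _ => ?_
    rw [map_mul, Complex.conj_ofReal, mul_mul_mul_comm, ← Complex.ofReal_mul, Complex.re_ofReal_mul]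
  simp only [e]
  rw [Finset.expect_sum_comm]
  refine Finset.sum_congr rfl fun α _ => ?_
  rw [Finset.expect_sum_comm]
  simp only [← Finset.expect_mul, expect_chiFun_mul_chiFun, ite_mul, one_mul, zero_mul,
    Finset.sum_ite_eq, Finset.mem_univ, if_true]
  rw [Complex.mul_conj, Complex.ofReal_re, Complex.normSq_eq_norm_sq]

/-- If the string `φ z` can be shifted arbitrarily without changing `ψ z`, then it is uniformly
distributed and independent of `ψ z`. -/
lemma expect_ite_eq_mul_of_shift {Z : Type*} [Fintype Z] (φ : Z → ι → Bool)
    (ψ : Z → ℝ) (e : (ι → Bool) → Z ≃ Z) (hφ : ∀ r z, φ (e r z) = xorEquiv r (φ z))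
    (hψ : ∀ r z, ψ (e r z) = ψ z) (c : ι → Bool) :
    𝔼 z, (if φ z = c then 1 else 0) * ψ z = (𝔼 z, ψ z) / 2 ^ Fintype.card ι := by
  have h1 : ∀ r, 𝔼 z, (if φ z = xorEquiv r c then 1 else 0) * ψ z
      = 𝔼 z, (if φ z = c then 1 else 0) * ψ z := by
    intro r
    refine Fintype.expect_equiv (e r) _ _ fun z => ?_
    rw [hφ, hψ]
    have : xorEquiv r (φ z) = c ↔ φ z = xorEquiv r c := by
      constructor <;> rintro h <;> funext i <;> have := congrFun h i <;> simp at this ⊢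
      · rw [← this]; simp
      · rw [this]; simp
    simp only [this]
  have h2 : ∑ r : ι → Bool, 𝔼 z, (if φ z = xorEquiv r c then (1 : ℝ) else 0) * ψ z = 𝔼 z, ψ z := by
    rw [← Finset.expect_sum_comm]
    refine Finset.expect_congr rfl fun z _ => ?_
    rw [← Finset.sum_mul]
    have : ∀ r : ι → Bool, φ z = xorEquiv r c ↔ r = xorEquiv c (φ z) := by
      intro r
      constructor <;> rintro h <;> funext i <;> have := congrFun h i <;> simp at this ⊢
      · rw [this, Bool.xor_right_comm]; simp
      · rw [this, Bool.xor_left_comm]; simp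
    simp [this]
  rw [← h2]
  simp only [h1, Finset.sum_const, Finset.card_univ, nsmul_eq_mul]
  have : (2 : ℝ) ^ Fintype.card ι ≠ 0 := by positivity
  rw [Fintype.card_fun, Fintype.card_bool]
  push_cast
  field_simp

/-- A superposition of characters each of which ignores some point of `s` says nothing about
the values at all points of `s`. -/
lemma expect_ite_mul_norm_sum_sq_le (s : Finset X) (t : X → ι → Bool) (c : (X → ι → Bool) → ℂ)
    (hc : ∀ α, c α ≠ 0 → ∃ x ∈ s, α x = ⊥) :
    𝔼 f : X → ι → Bool, (if ∀ x ∈ s, f x = t x then 1 else 0) *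
        ‖∑ α, (chiFun α f : ℂ) * c α‖ ^ 2
      ≤ s.card / 2 ^ Fintype.card ι * ∑ α, ‖c α‖ ^ 2 := by
  rcases isEmpty_or_nonempty X with hX | hX
  · have : ∀ α, c α = 0 := fun α => by
      by_contra h
      exact hX.elim (hc α h).choose
    simp [this]
  choose! κ hκs hκ using hc
  let d : X → (X → ι → Bool) → ℂ := fun x α => if κ α = x then c α else 0
  let D : X → (X → ι → Bool) → ℂ := fun x f => ∑ α, (chiFun α f : ℂ) * d x α
  have hsum : ∀ f : X → ι → Bool, ∑ α, (chiFun α f : ℂ) * c α = ∑ x ∈ s, D x f := by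
    intro f
    rw [Finset.sum_comm]
    refine Finset.sum_congr rfl fun α _ => ?_
    rw [← Finset.mul_sum]
    congr 1
    by_cases h : c α = 0
    · simp [d, h]
    · simp [d, hκs α h]
  have hD : ∀ x f r, D x (shiftAt x r f) = D x f := by
    intro x f r
    refine Finset.sum_congr rfl fun α _ => ?_
    by_cases h : κ α = x ∧ c α ≠ 0
    · have : α x = ⊥ := h.1 ▸ hκ α h.2
      rw [chiFun_shiftAt_right, this]
      congr 2
      rw [show chi ⊥ r = 1 from chi_zero_left r, mul_one]
    · have : d x α = 0 := by
        simp only [d]; split_ifs with h'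
        · by_contra h2; exact h ⟨h', h2⟩
        · rfl
      rw [this, mul_zero, mul_zero]
  calc _ ≤ 𝔼 f : X → ι → Bool, (s.card : ℝ) * ∑ x ∈ s, (if f x = t x then 1 else 0) *
        ‖D x f‖ ^ 2 := by
        refine Finset.expect_le_expect fun f _ => ?_
        split_ifs with h
        · rw [one_mul, hsum f]
          calc ‖∑ x ∈ s, D x f‖ ^ 2 ≤ (∑ x ∈ s, ‖D x f‖) ^ 2 :=
                pow_le_pow_left₀ (norm_nonneg _) (norm_sum_le _ _) 2
            _ ≤ s.card * ∑ x ∈ s, ‖D x f‖ ^ 2 := sq_sum_le_card_mul_sum_sq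
            _ = _ := by
              congr 1
              exact Finset.sum_congr rfl fun x hx => by rw [if_pos (h x hx), one_mul]
        · rw [zero_mul]
          exact mul_nonneg (Nat.cast_nonneg _) (Finset.sum_nonneg fun x _ => by positivity)
    _ = (s.card : ℝ) * ∑ x ∈ s, (∑ α, ‖d x α‖ ^ 2) / 2 ^ Fintype.card ι := by
        rw [← Finset.mul_expect, Finset.expect_sum_comm]
        congr 1
        refine Finset.sum_congr rfl fun x _ => ?_
        rw [expect_ite_eq_mul_of_shift (fun f : X → ι → Bool => f x) _ (shiftAt x)
          (fun r f => shiftAt_same x r f) (fun r f => by rw [hD]), expect_norm_sum_sq]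
    _ ≤ _ := by
        rw [← Finset.sum_div, div_mul_eq_mul_div, mul_div_assoc, Finset.sum_comm]
        gcongr with α
        calc ∑ x ∈ s, ‖d x α‖ ^ 2 = ∑ x ∈ s, if κ α = x then ‖c α‖ ^ 2 else 0 :=
              Finset.sum_congr rfl fun x _ => by simp only [d]; split_ifs <;> simp
          _ ≤ _ := by
            rw [Finset.sum_ite_eq]; split_ifs
            · exact le_rfl
            · positivity

end FunctionFourier

/-! ### Algorithms with phase queries -/

/-- A quantum algorithm with state space `ℂ ^ B`. On the basis state `b` a query applies a phase that
depends on the values of the oracle at the point `pt b`: the pair `(hd b, ch b)` is the character that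
is applied to this value. -/
structure PhaseAlgorithm (B X ι : Type*) [Fintype B] where
  pt : B → X
  hd : B → Bool
  ch : B → ι → Bool
  V : ℕ → (B → ℂ) →ₗ[ℂ] (B → ℂ)
  isometry : ∀ j ψ, ∑ b, ‖V j ψ b‖ ^ 2 = ∑ b, ‖ψ b‖ ^ 2
  init : B → ℂ
  norm_init : ∑ b, ‖init b‖ ^ 2 = 1

namespace PhaseAlgorithm

variable {B X ι : Type*} [Fintype B] [Fintype X] [DecidableEq X] [Fintype ι]
  (P : PhaseAlgorithm B X ι) (τ : X → Bool)

/-- The state after `j` queries to the oracle `x ↦ (τ x, f x)`, where the characters of `f` are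
given by `lab` instead of `ch`. -/
def state (lab : B → ι → Bool) (f : X → ι → Bool) : ℕ → B → ℂ
  | 0 => P.init
  | j + 1 => P.V j fun b =>
      (sgn (P.hd b && τ (P.pt b)) : ℂ) * ((chi (lab b) (f (P.pt b)) : ℂ) * state lab f j b)

/-- The Fourier coefficients of the state as a function of `f`. -/
def coeff (lab : B → ι → Bool) : ℕ → (X → ι → Bool) → B → ℂ
  | 0, α => if α = ⊥ then P.init else 0
  | j + 1, α => P.V j fun b =>
      (sgn (P.hd b && τ (P.pt b)) : ℂ) * coeff lab j (shiftAt (P.pt b) (lab b) α) b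

/-- The part of the Fourier coefficients that comes from computations in which every query adds a new
point to the support of the character. -/
def topCoeff : ℕ → (X → ι → Bool) → B → ℂ
  | 0, α => if α = ⊥ then P.init else 0
  | j + 1, α => P.V j fun b =>
      if P.ch b ≠ ⊥ ∧ α (P.pt b) = P.ch b then
        (sgn (P.hd b && τ (P.pt b)) : ℂ) * topCoeff j (Function.update α (P.pt b) ⊥) b
      else 0

lemma norm_sgn_mul (c : Bool) (z : ℂ) : ‖(sgn c : ℂ) * z‖ = ‖z‖ := by
  rw [norm_mul, Complex.norm_real, Real.norm_eq_abs, abs_sgn, one_mul]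

lemma coeff_eq_zero (lab : B → ι → Bool) {j : ℕ} {α : X → ι → Bool} (h : j < (supp α).card) :
    P.coeff τ lab j α = 0 := by
  induction j generalizing α with
  | zero =>
    have : α ≠ ⊥ := by rintro rfl; simp [supp_bot] at h
    simp [coeff, this]
  | succ j ih =>
    rw [coeff, ← map_zero (P.V j)]
    congr 1
    funext b
    have := card_supp_le α (P.pt b) (lab b)
    rw [ih (by omega)]
    simp

lemma topCoeff_eq_zero {j : ℕ} {α : X → ι → Bool} (h : j < (supp α).card) :
    P.topCoeff τ j α = 0 := by
  induction j generalizing α with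
  | zero =>
    have : α ≠ ⊥ := by rintro rfl; simp [supp_bot] at h
    simp [topCoeff, this]
  | succ j ih =>
    rw [topCoeff, ← map_zero (P.V j)]
    congr 1
    funext b
    split_ifs with hb
    · have := card_supp_update α (x := P.pt b) (hb.2 ▸ hb.1)
      rw [ih (by omega)]
      simp
    · rfl

/-- The coefficients of top weight do not depend on how the value at `p` is queried, since a character
of top weight is queried only once at each point. -/
lemma coeff_eq_topCoeff (lab : B → ι → Bool) (p : X)
    (hlab : ∀ b, lab b = if P.pt b = p then ⊥ else P.ch b) {j : ℕ} {α : X → ι → Bool}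
    (h : (supp α).card = j) :
    P.coeff τ lab j α = if α p = ⊥ then P.topCoeff τ j α else 0 := by
  induction j generalizing α with
  | zero =>
    have : α = ⊥ := by
      rw [Finset.card_eq_zero] at h
      funext x
      by_contra hx
      have : x ∈ supp α := by simpa using hx
      simp [h] at this
    subst this
    simp [coeff, topCoeff]
  | succ j ih =>
    have key : ∀ b, P.coeff τ lab j (shiftAt (P.pt b) (lab b) α)
        = if α p = ⊥ then (if P.ch b ≠ ⊥ ∧ α (P.pt b) = P.ch b then
          P.topCoeff τ j (Function.update α (P.pt b) ⊥) else 0) else 0 := by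
      intro b
      by_cases hb : lab b ≠ ⊥ ∧ α (P.pt b) = lab b
      · have hp : P.pt b ≠ p := fun hp => hb.1 (by rw [hlab, if_pos hp])
        have hl : lab b = P.ch b := by rw [hlab, if_neg hp]
        have hs : shiftAt (P.pt b) (lab b) α = Function.update α (P.pt b) ⊥ := by
          funext y
          by_cases hy : y = P.pt b
          · subst hy; funext i; simp [hb.2]
          · simp [shiftAt_of_ne hy, hy]
        have := card_supp_update α (x := P.pt b) (hb.2 ▸ hb.1)
        rw [hs, ih (by omega), Function.update_of_ne hp.symm]
        rw [hl] at hb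
        rw [if_pos hb]
      · have hcard : j < (supp (shiftAt (P.pt b) (lab b) α)).card := by
          have : supp α ⊆ supp (shiftAt (P.pt b) (lab b) α) := by
            intro y hy
            by_cases h' : y = P.pt b
            · subst h'
              rw [mem_supp] at hy ⊢
              rw [shiftAt_same]
              intro h0
              have : α (P.pt b) = lab b := (xor_eq_zero_iff _ _).1 h0
              exact hb ⟨this ▸ hy, this⟩
            · simpa [shiftAt_of_ne h'] using hy
          have := Finset.card_le_card this
          omega
        rw [P.coeff_eq_zero τ lab hcard]
        split_ifs with h1 h2
        · exfalso
          by_cases hp : P.pt b = p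
          · rw [hp, h1] at h2
            exact h2.1 h2.2.symm
          · rw [hlab, if_neg hp] at hb
            exact hb h2
        · rfl
        · rfl
    rw [coeff]
    simp only [key]
    split_ifs with h1
    · rw [topCoeff]
      congr 1
      funext b
      split_ifs <;> simp
    · rw [← map_zero (P.V j)]
      congr 1
      funext b
      simp

/-- The coefficients of top weight depend on `τ` only through its values on the support. -/
lemma topCoeff_congr {τ τ' : X → Bool} (j : ℕ) {α : X → ι → Bool}
    (h : ∀ x ∈ supp α, τ x = τ' x) : P.topCoeff τ j α = P.topCoeff τ' j α := by
  induction j generalizing α with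
  | zero => rfl
  | succ j ih =>
    rw [topCoeff, topCoeff]
    congr 1
    funext b
    split_ifs with hb
    · rw [h _ (by simpa using (hb.2 ▸ hb.1)), ih fun x hx => h x ?_]
      by_cases hxb : x = P.pt b
      · simp [hxb] at hx
      · simpa [hxb] using hx
    · rfl

variable [DecidableEq ι]

lemma state_eq_sum (lab : B → ι → Bool) (f : X → ι → Bool) (j : ℕ) (b : B) :
    P.state τ lab f j b = ∑ α, (chiFun α f : ℂ) * P.coeff τ lab j α b := by
  induction j generalizing b with
  | zero =>
    rw [Finset.sum_eq_single ⊥]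
    · simp [state, coeff, chiFun_bot]
    · intro α _ h; simp [coeff, h]
    · simp
  | succ j ih =>
    have e : (fun b => (sgn (P.hd b && τ (P.pt b)) : ℂ) *
        ((chi (lab b) (f (P.pt b)) : ℂ) * P.state τ lab f j b))
        = ∑ α, (chiFun α f : ℂ) • fun b => (sgn (P.hd b && τ (P.pt b)) : ℂ) *
          P.coeff τ lab j (shiftAt (P.pt b) (lab b) α) b := by
      funext b
      rw [ih, Finset.sum_apply, Finset.mul_sum, Finset.mul_sum,
        ← Equiv.sum_comp (shiftAt (P.pt b) (lab b))]
      refine Finset.sum_congr rfl fun α _ => ?_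
      simp only [Pi.smul_apply, smul_eq_mul, chiFun_shiftAt]
      have : (chi (lab b) (f (P.pt b)) : ℂ) * chi (lab b) (f (P.pt b)) = 1 := by
        rw [← Complex.ofReal_mul, chi_mul_self, Complex.ofReal_one]
      push_cast
      linear_combination ((sgn (P.hd b && τ (P.pt b)) : ℂ) * chiFun α f *
        P.coeff τ lab j (shiftAt (P.pt b) (lab b) α) b) * this
    simp only [state, e, map_sum, map_smul, Finset.sum_apply, Pi.smul_apply, smul_eq_mul, coeff]

lemma sum_norm_coeff (lab : B → ι → Bool) (j : ℕ) :
    ∑ α, ∑ b, ‖P.coeff τ lab j α b‖ ^ 2 = 1 := by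
  induction j with
  | zero =>
    rw [Finset.sum_eq_single ⊥]
    · simp [coeff, P.norm_init]
    · intro α _ h; simp [coeff, h]
    · simp
  | succ j ih =>
    simp only [coeff, P.isometry, norm_sgn_mul]
    rw [Finset.sum_comm, ← ih]
    conv_rhs => rw [Finset.sum_comm]
    refine Finset.sum_congr rfl fun b _ => ?_
    exact Equiv.sum_comp (shiftAt (P.pt b) (lab b)) fun α => ‖P.coeff τ lab j α b‖ ^ 2

/-- A query moves the weight of a character to the character with the queried point added. For a given
character, the contributions of different basis states are orthogonal. -/
lemma sum_topCoeff_succ_le (W : (X → ι → Bool) → ℝ) (hW : ∀ α, 0 ≤ W α) (j : ℕ) :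
    ∑ α, ∑ b, W α * ‖P.topCoeff τ (j + 1) α b‖ ^ 2
      ≤ ∑ α, ∑ b, W (Function.update α (P.pt b) (P.ch b)) * ‖P.topCoeff τ j α b‖ ^ 2 := by
  have e : ∀ α, ∑ b, W α * ‖P.topCoeff τ (j + 1) α b‖ ^ 2
      = ∑ b, if P.ch b ≠ ⊥ ∧ α (P.pt b) = P.ch b then
        W α * ‖P.topCoeff τ j (Function.update α (P.pt b) ⊥) b‖ ^ 2 else 0 := by
    intro α
    rw [← Finset.mul_sum, topCoeff, P.isometry, Finset.mul_sum]
    refine Finset.sum_congr rfl fun b _ => ?_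
    split_ifs
    · rw [norm_sgn_mul]
    · simp
  simp only [e]
  rw [Finset.sum_comm]
  conv_rhs => rw [Finset.sum_comm]
  refine Finset.sum_le_sum fun b _ => ?_
  rw [← Equiv.sum_comp (shiftAt (P.pt b) (P.ch b))]
  refine Finset.sum_le_sum fun α _ => ?_
  split_ifs with h
  · have h0 : α (P.pt b) = ⊥ := by
      have := h.2
      rw [shiftAt_same] at this
      funext i
      have := congrFun this i
      revert this
      change (α (P.pt b) i ^^ P.ch b i) = P.ch b i → α (P.pt b) i = false
      cases α (P.pt b) i <;> cases P.ch b i <;> simp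
    have h1 : shiftAt (P.pt b) (P.ch b) α = Function.update α (P.pt b) (P.ch b) := by
      change Function.update α (P.pt b) (xorEquiv (P.ch b) (α (P.pt b))) = _
      rw [← shiftAt_same, h.2]
    rw [h1, Function.update_idem, ← h0, Function.update_eq_self]
  · exact mul_nonneg (hW _) (by positivity)

lemma sum_norm_topCoeff_le (j : ℕ) : ∑ α, ∑ b, ‖P.topCoeff τ j α b‖ ^ 2 ≤ 1 := by
  induction j with
  | zero =>
    rw [Finset.sum_eq_single ⊥]
    · simp [topCoeff, P.norm_init]
    · intro α _ h; simp [topCoeff, h]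
    · simp
  | succ j ih =>
    have := P.sum_topCoeff_succ_le τ (fun _ => 1) (fun _ => zero_le_one) j
    simp only [one_mul] at this
    exact this.trans ih

end PhaseAlgorithm

/-! ### Forging more values than queries -/

namespace PhaseAlgorithm

variable {B X ι : Type*} [Fintype B] [Fintype X] [DecidableEq X] [Fintype ι] [DecidableEq ι]
  (P : PhaseAlgorithm B X ι) (τ : X → Bool)

/-- An algorithm that outputs the values of the random function at `q + 1` points, with the value at
`p` given for free, either guesses or has a character of top weight whose support avoids `p`. -/
lemma expect_success_le_aux (p : X) (lab : B → ι → Bool)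
    (hlab : ∀ b, lab b = if P.pt b = p then ⊥ else P.ch b) {q : ℕ} (b : B)
    (msg : Fin (q + 1) → X) (val : Fin (q + 1) → ι → Bool) (succ : (X → ι → Bool) → Prop)
    [DecidablePred succ]
    (hsucc : ∀ f, succ f → Function.Injective msg ∧ ∀ i, msg i ≠ p → f (msg i) = val i) :
    𝔼 f, (if succ f then ‖P.state τ lab f q b‖ ^ 2 else 0)
      ≤ 2 * ((q + 1) / 2 ^ Fintype.card ι) * ∑ α, ‖P.coeff τ lab q α b‖ ^ 2 +
        2 * ∑ α, if ∃ i, msg i = p then ‖P.topCoeff τ q α b‖ ^ 2 else 0 := by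
  have hnn : 0 ≤ 2 * ∑ α, if ∃ i, msg i = p then ‖P.topCoeff τ q α b‖ ^ 2 else 0 :=
    mul_nonneg zero_le_two (Finset.sum_nonneg fun α _ => by split_ifs <;> positivity)
  by_cases hinj : Function.Injective msg
  swap
  · rw [Finset.expect_eq_zero fun f _ => if_neg fun h => hinj (hsucc f h).1]
    positivity
  set S : Finset X := (Finset.univ.image msg).erase p with hS
  set t : X → ι → Bool := Function.extend msg val ⊥ with ht
  have hSt : ∀ f, succ f → ∀ x ∈ S, f x = t x := by
    intro f hf x hx
    rw [hS, Finset.mem_erase, Finset.mem_image] at hx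
    obtain ⟨hxp, i, -, rfl⟩ := hx
    rw [(hsucc f hf).2 i hxp, ht, hinj.extend_apply]
  have himg : (Finset.univ.image msg).card = q + 1 := by
    rw [Finset.card_image_of_injective _ hinj, Finset.card_univ, Fintype.card_fin]
  have hScard : S.card ≤ q + 1 := himg ▸ Finset.card_erase_le
  let c₁ : (X → ι → Bool) → ℂ := fun α => if S ⊆ supp α then P.coeff τ lab q α b else 0
  let c₂ : (X → ι → Bool) → ℂ := fun α => if S ⊆ supp α then 0 else P.coeff τ lab q α b
  have hc : ∀ f : X → ι → Bool, P.state τ lab f q b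
      = ∑ α, (chiFun α f : ℂ) * c₁ α + ∑ α, (chiFun α f : ℂ) * c₂ α := by
    intro f
    rw [P.state_eq_sum, ← Finset.sum_add_distrib]
    refine Finset.sum_congr rfl fun α _ => ?_
    simp only [c₁, c₂]
    split_ifs <;> ring
  have h₁ : ∑ α, ‖c₁ α‖ ^ 2 ≤ ∑ α, if ∃ i, msg i = p then ‖P.topCoeff τ q α b‖ ^ 2 else 0 := by
    refine Finset.sum_le_sum fun α _ => ?_
    by_cases hα : S ⊆ supp α ∧ P.coeff τ lab q α ≠ 0
    · have h1 := Finset.card_le_card hα.1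
      have h2 : (supp α).card ≤ q := by
        by_contra h
        exact hα.2 (P.coeff_eq_zero τ lab (by omega))
      have hp : p ∈ Finset.univ.image msg := by
        by_contra hp
        rw [hS, Finset.erase_eq_of_notMem hp] at h1
        omega
      have h3 : S.card + 1 = q + 1 := himg ▸ Finset.card_erase_add_one hp
      rw [if_pos (by simpa using hp)]
      simp only [c₁, if_pos hα.1]
      rw [P.coeff_eq_topCoeff τ lab p hlab (by omega)]
      split_ifs
      · exact le_rfl
      · simp
    · have : c₁ α = 0 := by
        simp only [c₁]
        split_ifs with h
        · have : P.coeff τ lab q α = 0 := by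
            by_contra h'; exact hα ⟨h, h'⟩
          rw [this]; rfl
        · rfl
      rw [this]
      split_ifs <;> simp
  have h₂ : ∑ α, ‖c₂ α‖ ^ 2 ≤ ∑ α, ‖P.coeff τ lab q α b‖ ^ 2 := by
    refine Finset.sum_le_sum fun α _ => ?_
    simp only [c₂]
    split_ifs <;> simp
  have hguess := expect_ite_mul_norm_sum_sq_le S t c₂ fun α hα => by
    simp only [c₂, ne_eq, ite_eq_left_iff, not_forall] at hα
    obtain ⟨h, -⟩ := hα
    obtain ⟨x, hx, hxα⟩ := Finset.not_subset.1 h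
    exact ⟨x, hx, by simpa using hxα⟩
  have h2N : (0 : ℝ) < 2 ^ Fintype.card ι := by positivity
  calc 𝔼 f, (if succ f then ‖P.state τ lab f q b‖ ^ 2 else 0)
      ≤ 𝔼 f : X → ι → Bool, (2 * ((if ∀ x ∈ S, f x = t x then 1 else 0) *
          ‖∑ α, (chiFun α f : ℂ) * c₂ α‖ ^ 2) + 2 * ‖∑ α, (chiFun α f : ℂ) * c₁ α‖ ^ 2) := by
        refine Finset.expect_le_expect fun f _ => ?_
        split_ifs with h h'
        · rw [hc]
          have := pow_le_pow_left₀ (norm_nonneg _)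
            (norm_add_le (∑ α, (chiFun α f : ℂ) * c₁ α) (∑ α, (chiFun α f : ℂ) * c₂ α)) 2
          refine this.trans (add_sq_le.trans (le_of_eq ?_))
          ring
        · exact absurd (hSt f h) h'
        · positivity
        · positivity
    _ = 2 * 𝔼 f : X → ι → Bool, ((if ∀ x ∈ S, f x = t x then 1 else 0) *
          ‖∑ α, (chiFun α f : ℂ) * c₂ α‖ ^ 2) + 2 * ∑ α, ‖c₁ α‖ ^ 2 := by
        rw [Finset.expect_add_distrib, ← Finset.mul_expect, ← Finset.mul_expect,
          expect_norm_sum_sq]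
    _ ≤ _ := by
        refine add_le_add ?_ (by linarith)
        rw [mul_assoc]
        refine mul_le_mul_of_nonneg_left (hguess.trans ?_) zero_le_two
        have : (S.card : ℝ) ≤ q + 1 := by exact_mod_cast hScard
        gcongr

lemma expect_success_le (p : X) (lab : B → ι → Bool)
    (hlab : ∀ b, lab b = if P.pt b = p then ⊥ else P.ch b) {q : ℕ}
    (msg : B → Fin (q + 1) → X) (val : B → Fin (q + 1) → ι → Bool)
    (succ : B → (X → ι → Bool) → Prop) [∀ b, DecidablePred (succ b)]
    (hsucc : ∀ b f, succ b f →
      Function.Injective (msg b) ∧ ∀ i, msg b i ≠ p → f (msg b i) = val b i) :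
    𝔼 f, ∑ b, (if succ b f then ‖P.state τ lab f q b‖ ^ 2 else 0)
      ≤ 2 * ((q + 1) / 2 ^ Fintype.card ι) +
        2 * ∑ α, ∑ b, if ∃ i, msg b i = p then ‖P.topCoeff τ q α b‖ ^ 2 else 0 := by
  rw [Finset.expect_sum_comm]
  refine (Finset.sum_le_sum fun b _ =>
    P.expect_success_le_aux τ p lab hlab b (msg b) (val b) (succ b) (hsucc b)).trans (le_of_eq ?_)
  rw [Finset.sum_add_distrib, ← Finset.mul_sum, ← Finset.mul_sum, Finset.sum_comm,
    P.sum_norm_coeff, mul_one, Finset.sum_comm]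

end PhaseAlgorithm

/-! ### The first bits of the tags of the hidden shift MAC -/

section HeadBit

variable {n : ℕ}

lemma sgn_injective : Function.Injective sgn := by
  intro a b h
  revert h
  cases a <;> cases b <;> norm_num [sgn]

lemma chi_and_single {ι : Type*} [Fintype ι] [DecidableEq ι] (c : Bool) (j : ι) (x : ι → Bool) :
    chi (fun k => c && decide (k = j)) x = sgn (c && x j) := by
  rw [chi, Finset.prod_eq_single j]
  · simp
  · intro k _ hk; simp [hk]
  · simp

lemma dot_xor_single {ι : Type*} [Fintype ι] [DecidableEq ι] (a x : ι → Bool) (c : Bool) (j : ι) :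
    dot (fun k => a k ^^ (c && decide (k = j))) x = (dot a x ^^ (c && x j)) := by
  apply sgn_injective
  rw [sgn_dot, chi_xor a (fun k => c && decide (k = j)), chi_and_single, sgn_xor, sgn_dot]

lemma dot_comm {ι : Type*} [Fintype ι] (a b : ι → Bool) : dot a b = dot b a := by
  simp [dot, Bool.and_comm]

/-- The argument at which the random function `g` is evaluated in the first bit of the tag of a
message whose second bit is `1`. -/
def label (ω : ShiftParam n) (m : BitString (n + n + 2)) : BitString n :=
  fun i => lin ω.1 (body m) i ^^ (m 0 && ω.2 i)

/-- The message is `10‖(z, Aᵀ z)` with `z ≠ 0`. -/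
def IsRow (A : Fin n → BitString n) (m : BitString (n + n + 2)) : Prop :=
  m 0 = true ∧ m 1 = false ∧ leftHalf (body m) ≠ ⊥ ∧
    rightHalf (body m) = vecMat A (leftHalf (body m))

/-- The first bits of the tags of the messages in `s` may reveal something about `(A, w)`: two of them
are values of `g` at the same label, or one of them is a bit `z · w` with `z ≠ 0`. -/
def Exposed (ω : ShiftParam n) (s : Finset (BitString (n + n + 2))) : Prop :=
  (∃ m ∈ s, ∃ m' ∈ s, m ≠ m' ∧ m 1 = true ∧ m' 1 = true ∧ label ω m = label ω m') ∨
    ∃ m ∈ s, IsRow ω.1 m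

lemma Exposed.mono {ω : ShiftParam n} {s t : Finset (BitString (n + n + 2))} (h : Exposed ω s)
    (hst : s ⊆ t) : Exposed ω t := by
  rcases h with ⟨m, hm, m', hm', h⟩ | ⟨m, hm, h⟩
  · exact Or.inl ⟨m, hst hm, m', hst hm', h⟩
  · exact Or.inr ⟨m, hst hm, h⟩

lemma not_exposed_empty (ω : ShiftParam n) : ¬ Exposed ω ∅ := by
  simp [Exposed]

lemma headBit_of_one (ω : ShiftParam n) (p : BitString (n + n)) (g : BitString n → Bool)
    {m : BitString (n + n + 2)} (h : m 1 = true) :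
    headBit ω.1 ω.2 p g m = (g (label ω m) ^^ (m 0 && dot p (body m))) := by
  have : m = mkMsg (m 0) true (body m) := by rw [← h, mkMsg_body]
  have hl : ∀ a x, label ω (mkMsg a true x) = fun i => lin ω.1 x i ^^ (a && ω.2 i) :=
    fun _ _ => rfl
  rw [this, hl]
  cases m 0 <;> simp [headBit]

lemma headBit_of_not_isRow (ω : ShiftParam n) (p : BitString (n + n)) (g : BitString n → Bool)
    {m : BitString (n + n + 2)} (h : m 1 = false) (hm : ¬ IsRow ω.1 m) :
    headBit ω.1 ω.2 p g m = false := by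
  unfold headBit
  cases h0 : m 0
  · rw [h]
  · rw [h]
    change (if _ then _ else _) = _
    split_ifs with h1
    · have : leftHalf (body m) = ⊥ := by
        by_contra h2
        exact hm ⟨h0, h, h2, h1⟩
      rw [this]
      exact sgn_injective ((sgn_dot _ _).trans (chi_zero_left _))
    · rfl

/-- On a set of messages that is not exposed, the first bits of the tags are distributed as
independent bits which do not depend on `(A, w)` and `p`. -/
lemma expect_headBit (ω : ShiftParam n) (p : BitString (n + n))
    {s : Finset (BitString (n + n + 2))} (hs : ¬ Exposed ω s)
    (φ : (BitString (n + n + 2) → Bool) → ℝ)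
    (hφ : ∀ τ τ', (∀ m ∈ s, τ m = τ' m) → φ τ = φ τ') :
    𝔼 g, φ (headBit ω.1 ω.2 p g) = 𝔼 h : BitString (n + n + 2) → Bool, φ fun m => m 1 && h m := by
  let T : Set (BitString (n + n + 2)) := {m | m ∈ s ∧ m 1 = true}
  have hinj : Set.InjOn (label ω) T := by
    intro m hm m' hm' h
    by_contra hne
    exact hs (Or.inl ⟨m, hm.1, m', hm'.1, hne, hm.2, hm'.2, h⟩)
  let ext : (BitString (n + n + 2) → Bool) → BitString n → Bool :=
    fun h u => h (Function.invFunOn (label ω) T u)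
  have hext : ∀ h m, m ∈ T → ext h (label ω m) = h m := fun h m hm =>
    congrArg h (hinj.leftInvOn_invFunOn hm)
  let v : BitString (n + n + 2) → Bool := fun m => m 0 && dot p (body m)
  -- a translation of `g` makes its values on the labels independent of everything else
  calc 𝔼 g, φ (headBit ω.1 ω.2 p g)
      = 𝔼 h : BitString (n + n + 2) → Bool, 𝔼 g,
          φ (headBit ω.1 ω.2 p (xorEquiv (ext h) g)) := by
        rw [Finset.expect_congr rfl fun h _ => Fintype.expect_equiv (xorEquiv (ext h)) _
          (fun g => φ (headBit ω.1 ω.2 p g)) fun g => rfl, Fintype.expect_const]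
    _ = 𝔼 h : BitString (n + n + 2) → Bool, 𝔼 g : BitString n → Bool,
          φ fun m => m 1 && (h m ^^ (g (label ω m) ^^ v m)) := by
        refine Finset.expect_congr rfl fun h _ => Finset.expect_congr rfl fun g _ => hφ _ _ ?_
        intro m hm
        cases h1 : m 1
        · rw [headBit_of_not_isRow ω p _ h1 fun h2 => hs (Or.inr ⟨m, hm, h2⟩)]; rfl
        · rw [headBit_of_one ω p _ h1, xorEquiv_apply, hext h m ⟨hm, h1⟩, Bool.true_and]
          change (_ ^^ v m) = _
          cases h m <;> cases g (label ω m) <;> cases v m <;> rfl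
    _ = 𝔼 g : BitString n → Bool, 𝔼 h : BitString (n + n + 2) → Bool,
          φ fun m => m 1 && (h m ^^ (g (label ω m) ^^ v m)) := Finset.expect_comm _ _ _
    _ = _ := by
        rw [Finset.expect_congr rfl fun g _ => Fintype.expect_equiv
          (xorEquiv fun m => g (label ω m) ^^ v m) _
          (fun h : BitString (n + n + 2) → Bool => φ fun m => m 1 && h m) fun h => rfl,
          Fintype.expect_const]

end HeadBit

/-! ### Exposed sets are unlikely -/

section Exposed

variable {n : ℕ}

lemma expect_ite_eq_of_shift {Z : Type*} [Fintype Z] [Nonempty Z] (φ : Z → BitString n)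
    (e : BitString n → Z ≃ Z) (hφ : ∀ r z, φ (e r z) = xorEquiv r (φ z)) (c : BitString n) :
    𝔼 z, (if φ z = c then (1 : ℝ) else 0) = 1 / 2 ^ n := by
  simpa using expect_ite_eq_mul_of_shift φ (fun _ => 1) e hφ (fun _ _ => rfl) c

/-- Exclusive or of a matrix with a fixed matrix. -/
def xorMatrix (D : Fin n → BitString n) : (Fin n → BitString n) ≃ (Fin n → BitString n) :=
  Function.Involutive.toPerm (fun A i => xorEquiv (D i) (A i)) fun A => by
    funext i j
    simp

open Classical in
lemma expect_label_eq_le {m m' : BitString (n + n + 2)} (hne : m ≠ m') (h1 : m 1 = true)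
    (h1' : m' 1 = true) :
    𝔼 ω : ShiftParam n, (if label ω m = label ω m' then (1 : ℝ) else 0) ≤ 1 / 2 ^ n := by
  let Φ : ShiftParam n → BitString n := fun ω i => label ω m i ^^ label ω m' i
  have hΦ : ∀ ω, label ω m = label ω m' ↔ Φ ω = ⊥ := fun ω => (xor_eq_zero_iff _ _).symm
  have e : 𝔼 ω : ShiftParam n, (if label ω m = label ω m' then (1 : ℝ) else 0)
      = 𝔼 ω : ShiftParam n, (if Φ ω = ⊥ then (1 : ℝ) else 0) :=
    Finset.expect_congr rfl fun ω _ => by simp only [hΦ]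
  by_cases h0 : m 0 = m' 0
  · by_cases hr : rightHalf (body m) = rightHalf (body m')
    · refine le_trans (le_of_eq (Finset.expect_eq_zero fun ω _ => if_neg fun h => hne ?_))
        (by positivity)
      rw [← mkMsg_body m, ← mkMsg_body m', h0, h1, h1']
      congr 1
      have hl : leftHalf (body m) = leftHalf (body m') := by
        funext i
        have := congrFun h i
        simpa [label, lin, h0, hr] using this
      funext i
      exact Fin.addCases (fun i => congrFun hl i) (fun i => congrFun hr i) i
    · obtain ⟨j, hj⟩ := Function.ne_iff.1 hr
      rw [e]
      refine le_of_eq (expect_ite_eq_of_shift Φ (fun r => Equiv.prodCongr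
        (xorMatrix fun i k => r i && decide (k = j)) (Equiv.refl _)) (fun r ω => ?_) ⊥)
      funext i
      have hd : ∀ x, dot (xorMatrix (fun i k => r i && decide (k = j)) ω.1 i) x
          = (dot (ω.1 i) x ^^ (r i && x j)) := fun x => dot_xor_single _ _ _ _
      simp only [Φ, label, lin, matVec, Equiv.prodCongr_apply, Prod.map, Equiv.refl_apply, hd, h0,
        xorEquiv_apply]
      have hj' : rightHalf (body m') j = !rightHalf (body m) j := by
        revert hj; cases rightHalf (body m) j <;> cases rightHalf (body m') j <;> simp
      rw [hj']
      generalize rightHalf (body m) j = u1, leftHalf (body m) i = u2, leftHalf (body m') i = u3,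
        dot (ω.1 i) _ = u4, dot (ω.1 i) _ = u5, r i = u6, (m' 0 && ω.2 i) = u7
      revert u1 u2 u3 u4 u5 u6 u7
      decide
  · rw [e]
    refine le_of_eq (expect_ite_eq_of_shift Φ (fun r => Equiv.prodCongr
      (Equiv.refl _) (xorEquiv r)) (fun r ω => ?_) ⊥)
    funext i
    have h0' : m' 0 = !m 0 := by
      revert h0; cases m 0 <;> cases m' 0 <;> simp
    simp only [Φ, label, Equiv.prodCongr_apply, Prod.map, Equiv.refl_apply, xorEquiv_apply, h0']
    generalize lin ω.1 (body m) i = u1, lin ω.1 (body m') i = u2, m 0 = u3, ω.2 i = u4, r i = u5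
    revert u1 u2 u3 u4 u5
    decide

open Classical in
lemma expect_isRow_le (m : BitString (n + n + 2)) :
    𝔼 ω : ShiftParam n, (if IsRow ω.1 m then (1 : ℝ) else 0) ≤ 1 / 2 ^ n := by
  by_cases hz : leftHalf (body m) = ⊥
  · refine le_trans (le_of_eq (Finset.expect_eq_zero fun ω _ => if_neg fun h => h.2.2.1 hz))
      (by positivity)
  · obtain ⟨j, hj⟩ := Function.ne_iff.1 hz
    set z := leftHalf (body m) with hzdef
    have hj : z j = true := by simpa using hj
    refine le_trans (Finset.expect_le_expect (g := fun ω : ShiftParam n =>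
      if vecMat ω.1 z = rightHalf (body m) then (1 : ℝ) else 0) fun ω _ => ?_)
      (le_of_eq (expect_ite_eq_of_shift (fun ω : ShiftParam n => vecMat ω.1 z)
        (fun r => Equiv.prodCongr
        (xorMatrix fun i k => r k && decide (i = j)) (Equiv.refl _)) (fun r ω => ?_) _))
    · split_ifs with h h' h'
      · exact le_rfl
      · exact absurd h.2.2.2.symm h'
      · exact zero_le_one
      · exact le_rfl
    · funext k
      have hd := dot_xor_single (fun i => ω.1 i k) z (r k) j
      rw [hj, Bool.and_true, dot_comm _ z, dot_comm _ z] at hd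
      exact hd

open Classical in
/-- Adding a message to a set is unlikely to expose it. -/
lemma expect_exposed_insert_le (s : Finset (BitString (n + n + 2))) (m : BitString (n + n + 2)) :
    𝔼 ω : ShiftParam n, (if ¬ Exposed ω s ∧ Exposed ω (insert m s) then (1 : ℝ) else 0)
      ≤ (s.card + 1) / 2 ^ n := by
  calc _ ≤ 𝔼 ω : ShiftParam n, ((∑ m' ∈ s,
        if m ≠ m' ∧ m 1 = true ∧ m' 1 = true ∧ label ω m = label ω m' then (1 : ℝ) else 0) +
        if IsRow ω.1 m then 1 else 0) := by
        refine Finset.expect_le_expect fun ω _ => ?_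
        have hnn : ∀ m' ∈ s, (0 : ℝ) ≤
            if m ≠ m' ∧ m 1 = true ∧ m' 1 = true ∧ label ω m = label ω m' then (1 : ℝ) else 0 :=
          fun m' _ => by split_ifs <;> norm_num
        have hnn' : (0 : ℝ) ≤ if IsRow ω.1 m then 1 else 0 := by split_ifs <;> norm_num
        have hcoll : ∀ m' ∈ s, m ≠ m' → m 1 = true → m' 1 = true → label ω m = label ω m' →
            (1 : ℝ) ≤ (∑ m' ∈ s, if m ≠ m' ∧ m 1 = true ∧ m' 1 = true ∧ label ω m = label ω m'
              then (1 : ℝ) else 0) + if IsRow ω.1 m then 1 else 0 := by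
          intro m' hm' h1 h2 h3 h4
          have := Finset.single_le_sum hnn hm'
          rw [if_pos ⟨h1, h2, h3, h4⟩] at this
          linarith
        by_cases h : ¬ Exposed ω s ∧ Exposed ω (insert m s)
        · rw [if_pos h]
          obtain ⟨h1, h2⟩ := h
          rcases h2 with ⟨a, ha, b, hb, hab, ha1, hb1, hl⟩ | ⟨a, ha, hrow⟩
          · rcases Finset.mem_insert.1 ha with rfl | ha'
            · rcases Finset.mem_insert.1 hb with rfl | hb'
              · exact absurd rfl hab
              · exact hcoll b hb' hab ha1 hb1 hl
            · rcases Finset.mem_insert.1 hb with rfl | hb'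
              · exact hcoll a ha' hab.symm hb1 ha1 hl.symm
              · exact absurd (Or.inl ⟨a, ha', b, hb', hab, ha1, hb1, hl⟩) h1
          · rcases Finset.mem_insert.1 ha with rfl | ha'
            · have := Finset.sum_nonneg hnn
              rw [if_pos hrow]
              linarith
            · exact absurd (Or.inr ⟨a, ha', hrow⟩) h1
        · rw [if_neg h]
          exact add_nonneg (Finset.sum_nonneg hnn) hnn'
    _ ≤ (∑ m' ∈ s, 1 / 2 ^ n) + 1 / 2 ^ n := by
        rw [Finset.expect_add_distrib, Finset.expect_sum_comm]
        refine add_le_add (Finset.sum_le_sum fun m' _ => ?_) (expect_isRow_le m)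
        by_cases h : m ≠ m' ∧ m 1 = true ∧ m' 1 = true
        · refine le_trans (Finset.expect_le_expect fun ω _ => ?_)
            (expect_label_eq_le h.1 h.2.1 h.2.2)
          by_cases hl : label ω m = label ω m'
          · simp [hl, h]
          · simp [hl]
        · refine le_trans (le_of_eq (Finset.expect_eq_zero fun ω _ => if_neg fun h' =>
            h ⟨h'.1, h'.2.1, h'.2.2.1⟩)) (by positivity)
    _ = _ := by
        rw [Finset.sum_const, nsmul_eq_mul]; ring

end Exposed

/-! ### The top weight does not find the special message -/

namespace PhaseAlgorithm

variable {n : ℕ} {B : Type*} [Fintype B] (P : PhaseAlgorithm B (BitString (n + n + 2)) (Fin n))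

/-- The mass of a coefficient of top weight, when the first bits of the tags of all messages whose
second bit is `1` are independent random bits. -/
def refMass (j : ℕ) (α : BitString (n + n + 2) → Fin n → Bool) (b : B) : ℝ :=
  𝔼 h : BitString (n + n + 2) → Bool, ‖P.topCoeff (fun m => m 1 && h m) j α b‖ ^ 2

lemma refMass_nonneg (j : ℕ) (α : BitString (n + n + 2) → Fin n → Bool) (b : B) :
    0 ≤ P.refMass j α b :=
  Finset.expect_nonneg fun _ _ => by positivity

lemma sum_refMass_le (j : ℕ) : ∑ α, ∑ b, P.refMass j α b ≤ 1 := by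
  simp only [refMass, ← Finset.expect_sum_comm]
  exact Finset.expect_le Finset.univ_nonempty fun h _ => P.sum_norm_topCoeff_le _ j

open Classical in
/-- On characters with unexposed support, the distribution of the coefficients of top weight does not
depend on `(A, w)` and `p`. -/
lemma expect_unexposed_le (p : BitString (n + n)) (j : ℕ)
    (E : ShiftParam n → (BitString (n + n + 2) → Fin n → Bool) → B → Prop)
    (c : (BitString (n + n + 2) → Fin n → Bool) → B → ℝ)
    (hc : ∀ α b, 𝔼 ω : ShiftParam n,
      (if ¬ Exposed ω (supp α) ∧ E ω α b then (1 : ℝ) else 0) ≤ c α b) :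
    𝔼 ω : ShiftParam n, 𝔼 g, ∑ α, ∑ b, (if ¬ Exposed ω (supp α) ∧ E ω α b then
      ‖P.topCoeff (headBit ω.1 ω.2 p g) j α b‖ ^ 2 else 0) ≤ ∑ α, ∑ b, c α b * P.refMass j α b := by
  have e : ∀ (ω : ShiftParam n) α b, 𝔼 g, (if ¬ Exposed ω (supp α) ∧ E ω α b then
      ‖P.topCoeff (headBit ω.1 ω.2 p g) j α b‖ ^ 2 else 0)
      = (if ¬ Exposed ω (supp α) ∧ E ω α b then 1 else 0) * P.refMass j α b := by
    intro ω α b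
    split_ifs with h
    · rw [one_mul, refMass]
      exact expect_headBit ω p h.1 (fun τ => ‖P.topCoeff τ j α b‖ ^ 2) fun τ τ' hτ => by
        simp only [P.topCoeff_congr j hτ]
    · rw [zero_mul, Finset.expect_const_zero]
  simp only [Finset.expect_sum_comm, e, ← Finset.expect_mul]
  exact Finset.sum_le_sum fun α _ => Finset.sum_le_sum fun b _ =>
    mul_le_mul_of_nonneg_right (hc α b) (P.refMass_nonneg j α b)

lemma supp_update_subset {X ι : Type*} [Fintype X] [DecidableEq X] [Fintype ι] (α : X → ι → Bool)
    (x : X) (c : ι → Bool) : supp (Function.update α x c) ⊆ insert x (supp α) := by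
  intro y hy
  by_cases h : y = x
  · simp [h]
  · simpa [h] using hy

open Classical in
/-- The mass of the characters with exposed support grows slowly. -/
lemma expect_exposed_le (p : BitString (n + n)) (j : ℕ) :
    𝔼 ω : ShiftParam n, 𝔼 g, ∑ α, ∑ b, (if Exposed ω (supp α) then
      ‖P.topCoeff (headBit ω.1 ω.2 p g) j α b‖ ^ 2 else 0) ≤ j * (j + 1) / 2 ^ n := by
  induction j with
  | zero =>
    refine le_of_eq ?_
    simp only [Nat.cast_zero, zero_mul, zero_div]
    refine Finset.expect_eq_zero fun ω _ => Finset.expect_eq_zero fun g _ =>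
      Finset.sum_eq_zero fun α _ => Finset.sum_eq_zero fun b _ => ?_
    split_ifs with h
    · have : α ≠ ⊥ := by
        rintro rfl
        rw [supp_bot] at h
        exact not_exposed_empty ω h
      simp [topCoeff, this]
    · rfl
  | succ j ih =>
    have hstep : ∀ (ω : ShiftParam n) g, ∑ α, ∑ b, (if Exposed ω (supp α) then
        ‖P.topCoeff (headBit ω.1 ω.2 p g) (j + 1) α b‖ ^ 2 else 0)
        ≤ (∑ α, ∑ b, if Exposed ω (supp α) then
          ‖P.topCoeff (headBit ω.1 ω.2 p g) j α b‖ ^ 2 else 0) +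
        ∑ α, ∑ b, if ¬ Exposed ω (supp α) ∧ Exposed ω (insert (P.pt b) (supp α)) then
          ‖P.topCoeff (headBit ω.1 ω.2 p g) j α b‖ ^ 2 else 0 := by
      intro ω g
      have := P.sum_topCoeff_succ_le (headBit ω.1 ω.2 p g)
        (fun α => if Exposed ω (supp α) then 1 else 0) (fun α => by split_ifs <;> norm_num) j
      simp only [ite_mul, one_mul, zero_mul] at this
      refine this.trans ?_
      rw [← Finset.sum_add_distrib]
      refine Finset.sum_le_sum fun α _ => ?_
      rw [← Finset.sum_add_distrib]
      refine Finset.sum_le_sum fun b _ => ?_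
      have hnn : 0 ≤ ‖P.topCoeff (headBit ω.1 ω.2 p g) j α b‖ ^ 2 := by positivity
      have himp : Exposed ω (supp (Function.update α (P.pt b) (P.ch b))) →
          Exposed ω (insert (P.pt b) (supp α)) := fun h => h.mono (supp_update_subset _ _ _)
      split_ifs <;> first | linarith | (exfalso; tauto)
    have hnew := P.expect_unexposed_le p j
      (fun ω α b => Exposed ω (insert (P.pt b) (supp α))) (fun α b => ((supp α).card + 1) / 2 ^ n)
      fun α b => expect_exposed_insert_le _ _
    have hmass : ∑ α, ∑ b, (((supp α).card + 1 : ℝ) / 2 ^ n) * P.refMass j α b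
        ≤ (j + 1) / 2 ^ n := by
      calc _ ≤ ∑ α, ∑ b, ((j + 1 : ℝ) / 2 ^ n) * P.refMass j α b := by
            refine Finset.sum_le_sum fun α _ => Finset.sum_le_sum fun b _ => ?_
            by_cases h : (supp α).card ≤ j
            · have h' : ((supp α).card : ℝ) ≤ j := by exact_mod_cast h
              have := P.refMass_nonneg j α b
              gcongr
            · have : P.refMass j α b = 0 := Finset.expect_eq_zero fun _ _ => by
                rw [P.topCoeff_eq_zero _ (not_le.1 h)]; simp
              rw [this, mul_zero, mul_zero]
        _ ≤ _ := by
            simp only [← Finset.mul_sum]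
            exact mul_le_of_le_one_right (by positivity) (P.sum_refMass_le j)
    calc _ ≤ _ := Finset.expect_le_expect fun ω _ => Finset.expect_le_expect fun g _ => hstep ω g
      _ ≤ j * (j + 1) / 2 ^ n + (j + 1) / 2 ^ n := by
          simp only [Finset.expect_add_distrib]
          exact add_le_add ih (hnew.trans hmass)
      _ ≤ _ := by
          rw [← add_div]
          push_cast
          gcongr
          nlinarith

/-- The coefficients of top weight carry almost no information on the special message. -/
lemma expect_special_le {q : ℕ} (msg : B → Fin (q + 1) → BitString (n + n + 2)) :
    𝔼 ω : ShiftParam n, 𝔼 p : BitString (n + n), 𝔼 g, ∑ α, ∑ b,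
      (if ∃ i, msg b i = mkMsg false false p then
        ‖P.topCoeff (headBit ω.1 ω.2 p g) q α b‖ ^ 2 else 0)
      ≤ q * (q + 1) / 2 ^ n + (q + 1) / 2 ^ (n + n) := by
  classical
  have hp : ∀ b, 𝔼 p : BitString (n + n), (if ∃ i, msg b i = mkMsg false false p then (1 : ℝ) else 0)
      ≤ (q + 1) / 2 ^ (n + n) := by
    intro b
    have hi : ∀ i, 𝔼 p : BitString (n + n), (if msg b i = mkMsg false false p then (1 : ℝ) else 0)
        ≤ 1 / 2 ^ (n + n) := by
      intro i
      refine le_trans (Finset.expect_le_expect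
        (g := fun p => if p = body (msg b i) then (1 : ℝ) else 0) fun p _ => ?_) (le_of_eq ?_)
      · split_ifs with h h' h'
        · exact le_rfl
        · exact absurd (by rw [h, body_mkMsg]) h'
        · exact zero_le_one
        · exact le_rfl
      · simp
    calc _ ≤ 𝔼 p : BitString (n + n), ∑ i, (if msg b i = mkMsg false false p then (1 : ℝ) else 0) := by
          refine Finset.expect_le_expect fun p _ => ?_
          have hnn : ∀ i ∈ Finset.univ, (0 : ℝ) ≤ if msg b i = mkMsg false false p then 1 else 0 :=
            fun i _ => by split_ifs <;> norm_num
          split_ifs with h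
          · obtain ⟨i, hi⟩ := h
            refine le_trans (le_of_eq (if_pos hi).symm) (Finset.single_le_sum hnn (Finset.mem_univ i))
          · exact Finset.sum_nonneg hnn
      _ ≤ ∑ i : Fin (q + 1), (1 / 2 ^ (n + n) : ℝ) := by
          rw [Finset.expect_sum_comm]
          exact Finset.sum_le_sum fun i _ => hi i
      _ = _ := by
          rw [Finset.sum_const, Finset.card_univ, Fintype.card_fin, nsmul_eq_mul]
          push_cast
          ring
  have hfix : ∀ p : BitString (n + n), 𝔼 ω : ShiftParam n, 𝔼 g, ∑ α, ∑ b,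
      (if ∃ i, msg b i = mkMsg false false p then
        ‖P.topCoeff (headBit ω.1 ω.2 p g) q α b‖ ^ 2 else 0)
      ≤ q * (q + 1) / 2 ^ n + ∑ α, ∑ b,
        (if ∃ i, msg b i = mkMsg false false p then 1 else 0) * P.refMass q α b := by
    intro p
    have h1 := P.expect_exposed_le p q
    have h2 := P.expect_unexposed_le p q (fun _ _ b => ∃ i, msg b i = mkMsg false false p)
      (fun _ b => if ∃ i, msg b i = mkMsg false false p then 1 else 0) fun α b => by
        refine Finset.expect_le Finset.univ_nonempty fun ω _ => ?_
        split_ifs with h h' h'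
        · exact le_rfl
        · exact absurd h.2 h'
        · exact zero_le_one
        · exact le_rfl
    refine le_trans ?_ (add_le_add h1 h2)
    simp only [← Finset.expect_add_distrib, ← Finset.sum_add_distrib]
    refine Finset.expect_le_expect fun ω _ => Finset.expect_le_expect fun g _ =>
      Finset.sum_le_sum fun α _ => Finset.sum_le_sum fun b _ => ?_
    have hnn : 0 ≤ ‖P.topCoeff (headBit ω.1 ω.2 p g) q α b‖ ^ 2 := by positivity
    split_ifs <;> first | linarith | (exfalso; tauto)
  rw [Finset.expect_comm]
  refine (Finset.expect_le_expect fun p _ => hfix p).trans ?_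
  rw [Finset.expect_add_distrib, Fintype.expect_const]
  refine add_le_add le_rfl ?_
  simp only [Finset.expect_sum_comm, ← Finset.expect_mul]
  calc _ ≤ ∑ α, ∑ b, ((q + 1 : ℝ) / 2 ^ (n + n)) * P.refMass q α b :=
        Finset.sum_le_sum fun α _ => Finset.sum_le_sum fun b _ =>
          mul_le_mul_of_nonneg_right (hp b) (P.refMass_nonneg q α b)
    _ ≤ _ := by
        simp only [← Finset.mul_sum]
        exact mul_le_of_le_one_right (by positivity) (P.sum_refMass_le q)

end PhaseAlgorithm

/-! ### From query algorithms to phase algorithms -/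

section Fourier

variable {N : ℕ}

lemma fourier_fourier (ξ : BitString N → ℂ) : fourier (fourier ξ) = ξ := by
  funext x
  have e : ∀ u : BitString N, (chi x u : ℂ) *
      (((1 / Real.sqrt 2 : ℝ) : ℂ) ^ N * ∑ v : BitString N, (chi u v : ℂ) * ξ v)
      = ∑ v : BitString N, ((1 / Real.sqrt 2 : ℝ) : ℂ) ^ N * ξ v *
        ((chi u x * chi u v : ℝ) : ℂ) := by
    intro u
    rw [Finset.mul_sum, Finset.mul_sum]
    refine Finset.sum_congr rfl fun v _ => ?_
    rw [chi_comm x u]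
    push_cast
    ring
  simp only [fourier, e]
  rw [Finset.sum_comm]
  simp only [← Finset.mul_sum, ← Complex.ofReal_sum, sum_chi_mul_chi]
  rw [Finset.sum_eq_single x]
  · rw [if_pos rfl, Fintype.card_fin, mul_comm _ (ξ x), mul_assoc, mul_left_comm, ← mul_assoc _ _
      (((2 : ℝ) ^ N : ℝ) : ℂ), invSqrtTwo_pow_mul_self]
    push_cast
    rw [← mul_pow]
    norm_num
  · intro v _ hv
    rw [if_neg hv.symm]; simp
  · simp

lemma sum_norm_fourier (ξ : BitString N → ℂ) : ∑ u, ‖fourier ξ u‖ ^ 2 = ∑ u, ‖ξ u‖ ^ 2 := by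
  have key : ∑ u, fourier ξ u * starRingEnd ℂ (fourier ξ u) = ∑ v, ξ v * starRingEnd ℂ (ξ v) := by
    have e : ∀ u, fourier ξ u * starRingEnd ℂ (fourier ξ u) = ∑ v,
        ((1 / Real.sqrt 2 : ℝ) : ℂ) ^ N * ((chi v u : ℂ) * fourier ξ u) * starRingEnd ℂ (ξ v) := by
      intro u
      conv_lhs => rw [fourier.eq_def ξ u]
      rw [map_mul, map_pow, Complex.conj_ofReal, map_sum]
      change fourier ξ u * _ = _
      rw [Finset.mul_sum, Finset.mul_sum]
      refine Finset.sum_congr rfl fun v _ => ?_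
      rw [map_mul, Complex.conj_ofReal, chi_comm]
      ring
    rw [Finset.sum_congr rfl fun u _ => e u, Finset.sum_comm]
    refine Finset.sum_congr rfl fun v _ => ?_
    rw [← Finset.sum_mul, ← Finset.mul_sum]
    exact congrArg (· * _) (congrFun (fourier_fourier ξ) v)
  simp only [Complex.mul_conj, Complex.normSq_eq_norm_sq] at key
  exact_mod_cast key

/-- The Fourier transform turns a translation into a phase. -/
lemma fourier_xor (ξ : BitString N → ℂ) (c u : BitString N) :
    fourier (fun y => ξ (y.xor c)) u = chi u c * fourier ξ u := by
  simp only [fourier]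
  rw [mul_left_comm, Finset.mul_sum (a := (chi u c : ℂ)), ← Equiv.sum_comp (xorEquiv c)]
  congr 1
  refine Finset.sum_congr rfl fun y _ => ?_
  have h1 : BitString.xor (xorEquiv c y) c = y := (xorEquiv c).left_inv y
  have h2 : chi u (xorEquiv c y) = chi u y * chi u c := chi_xor_right _ _ _
  rw [h1, h2]
  push_cast
  ring

end Fourier

lemma sum_norm_mulVec {β : Type*} [Fintype β] [DecidableEq β] (U : Matrix.unitaryGroup β ℂ)
    (v : β → ℂ) : ∑ b, ‖U.1.mulVec v b‖ ^ 2 = ∑ b, ‖v b‖ ^ 2 := by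
  have h : ∀ u : β → ℂ, star u ⬝ᵥ u = ((∑ b, ‖u b‖ ^ 2 : ℝ) : ℂ) := by
    intro u
    rw [dotProduct, Complex.ofReal_sum]
    refine Finset.sum_congr rfl fun b _ => ?_
    rw [Pi.star_apply, mul_comm]
    exact (Complex.mul_conj _).trans (by rw [Complex.normSq_eq_norm_sq])
  have h2 : star (U.1.mulVec v) ⬝ᵥ U.1.mulVec v = star v ⬝ᵥ v := by
    rw [Matrix.star_mulVec, Matrix.dotProduct_mulVec, Matrix.vecMul_vecMul]
    have : U.1.conjTranspose * U.1 = 1 := Matrix.mem_unitaryGroup_iff'.1 U.2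
    rw [this, Matrix.vecMul_one]
  rw [h, h] at h2
  exact_mod_cast h2

namespace QueryAlgorithm

/-- The Fourier transform of the query output register. -/
def outFourier (m t d : ℕ) : (QueryBasis m t d → ℂ) →ₗ[ℂ] (QueryBasis m t d → ℂ) where
  toFun ψ := fun b => fourier (fun y => ψ (b.1, y, b.2.2)) b.2.1
  map_add' ψ φ := by
    funext b
    simp only [fourier, Pi.add_apply, mul_add, Finset.sum_add_distrib]
  map_smul' c ψ := by
    funext b
    simp only [fourier, Pi.smul_apply, smul_eq_mul, RingHom.id_apply, Finset.mul_sum]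
    exact Finset.sum_congr rfl fun _ _ => by ring

lemma outFourier_outFourier {m t d : ℕ} (ψ : QueryBasis m t d → ℂ) :
    outFourier m t d (outFourier m t d ψ) = ψ := by
  funext b
  exact congrFun (fourier_fourier fun y => ψ (b.1, y, b.2.2)) b.2.1

lemma sum_norm_outFourier {m t d : ℕ} (ψ : QueryBasis m t d → ℂ) :
    ∑ b, ‖outFourier m t d ψ b‖ ^ 2 = ∑ b, ‖ψ b‖ ^ 2 := by
  simp only [Fintype.sum_prod_type]
  refine Finset.sum_congr rfl fun x _ => ?_
  rw [Finset.sum_comm]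
  conv_rhs => rw [Finset.sum_comm]
  exact Finset.sum_congr rfl fun d _ => sum_norm_fourier fun y => ψ (x, y, d)

variable {m n q : ℕ} (A : QueryAlgorithm m (n + 1) q)

/-- The change of basis of the state after `j` queries: the query output register is Fourier
transformed, except after the last query. -/
def basisChange (j : ℕ) : (QueryBasis m (n + 1) A.workspace → ℂ) →ₗ[ℂ]
    (QueryBasis m (n + 1) A.workspace → ℂ) :=
  if j = q then LinearMap.id else outFourier m (n + 1) A.workspace

lemma sum_norm_basisChange (j : ℕ) (ψ : QueryBasis m (n + 1) A.workspace → ℂ) :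
    ∑ b, ‖A.basisChange j ψ b‖ ^ 2 = ∑ b, ‖ψ b‖ ^ 2 := by
  unfold basisChange
  split_ifs
  · rfl
  · exact sum_norm_outFourier ψ

/-- A query algorithm, with the query output register in the Fourier basis before each query. -/
def toPhase : PhaseAlgorithm (QueryBasis m (n + 1) A.workspace) (BitString m) (Fin n) where
  pt b := b.1
  hd b := b.2.1 0
  ch b := fun i => b.2.1 i.succ
  V j := A.basisChange (j + 1) ∘ₗ (A.U (j + 1)).1.mulVecLin ∘ₗ outFourier m (n + 1) A.workspace
  isometry j ψ := by
    simp only [LinearMap.comp_apply, Matrix.mulVecLin_apply]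
    rw [sum_norm_basisChange, sum_norm_mulVec, sum_norm_outFourier]
  init := A.basisChange 0 ((A.U 0).1.mulVec (Pi.single (fun _ => false, fun _ => false, 0) 1))
  norm_init := by
    rw [sum_norm_basisChange, sum_norm_mulVec, Finset.sum_eq_single
      ((fun _ => false, fun _ => false, 0) : QueryBasis m (n + 1) A.workspace)]
    · simp
    · intro b _ hb; simp [hb]
    · simp

lemma chi_cons {N : ℕ} (η : BitString (N + 1)) (a : Bool) (v : BitString N) :
    chi η (Fin.cons (α := fun _ => Bool) a v : Fin (N + 1) → Bool)
      = sgn (η 0 && a) * chi (fun i => η i.succ) v := by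
  simp [chi, Fin.prod_univ_succ]

/-- The special message `s`, whose tag is `0…0`, is handled by the label `⊥`. -/
lemma state_toPhase (s : BitString m) (τ : BitString m → Bool) (f : BitString m → BitString n)
    (hτ : τ s = false) (F : BitString m → BitString (n + 1))
    (hF : ∀ x, F x = if x = s then fun _ => false else Fin.cons (α := fun _ => Bool) (τ x) (f x))
    {j : ℕ} (hj : j ≤ q) :
    A.toPhase.state τ (fun b => if b.1 = s then ⊥ else A.toPhase.ch b) f j
      = A.basisChange j (A.state F j) := by
  induction j with
  | zero => rfl
  | succ j ih =>
    have hphase : (fun b : QueryBasis m (n + 1) A.workspace => (sgn (b.2.1 0 && τ b.1) : ℂ) *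
        ((chi (if b.1 = s then ⊥ else A.toPhase.ch b) (f b.1) : ℂ) *
          outFourier m (n + 1) A.workspace (A.state F j) b))
        = outFourier m (n + 1) A.workspace fun b => A.state F j (b.1, b.2.1.xor (F b.1), b.2.2) := by
      funext b
      refine Eq.trans ?_
        (fourier_xor (fun y => A.state F j (b.1, y, b.2.2)) (F b.1) b.2.1).symm
      change _ * (_ * fourier (fun y => A.state F j (b.1, y, b.2.2)) b.2.1) = _
      rw [← mul_assoc, ← Complex.ofReal_mul]
      congr 2
      rw [hF]
      split_ifs with h
      · rw [h, hτ, Bool.and_false, sgn_false, one_mul, chi_zero_right]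
        exact chi_zero_left _
      · rw [chi_cons]; rfl
    have hb : A.basisChange j = outFourier m (n + 1) A.workspace := if_neg (by omega)
    have hih := ih (by omega)
    rw [hb] at hih
    simp only [PhaseAlgorithm.state, hih]
    refine (congrArg (A.toPhase.V j) hphase).trans ?_
    change A.basisChange (j + 1) ((A.U (j + 1)).1.mulVec (outFourier m (n + 1) A.workspace _)) = _
    rw [outFourier_outFourier]
    rfl

end QueryAlgorithm

/-! ### Security of the hidden shift MAC -/

lemma expectKey_multiForgeProb_le {n q : ℕ}
    (A : QueryAlgorithm (shiftMAC.msgLen n) (shiftMAC.tagLen n) q) :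
    shiftMAC.expectKey n (multiForgeProb shiftMAC A) ≤ 2 * (q + 2) ^ 2 / 2 ^ n := by
  classical
  have : Nonempty (shiftMAC.Key n) := inferInstanceAs (Nonempty (ShiftKey n))
  rw [expectKey_uniform rfl]
  let A' : QueryAlgorithm (n + n + 2) (n + 1) q := A
  let P := A'.toPhase
  let msg : QueryBasis (n + n + 2) (n + 1) A'.workspace → Fin (q + 1) → BitString (n + n + 2) :=
    fun b i => (A'.out b i).1
  let succ : ShiftKey n → QueryBasis (n + n + 2) (n + 1) A'.workspace → Prop := fun k b =>
    Function.Injective (A'.out b) ∧ ∀ i, shiftTag k (A'.out b i).1 = (A'.out b i).2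
  have hforge : ∀ k : ShiftKey n, multiForgeProb shiftMAC (n := n) A k
      = ∑ b, if succ k b then ‖A'.state (shiftTag k) q b‖ ^ 2 else 0 := by
    intro k
    refine Finset.sum_congr rfl fun b _ => ?_
    congr
  have hkey : ∀ (ω : ShiftParam n) (p : BitString (n + n)) (g : BitString n → Bool),
      𝔼 f : BitString (n + n + 2) → BitString n, multiForgeProb shiftMAC (n := n) A (ω, p, g, f)
      ≤ 2 * ((q + 1) / 2 ^ n) + 2 * ∑ α, ∑ b, if ∃ i, msg b i = mkMsg false false p then
        ‖P.topCoeff (headBit ω.1 ω.2 p g) q α b‖ ^ 2 else 0 := by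
    intro ω p g
    have := P.expect_success_le (headBit ω.1 ω.2 p g) (mkMsg false false p)
      (fun b => if b.1 = mkMsg false false p then ⊥ else P.ch b) (fun b => rfl) msg
      (fun b i k => (A'.out b i).2 k.succ) (fun b f => succ (ω, p, g, f) b) (fun b f h => by
        obtain ⟨h1, h2⟩ := h
        refine ⟨fun i j hij => h1 (Prod.ext hij ?_), fun i hi => ?_⟩
        · rw [← h2 i, ← h2 j]
          exact congrArg _ hij
        · funext k
          rw [← h2 i, shiftTag, if_neg hi, Fin.cons_succ])
    rw [Fintype.card_fin] at this
    refine le_trans (le_of_eq (Finset.expect_congr rfl fun f _ => ?_)) this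
    rw [hforge]
    refine Finset.sum_congr rfl fun b _ => ?_
    rw [A'.state_toPhase (mkMsg false false p) (headBit ω.1 ω.2 p g) f rfl
      (shiftTag (ω, p, g, f)) (fun x => rfl) le_rfl]
    have : A'.basisChange q = LinearMap.id := if_pos rfl
    rw [this]
    rfl
  calc 𝔼 k : ShiftKey n, multiForgeProb shiftMAC (n := n) A k
      = 𝔼 ω : ShiftParam n, 𝔼 p : BitString (n + n), 𝔼 g : BitString n → Bool,
          𝔼 f : BitString (n + n + 2) → BitString n,
          multiForgeProb shiftMAC (n := n) A (ω, p, g, f) := by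
        refine (expect_prod _).trans (Finset.expect_congr rfl fun ω _ => ?_)
        refine (expect_prod _).trans (Finset.expect_congr rfl fun p _ => ?_)
        exact expect_prod _
    _ ≤ 𝔼 ω : ShiftParam n, 𝔼 p : BitString (n + n), 𝔼 g : BitString n → Bool,
          (2 * ((q + 1) / 2 ^ n) + 2 * ∑ α, ∑ b, if ∃ i, msg b i = mkMsg false false p then
            ‖P.topCoeff (headBit ω.1 ω.2 p g) q α b‖ ^ 2 else 0) :=
        Finset.expect_le_expect fun ω _ => Finset.expect_le_expect fun p _ =>
          Finset.expect_le_expect fun g _ => hkey ω p g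
    _ ≤ 2 * ((q + 1) / 2 ^ n) + 2 * (q * (q + 1) / 2 ^ n + (q + 1) / 2 ^ (n + n)) := by
        have := P.expect_special_le msg
        simp only [Finset.expect_add_distrib, ← Finset.mul_expect, Fintype.expect_const]
        gcongr
    _ ≤ 2 * ((q + 1) / 2 ^ n) + 2 * (q * (q + 1) / 2 ^ n + (q + 1) / 2 ^ n) := by
        have : (2 : ℝ) ^ n ≤ 2 ^ (n + n) := pow_le_pow_right₀ one_le_two (by omega)
        gcongr
    _ ≤ _ := by
        rw [← add_div, ← mul_div_assoc, ← mul_div_assoc, ← add_div]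
        gcongr
        nlinarith [(Nat.cast_nonneg q : (0 : ℝ) ≤ q)]

theorem shiftMAC_bzSecure : BZSecure shiftMAC := by
  intro q ⟨R, hR⟩ A
  have hdecay : Asymptotics.SuperpolynomialDecay Filter.atTop (fun n : ℕ => (n : ℝ))
      fun n : ℕ => ((2 : ℝ) ^ n)⁻¹ := fun k => by
    simpa only [div_eq_mul_inv] using
      tendsto_pow_const_div_const_pow_of_one_lt k (one_lt_two : (1 : ℝ) < 2)
  have hpoly := hdecay.polynomial_mul (2 * (R.map (Nat.castRingHom ℝ) + 2) ^ 2)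
  refine hpoly.trans_abs_le fun n => ?_
  have hnn : 0 ≤ shiftMAC.expectKey n (multiForgeProb shiftMAC (A n)) :=
    Finset.sum_nonneg fun k _ => mul_nonneg ENNReal.toReal_nonneg
      (Finset.sum_nonneg fun b _ => by split_ifs <;> positivity)
  rw [abs_of_nonneg hnn]
  refine (expectKey_multiForgeProb_le (A n)).trans (le_trans ?_ (le_abs_self _))
  have hq : (q n : ℝ) ≤ (R.map (Nat.castRingHom ℝ)).eval (n : ℝ) := by
    have h1 : (R.map (Nat.castRingHom ℝ)).eval (n : ℝ) = ((R.eval n : ℕ) : ℝ) := by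
      simp [Polynomial.eval_natCast_map]
    rw [h1]
    exact_mod_cast hR n
  simp only [Polynomial.eval_mul, Polynomial.eval_pow, Polynomial.eval_add, Polynomial.eval_ofNat]
  rw [← div_eq_mul_inv]
  gcongr

end BlindForgery

end

theorem theorem4p3 :
    ¬ BlindForgery.BUSecure BlindForgery.periodicMAC ∧
      ∃ M : BlindForgery.MAC, BlindForgery.BZSecure M ∧ ¬ BlindForgery.BUSecure M := by
  exact ⟨BlindForgery.periodicMAC_not_buSecure, BlindForgery.shiftMAC,
    BlindForgery.shiftMAC_bzSecure, BlindForgery.shiftMAC_not_buSecure⟩
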